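/- **String diagrams.** Let $\mathbb C$ be the category generated by the following objects and arrows. The objects are: a channel $\star$; agents $[n]$ ($n\in\mathbb N$); basic actions $b\colon[p]\rightsquigarrow[n]$ of initial agent $[n]$ and final agent $[p]$, namely left fork $\pi^l_n$, right fork $\pi^r_n$, tick $\heartsuit_n$, silent $\tau_n$, output $o_{n,a,b}$ ($a,b\in n$), all with $p=n$, and channel creation $\nu_n$, input $\iota_{n,a}$ ($a\in n$), with $p=n+1$; forks $\pi_n$; and synchronisations $\tau_{n,a,m,c,d}$ ($a\in n$; $c,d\in m$). The arrows are $s_i\colon\star\to[n]$ ($i\in n$); $s\colon[p]\to b$ and $t\colon[n]\to b$ for each basic action $b$; $l\colon\pi^l_n\to\pi_n$, $r\colon\pi^r_n\to\pi_n$; $\rho\colon\iota_{n,a}\to\tau_{n,a,m,c,d}$, $\epsilon\colon o_{m,c,d}\to\tau_{n,a,m,c,d}$. The equations are $s\circ s_i=t\circ s_i$ ($i\in n$), $l\circ t=r\circ t$, $\rho\circ t\circ s_a=\epsilon\circ t\circ s_c$ and $\rho\circ s\circ s_{n+1}=\epsilon\circ s\circ s_d$. A *diagram* is a presheaf on $\mathbb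 C$; representables are written like their objects. Give $\star$, agents, basic actions, forks, synchronisations the dimensions $0,1,2,3,4$. A *position* is a finite diagram with no elements above dimension $1$; in pairs $(X,D)$ below its channels and $n$-ary agents are finite subsets of $\mathbb N$. An *agent* of $X$ is a pair $(n,x)$ with $x\in X[n]$. The *interface* $I_X$ is the position formed by the channels of $X$ alone. A map is *$1$-injective* if it is injective in positive dimensions. A cospan $Y\to U\leftarrow X$ is written $U\colon Y\rightsquigarrow X$ (from the initial $X$ to the final $Y$); vertical composition $\bullet$ is by pushout; a cell between cospans is a commuting triple of $1$-injective maps. The *seeds* are $[p]\to b\leftarrow[n]$ for basic $b$; $[n]|[n]\to\pi_n\leftarrow[n]$, where the two agents of $[n]|[n]$ share all channels in order; and $Y_0\to\tau_{n,a,m,c,d}\leftarrow X_0$, where $X_0$ is an $m$-ary and an $n$-ary agent sharing the $c$-th channel of the first and the $a$-th of the second, and $Y_0$ is an $m$-ary and an $(n+1)$-ary agent sharing in addition the $d$-th channel of the first and the last of the second. An *action* is the pushout of a seed (all three objects) along a map from the interface of its initial position to a position. *Traces* are cospans isomorphic to finite, possibly empty composites of actions; *views* are cospans isomorphic to finite,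 possibly empty composites of basic seeds. An action is *closed-world* if its seed is $\tau_n$, $\nu_n$, $\heartsuit_n$, $\pi_n$ or $\tau_{n,a,m,c,d}$. **Behaviours.** The category $\mathbb V_{[n]}$ has as objects the views $v\colon[p]\rightsquigarrow[n]$. A morphism $v\to v'$ is a pair $(w,\alpha)$ of a trace $w$ from $[p]$ and a cell $\alpha\colon v\bullet w\to v'$ that is the identity on $[n]$, modulo the equivalence generated by $(w',\alpha\circ(v\bullet\gamma))\sim(w,\alpha)$ for cells $\gamma\colon w'\to w$ that are the identity on $[p]$; the identity is given by empty $w$, and composition is by pasting, after restricting the second trace along the final component of the first cell. For a position $X$, put $\mathbb V_X=\sum_{(n,x)}\mathbb V_{[n]}$, summed over the agents of $X$. A *behaviour* on $X$ is a functor from $\mathbb V_X^{op}$ to the category of finite subsets of $\mathbb N$ and maps; $D\cdot x$ is its component at an agent $x$, and $D\cdot h$ its reindexing along a map $h$ of positions. For a behaviour $B$ on $[n]$, $|B|=B(\mathrm{id})$ is its set of initial states; its residual along $v$ is $(B\cdot v)(w)=B(v\bullet w)$; for $k\in|B|$, $B|_k(v)=\{\sigma\in B(v)\mid\sigma\cdot{!_v}=k\}$,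 where $!_v\colon\mathrm{id}\to v$ is the canonical morphism. $B$ is *definite* if $|B|$ has exactly one element; $D$ on $X$ is definite if every $D\cdot x$ is. Let $\mathsf D_{[n]}$ be the set of definite behaviours on $[n]$. **Graphs with testing.** Let $\Sigma$ be the graph with one vertex, an identity edge $\mathit{id}$ and an edge $\heartsuit$. For a graph $G$ over $\Sigma$ with a relation $z\in(x\mid y)$ on its vertices, write $x\Rightarrow_k y$ if there is a path from $x$ to $y$ with exactly $k$ edges over $\heartsuit$; $x\in\bot$ if every $y$ with $x\Rightarrow_0 y$ admits $z$ with $y\Rightarrow_1 z$; $x\mathrel{\text{⌒}} y$ if $(x\mid y)\neq\emptyset$. *Fair testing equivalence*: $x\sim_G y$ iff $x\mathrel{\text{⌒}} y$ and, for all $z\mathrel{\text{⌒}} x$, some $u\in(x\mid z)$ is in $\bot$ iff some $u\in(y\mid z)$ is in $\bot$. Strong bisimilarity over $\Sigma$ is the usual notion, edges being matched by edges with the same image in $\Sigma$. *$\mathbb S$*: vertices are pairs $(X,D)$ of a position and a definite behaviour on it. Besides identities, there is an edge $(X,D)\to(Y,D')$ for each closed-world action $M\colon Y\rightsquigarrow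 X$ such that for every agent $y$ of $Y$ there is $\sigma\in|D\cdot M\cdot y|$ with $D'\cdot y\cong(D\cdot M\cdot y)|_\sigma$; here $D\cdot M\cdot y=(D\cdot x)\cdot v$, where $v$ is the view of $y$ in $M$, i.e. the essentially unique view with a cell $v\to M$ whose final component is $y$ and whose initial component is an agent $x$ of $X$. The edge lies over $\heartsuit$ if $M$ is a tick, and over $\mathit{id}$ otherwise. Testing: $(Z,D)\in((X_1,D_1)\mid(X_2,D_2))$ iff $X_1(\star)=X_2(\star)$ and there is a pushout $Z=X_1+_{I_{X_1}}X_2$ with injections $i_1,i_2$ such that $D_j\cong D\cdot i_j$ ($j=1,2$). *$\mathbb M$*: vertices are the mixed behaviours, i.e. elements of $\sum_{\gamma\subseteq_{\mathrm{fin}}\mathbb N}\mathrm{Multisets}\bigl(\sum_n\mathsf D_{[n]}\times\gamma^n\bigr)$, written $\gamma\vdash D_1[\sigma_1],\dots,D_k[\sigma_k]$. Edges are generated by - $\gamma\vdash D[\sigma]\xrightarrow{\mathit{id}}\gamma\vdash (D\cdot\pi^l_n)|_i[\sigma],(D\cdot\pi^r_n)|_j[\sigma]$; - $\gamma\vdash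 D[\sigma]\xrightarrow{\mathit{id}}\gamma\vdash(D\cdot\tau_n)|_i[\sigma]$; - $\gamma\vdash D[\sigma]\xrightarrow{\heartsuit}\gamma\vdash(D\cdot\heartsuit_n)|_i[\sigma]$; - $\gamma\vdash D[\sigma]\xrightarrow{\mathit{id}}\gamma\cup\{a\}\vdash(D\cdot\nu_n)|_i[\sigma,a]$ for $a\notin\gamma$; - $\gamma\vdash D_1[\sigma_1],D_2[\sigma_2]\xrightarrow{\mathit{id}}\gamma\vdash(D_1\cdot\iota_{n_1,a_1})|_i[\sigma_1,\sigma_2(b_2)],(D_2\cdot o_{n_2,a_2,b_2})|_j[\sigma_2]$ if $\sigma_1(a_1)=\sigma_2(a_2)$; - if $\gamma_1\vdash S_1\xrightarrow{\alpha}\gamma_2\vdash S_2$ with $\gamma_1\subseteq\gamma_2$, then $\gamma_1\vdash S\cup S_1\xrightarrow{\alpha}\gamma_2\vdash S\cup S_2$ for every multiset $S$ over $\gamma_1$ (viewed over $\gamma_2$ in the target); - identity edges, with $i,j$ ranging over the initial states of the residuals concerned. Testing: $(\gamma\vdash S)\mid(\gamma\vdash S')$ is $\gamma\vdash S\cup S'$,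 and $(\gamma\vdash S)\mid(\gamma'\vdash S')$ is empty if $\gamma\ne\gamma'$. **Proposition.** Let $\mathsf m\colon\mathrm{ob}(\mathbb S)\to\mathrm{ob}(\mathbb M)$ map $(X,D)$ to $X(\star)\vdash[(D\cdot x)[\sigma_x]\mid(n,x)\text{ an agent of }X]$, where $\sigma_x(i)=x\cdot s_i$. Then $\mathsf m$ is intensionally fully abstract for fair testing equivalence: 1. for all vertices $P,Q$ of $\mathbb S$, $P\sim_{\mathbb S}Q$ if and only if $\mathsf m(P)\sim_{\mathbb M}\mathsf m(Q)$; 2. for every mixed behaviour $N$ there is a vertex $P$ of $\mathbb S$ with $\mathsf m(P)\sim_{\mathbb M}N$. Moreover $\mathsf m$ is surjective, and $(X,D)$ and $\mathsf m(X,D)$ are strongly bisimilar over $\Sigma$ for every $(X,D)$. -/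

import Mathlib

open CategoryTheory CategoryTheory.Limits Opposite

noncomputable section

namespace PiTraces

/-! ### The base category of string diagrams -/

/-- Names of the basic seeds.  `Basic p n` collects those with initial agent `[n]` and final agent
`[p]`.  Channel indices range over `Fin n`, i.e. `0, …, n-1`. -/
inductive Basic : ℕ → ℕ → Type
  | forkL (n : ℕ) : Basic n n
  | forkR (n : ℕ) : Basic n n
  | tick (n : ℕ) : Basic n n
  | tau (n : ℕ) : Basic n n
  | out (n : ℕ) (a b : Fin n) : Basic n n
  | nu (n : ℕ) : Basic (n + 1) n
  | inp (n : ℕ) (a : Fin n) : Basic (n + 1) n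

theorem Basic.le {p n : ℕ} : Basic p n → n ≤ p
  | .forkL _ => le_refl _
  | .forkR _ => le_refl _
  | .tick _ => le_refl _
  | .tau _ => le_refl _
  | .out _ _ _ => le_refl _
  | .nu _ => Nat.le_succ _
  | .inp _ _ => Nat.le_succ _

/-- Objects of the base category: the channel `⋆`, the `n`-ary agents `[n]`, the basic actions,
forks, and synchronisations (`sync n a m c d`: an `n`-ary agent inputs on its channel `a`, an
`m`-ary agent outputs its channel `d` on its channel `c`). -/
inductive Vertex : Type
  | star : Vertex
  | ag (n : ℕ) : Vertex
  | act {p n : ℕ} (b : Basic p n) : Vertex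
  | fork (n : ℕ) : Vertex
  | sync (n : ℕ) (a : Fin n) (m : ℕ) (c d : Fin m) : Vertex

/-- The dimension of an object of the base category. -/
def Vertex.dim : Vertex → ℕ
  | .star => 0
  | .ag _ => 1
  | .act _ => 2
  | .fork _ => 3
  | .sync _ _ _ _ _ => 4

/-- Generating arrows of the base category. -/
inductive Edge : Vertex → Vertex → Type
  | port (n : ℕ) (i : Fin n) : Edge .star (.ag n)
  | src {p n : ℕ} (b : Basic p n) : Edge (.ag p) (.act b)
  | tgt {p n : ℕ} (b : Basic p n) : Edge (.ag n) (.act b)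
  | left (n : ℕ) : Edge (.act (.forkL n)) (.fork n)
  | right (n : ℕ) : Edge (.act (.forkR n)) (.fork n)
  | rho (n : ℕ) (a : Fin n) (m : ℕ) (c d : Fin m) : Edge (.act (.inp n a)) (.sync n a m c d)
  | eps (n : ℕ) (a : Fin n) (m : ℕ) (c d : Fin m) : Edge (.act (.out m c d)) (.sync n a m c d)

instance : Quiver.{0} Vertex := ⟨Edge⟩

/-- A generating arrow seen in the free category. -/
def Edge.path {a b : Vertex} (e : Edge a b) : (Paths.of Vertex).obj a ⟶ (Paths.of Vertex).obj b :=
  (Paths.of Vertex).map e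

/-- The equations of the base category (diagrammatic order of composition). -/
inductive BaseRel : HomRel (Paths Vertex)
  | st {p n : ℕ} (b : Basic p n) (i : Fin n) :
      BaseRel ((Edge.port p (Fin.castLE b.le i)).path ≫ (Edge.src b).path)
        ((Edge.port n i).path ≫ (Edge.tgt b).path)
  | fork (n : ℕ) :
      BaseRel ((Edge.tgt (.forkL n)).path ≫ (Edge.left n).path)
        ((Edge.tgt (.forkR n)).path ≫ (Edge.right n).path)
  | syncSubject (n : ℕ) (a : Fin n) (m : ℕ) (c d : Fin m) :
      BaseRel ((Edge.port n a).path ≫ (Edge.tgt (.inp n a)).path ≫ (Edge.rho n a m c d).path)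
        ((Edge.port m c).path ≫ (Edge.tgt (.out m c d)).path ≫ (Edge.eps n a m c d).path)
  | syncObject (n : ℕ) (a : Fin n) (m : ℕ) (c d : Fin m) :
      BaseRel ((Edge.port (n + 1) (Fin.last n)).path ≫ (Edge.src (.inp n a)).path ≫
          (Edge.rho n a m c d).path)
        ((Edge.port m d).path ≫ (Edge.src (.out m c d)).path ≫ (Edge.eps n a m c d).path)

/-- The base category. -/
abbrev Base : Type := CategoryTheory.Quotient BaseRel

/-- A vertex as an object of the base category. -/
abbrev Vertex.ob (c : Vertex) : Base := (Quotient.functor BaseRel).obj ((Paths.of Vertex).obj c)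

/-- A generating arrow as a morphism of the base category. -/
abbrev Edge.hom {a b : Vertex} (e : Edge a b) : a.ob ⟶ b.ob := (Quotient.functor BaseRel).map e.path

/-- String diagrams: presheaves on the base category.  (Finiteness is imposed on positions, and is
then automatic for traces.) -/
abbrev Diagram : Type 1 := Baseᵒᵖ ⥤ Type

/-- The representable diagram on a vertex. -/
abbrev rep (c : Vertex) : Diagram := yoneda.obj c.ob

/-- The individual `[n]`. -/
abbrev ind (n : ℕ) : Diagram := rep (.ag n)

/-- The map of diagrams named by an element. -/
abbrev nameOf {P : Diagram} {c : Vertex} (x : P.obj (op c.ob)) : rep c ⟶ P := yonedaEquiv.symm x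

/-- The map of representables induced by a generating arrow. -/
abbrev Edge.rep {a b : Vertex} (e : Edge a b) : rep a ⟶ rep b := yoneda.map e.hom

/-- Positions: finite diagrams of dimension at most one. -/
structure IsPosition (P : Diagram) : Prop where
  finite : Finite (Σ c : Vertex, P.obj (op c.ob))
  dim_le : ∀ c : Vertex, Nonempty (P.obj (op c.ob)) → c.dim ≤ 1

/-- `1`-injective maps: injective in all strictly positive dimensions. -/
def OneInj {P Q : Diagram} (f : P ⟶ Q) : Prop :=
  ∀ c : Vertex, 0 < c.dim → Function.Injective (f.app (op c.ob))

/-- The interface of a diagram: the position consisting solely of its channels. -/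
abbrev interface (P : Diagram) : Diagram := ∐ fun _ : P.obj (op Vertex.star.ob) => rep .star

/-- The inclusion of the interface. -/
abbrev interfaceMap (P : Diagram) : interface P ⟶ P := Sigma.desc fun c => nameOf c

/-! ### Cospans, seeds, actions and traces -/

/-- A cospan `Y → mid ← X`, written `Y ⇸ X`; `X` is the initial and `Y` the final diagram. -/
structure Cospan (Y X : Diagram) where
  mid : Diagram
  s : Y ⟶ mid
  t : X ⟶ mid

/-- The vertical identity. -/
abbrev Cospan.id (X : Diagram) : Cospan X X := ⟨X, 𝟙 X, 𝟙 X⟩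

/-- Vertical composition by pushout: first `u : Y ⇸ X`, then `w : T ⇸ Y`. -/
abbrev Cospan.comp {T Y X : Diagram} (u : Cospan Y X) (w : Cospan T Y) : Cospan T X :=
  ⟨pushout u.s w.t, w.s ≫ pushout.inr _ _, u.t ≫ pushout.inl _ _⟩

/-- Special isomorphisms of cospans. -/
def Cospan.Iso {Y X : Diagram} (u u' : Cospan Y X) : Prop :=
  ∃ f : u.mid ≅ u'.mid, u.s ≫ f.hom = u'.s ∧ u.t ≫ f.hom = u'.t

/-- Double cells: commuting diagrams of `1`-injective maps. -/
structure Cell {Y X Y' X' : Diagram} (u : Cospan Y X) (u' : Cospan Y' X') where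
  top : Y ⟶ Y'
  mid : u.mid ⟶ u'.mid
  bot : X ⟶ X'
  top_inj : OneInj top
  mid_inj : OneInj mid
  bot_inj : OneInj bot
  w_s : u.s ≫ mid = top ≫ u'.s
  w_t : u.t ≫ mid = bot ≫ u'.t

/-- Shapes of seeds. -/
inductive Seed : Type
  | act {p n : ℕ} (b : Basic p n) : Seed
  | fork (n : ℕ) : Seed
  | sync (n : ℕ) (a : Fin n) (m : ℕ) (c d : Fin m) : Seed

/-- The cospan `[p] → b ← [n]` of a basic seed. -/
abbrev Basic.cospan {p n : ℕ} (b : Basic p n) : Cospan (ind p) (ind n) :=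
  ⟨rep (.act b), (Edge.src b).rep, (Edge.tgt b).rep⟩

/-- The `n` channels of `[n]`, in order. -/
abbrev ports (n : ℕ) : (∐ fun _ : Fin n => rep .star) ⟶ ind n :=
  Sigma.desc fun i => (Edge.port n i).rep

/-- `[n] | [n]`: two `n`-ary agents sharing all channels in order. -/
abbrev twin (n : ℕ) : Diagram := pushout (ports n) (ports n)

/-- `[m] c|a [n]`: an `m`-ary agent `x` and an `n`-ary agent `y` with `x · s_c = y · s_a`. -/
abbrev link (m : ℕ) (c : Fin m) (n : ℕ) (a : Fin n) : Diagram :=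
  pushout (Edge.port m c).rep (Edge.port n a).rep

/-- `[m] c,d|a,e [n]`: an `m`-ary agent `x` and an `n`-ary agent `y` with `x · s_c = y · s_a` and
`x · s_d = y · s_e`. -/
abbrev link₂ (m : ℕ) (c d : Fin m) (n : ℕ) (a e : Fin n) : Diagram :=
  pushout (coprod.desc (Edge.port m c).rep (Edge.port m d).rep)
    (coprod.desc (Edge.port n a).rep (Edge.port n e).rep)

/-- The final position of a seed. -/
abbrev Seed.final : Seed → Diagram
  | .act (p := p) _ => ind p
  | .fork n => twin n
  | .sync n a m c d => link₂ m c d (n + 1) (Fin.castSucc a) (Fin.last n)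

/-- The initial position of a seed. -/
abbrev Seed.init : Seed → Diagram
  | .act (n := n) _ => ind n
  | .fork n => ind n
  | .sync n a m c _ => link m c n a

theorem Edge.rep_st {p n : ℕ} (b : Basic p n) (i : Fin n) :
    (Edge.port p (Fin.castLE b.le i)).rep ≫ (Edge.src b).rep =
      (Edge.port n i).rep ≫ (Edge.tgt b).rep := by
  have h := CategoryTheory.Quotient.sound BaseRel (BaseRel.st b i)
  simp only [← Functor.map_comp]
  exact congrArg yoneda.map (by simpa using h)

theorem Edge.rep_fork (n : ℕ) :
    (Edge.tgt (.forkL n)).rep ≫ (Edge.left n).rep =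
      (Edge.tgt (.forkR n)).rep ≫ (Edge.right n).rep := by
  have h := CategoryTheory.Quotient.sound BaseRel (BaseRel.fork n)
  simp only [← Functor.map_comp]
  exact congrArg yoneda.map (by simpa using h)

theorem Edge.rep_subject (n : ℕ) (a : Fin n) (m : ℕ) (c d : Fin m) :
    (Edge.port n a).rep ≫ (Edge.tgt (.inp n a)).rep ≫ (Edge.rho n a m c d).rep =
      (Edge.port m c).rep ≫ (Edge.tgt (.out m c d)).rep ≫ (Edge.eps n a m c d).rep := by
  have h := CategoryTheory.Quotient.sound BaseRel (BaseRel.syncSubject n a m c d)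
  simp only [← Functor.map_comp]
  exact congrArg yoneda.map (by simpa using h)

theorem Edge.rep_object (n : ℕ) (a : Fin n) (m : ℕ) (c d : Fin m) :
    (Edge.port (n + 1) (Fin.last n)).rep ≫ (Edge.src (.inp n a)).rep ≫ (Edge.rho n a m c d).rep =
      (Edge.port m d).rep ≫ (Edge.src (.out m c d)).rep ≫ (Edge.eps n a m c d).rep := by
  have h := CategoryTheory.Quotient.sound BaseRel (BaseRel.syncObject n a m c d)
  simp only [← Functor.map_comp]
  exact congrArg yoneda.map (by simpa using h)

/-- The cospan `[n] | [n] → fork ← [n]`. -/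
def forkCospan (n : ℕ) : Cospan (twin n) (ind n) where
  mid := rep (.fork n)
  s := pushout.desc ((Edge.src (.forkL n)).rep ≫ (Edge.left n).rep)
    ((Edge.src (.forkR n)).rep ≫ (Edge.right n).rep) (by
      refine Sigma.hom_ext _ _ fun i => ?_
      have hl := Edge.rep_st (.forkL n) i
      have hr := Edge.rep_st (.forkR n) i
      simp only [Fin.castLE_rfl, id_eq] at hl hr
      rw [colimit.ι_desc_assoc, colimit.ι_desc_assoc]
      change (Edge.port n i).rep ≫ _ ≫ _ = (Edge.port n i).rep ≫ _ ≫ _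
      rw [reassoc_of% hl, reassoc_of% hr, Edge.rep_fork])
  t := (Edge.tgt (.forkL n)).rep ≫ (Edge.left n).rep

/-- The cospan `[m] c,d|a,n+1 [n+1] → sync ← [m] c|a [n]`. -/
def syncCospan (n : ℕ) (a : Fin n) (m : ℕ) (c d : Fin m) :
    Cospan (link₂ m c d (n + 1) (Fin.castSucc a) (Fin.last n)) (link m c n a) where
  mid := rep (.sync n a m c d)
  s := pushout.desc ((Edge.src (.out m c d)).rep ≫ (Edge.eps n a m c d).rep)
    ((Edge.src (.inp n a)).rep ≫ (Edge.rho n a m c d).rep) (by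
      have ho := Edge.rep_st (.out m c d) c
      have hi := Edge.rep_st (.inp n a) a
      simp only [Fin.castLE_rfl, id_eq] at ho
      refine coprod.hom_ext ?_ ?_
      · rw [coprod.inl_desc_assoc, coprod.inl_desc_assoc, reassoc_of% ho]
        have hi' : (Edge.port (n + 1) (Fin.castSucc a)).rep ≫ (Edge.src (.inp n a)).rep =
            (Edge.port n a).rep ≫ (Edge.tgt (.inp n a)).rep := hi
        rw [reassoc_of% hi']
        exact (Edge.rep_subject n a m c d).symm
      · rw [coprod.inr_desc_assoc, coprod.inr_desc_assoc]
        exact (Edge.rep_object n a m c d).symm)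
  t := pushout.desc ((Edge.tgt (.out m c d)).rep ≫ (Edge.eps n a m c d).rep)
    ((Edge.tgt (.inp n a)).rep ≫ (Edge.rho n a m c d).rep) (Edge.rep_subject n a m c d).symm

/-- The cospan of a seed. -/
def Seed.cospan : (σ : Seed) → Cospan σ.final σ.init
  | .act b => b.cospan
  | .fork n => forkCospan n
  | .sync n a m c d => syncCospan n a m c d

/-- `u` is an action of shape `σ`: the seed `σ` pushed along a map from its interface to some
position `Z`.  (The map `j` is the cone component to the final position; it is determined by its
composite with the monomorphism `σ.cospan.s`.) -/
def IsActionOf (σ : Seed) {Y X : Diagram} (u : Cospan Y X) : Prop :=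
  ∃ (Z : Diagram) (_ : IsPosition Z) (h : interface σ.init ⟶ Z) (j : interface σ.init ⟶ σ.final)
    (x : σ.init ⟶ X) (zx : Z ⟶ X) (μ : σ.cospan.mid ⟶ u.mid) (zu : Z ⟶ u.mid)
    (y : σ.final ⟶ Y) (zy : Z ⟶ Y),
    j ≫ σ.cospan.s = interfaceMap σ.init ≫ σ.cospan.t ∧
    IsPushout (interfaceMap σ.init) h x zx ∧
    IsPushout (interfaceMap σ.init ≫ σ.cospan.t) h μ zu ∧
    IsPushout j h y zy ∧
    x ≫ u.t = σ.cospan.t ≫ μ ∧ zx ≫ u.t = zu ∧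
    y ≫ u.s = σ.cospan.s ≫ μ ∧ zy ≫ u.s = zu

/-- Traces: cospans isomorphic to a finite, possibly empty composite of actions. -/
inductive IsTrace : {Y X : Diagram} → Cospan Y X → Prop
  | id {X : Diagram} (hX : IsPosition X) : IsTrace (Cospan.id X)
  | action {Y X : Diagram} {u : Cospan Y X} (σ : Seed) (h : IsActionOf σ u) : IsTrace u
  | comp {T Y X : Diagram} {u : Cospan Y X} {w : Cospan T Y} (hu : IsTrace u) (hw : IsTrace w) :
      IsTrace (u.comp w)
  | iso {Y X : Diagram} {u u' : Cospan Y X} (hu : IsTrace u) (h : u.Iso u') : IsTrace u'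

/-- Views: cospans isomorphic to a finite, possibly empty composite of basic seeds. -/
inductive IsView : {p n : ℕ} → Cospan (ind p) (ind n) → Prop
  | id (n : ℕ) : IsView (Cospan.id (ind n))
  | basic {p n : ℕ} (b : Basic p n) : IsView b.cospan
  | comp {q p n : ℕ} {u : Cospan (ind p) (ind n)} {w : Cospan (ind q) (ind p)}
      (hu : IsView u) (hw : IsView w) : IsView (u.comp w)
  | iso {p n : ℕ} {u u' : Cospan (ind p) (ind n)} (hu : IsView u) (h : u.Iso u') : IsView u'

/-! ### Views are traces -/

theorem path_star {a : Vertex} (f : Quiver.Path a Vertex.star) : a = .star := by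
  cases f with
  | nil => rfl
  | cons _ e => exact nomatch (e : Edge _ _)

theorem dim_path {a b : Vertex} (f : Quiver.Path a b) : a.dim ≤ b.dim := by
  induction f with
  | nil => exact le_rfl
  | cons _ e ih =>
    refine ih.trans ?_
    rcases (e : Edge _ _) <;> simp [Vertex.dim]

theorem dim_hom {a b : Vertex} (f : a.ob ⟶ b.ob) : a.dim ≤ b.dim := by
  obtain ⟨g, -⟩ := (Quotient.functor BaseRel).map_surjective f
  exact dim_path g

theorem path_port {n : ℕ} : ∀ {a : Vertex} (f : Quiver.Path a (Vertex.ag n)),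
    (∃ h : a = .ag n, f = h ▸ Quiver.Path.nil) ∨
      ∃ (h : a = .star) (i : Fin n), f = h ▸ Quiver.Hom.toPath (Edge.port n i : Vertex.star ⟶ _)
  | _, .nil => .inl ⟨rfl, rfl⟩
  | _, .cons .nil (Edge.port _ i) => .inr ⟨rfl, i, rfl⟩
  | _, .cons (.cons _ e') (Edge.port _ _) => nomatch (e' : Edge _ _)

theorem hom_ag {n : ℕ} {c : Vertex} (f : c.ob ⟶ (Vertex.ag n).ob) :
    (∃ h : c = .ag n, f = eqToHom (by rw [h])) ∨
      ∃ (h : c = .star) (i : Fin n), f = eqToHom (by rw [h]) ≫ (Edge.port n i).hom := by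
  obtain ⟨g, rfl⟩ := (Quotient.functor BaseRel).map_surjective f
  change Quiver.Path c (Vertex.ag n) at g
  rcases path_port g with ⟨h, hg⟩ | ⟨h, i, hg⟩
  · subst h
    exact .inl ⟨rfl, congrArg _ hg⟩
  · subst h
    exact .inr ⟨rfl, i, (congrArg _ hg).trans (Category.id_comp _).symm⟩

theorem hom_port {n : ℕ} (f : Vertex.star.ob ⟶ (Vertex.ag n).ob) :
    ∃ i : Fin n, f = (Edge.port n i).hom := by
  rcases hom_ag f with ⟨h, -⟩ | ⟨h, i, hi⟩
  · exact nomatch h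
  · exact ⟨i, hi.trans (Category.id_comp _)⟩

theorem hom_star {c : Vertex} (f : c.ob ⟶ Vertex.star.ob) :
    ∃ h : c = .star, f = eqToHom (by rw [h]) := by
  obtain ⟨g, rfl⟩ := (Quotient.functor BaseRel).map_surjective f
  change Quiver.Path c Vertex.star at g
  cases g with
  | nil => exact ⟨rfl, rfl⟩
  | cons _ e => exact nomatch (e : Edge _ _)

theorem isPosition_interface_ind (n : ℕ) : IsPosition (interface (ind n)) := by
  have key : ∀ (c : Vertex) (z : (interface (ind n)).obj (op c.ob)),
      ∃ (x : (ind n).obj (op Vertex.star.ob)) (g : c.ob ⟶ Vertex.star.ob),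
        z = (Sigma.ι (fun _ : (ind n).obj (op Vertex.star.ob) => rep .star) x).app (op c.ob) g := by
    intro c z
    have hc := isColimitOfPreserves ((evaluation Baseᵒᵖ Type).obj (op c.ob))
      (colimit.isColimit
        (Discrete.functor fun _ : (ind n).obj (op Vertex.star.ob) => rep Vertex.star))
    obtain ⟨⟨x⟩, g, hg⟩ := Types.jointly_surjective _ hc z
    exact ⟨x, g, hg.symm⟩
  refine ⟨?_, ?_⟩
  · let φ : Fin n → Σ c : Vertex, (interface (ind n)).obj (op c.ob) := fun i =>
      ⟨.star, (Sigma.ι (fun _ : (ind n).obj (op Vertex.star.ob) => rep .star)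
        (Edge.port n i).hom).app (op Vertex.star.ob) (𝟙 _)⟩
    refine Finite.of_surjective φ ?_
    rintro ⟨c, z⟩
    obtain ⟨x, g, rfl⟩ := key c z
    obtain ⟨rfl, rfl⟩ := hom_star g
    obtain ⟨i, rfl⟩ := hom_port x
    exact ⟨i, rfl⟩
  · rintro c ⟨z⟩
    obtain ⟨x, g, -⟩ := key c z
    exact (dim_hom g).trans (by simp [Vertex.dim])

theorem isAction_basic {p n : ℕ} (b : Basic p n) : IsActionOf (.act b) b.cospan := by
  have hj : ∀ x : (ind n).obj (op Vertex.star.ob), ∃ x' : (ind p).obj (op Vertex.star.ob),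
      nameOf (P := ind p) x' ≫ (Edge.src b).rep = nameOf (P := ind n) x ≫ (Edge.tgt b).rep := by
    intro x
    obtain ⟨i, rfl⟩ := hom_port x
    refine ⟨(Edge.port p (Fin.castLE b.le i)).hom, ?_⟩
    have h := Edge.rep_st b i
    have e : ∀ {c : Vertex} (g : Vertex.star.ob ⟶ c.ob), nameOf (P := rep c) g = yoneda.map g :=
      fun g => by rw [nameOf, Equiv.symm_apply_eq, yonedaEquiv_yoneda_map]
    rw [e, e]
    exact h
  choose j hj using hj
  refine ⟨interface (ind n), isPosition_interface_ind n, 𝟙 _, Sigma.desc fun x => nameOf (j x),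
    𝟙 _, interfaceMap (ind n), 𝟙 _, interfaceMap (ind n) ≫ (Edge.tgt b).rep, 𝟙 _,
    Sigma.desc fun x => nameOf (j x), ?_, ?_, ?_, ?_, ?_, ?_, ?_, ?_⟩
  · refine Sigma.hom_ext _ _ fun x => ?_
    rw [colimit.ι_desc_assoc, colimit.ι_desc_assoc]
    exact hj x
  · exact IsPushout.of_vert_isIso ⟨by simp⟩
  · have e : IsPushout (interfaceMap (ind n) ≫ (Edge.tgt b).rep) (𝟙 _) (𝟙 (rep (.act b)))
        (interfaceMap (ind n) ≫ (Edge.tgt b).rep) := IsPushout.of_vert_isIso ⟨by simp⟩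
    exact e
  · exact IsPushout.of_vert_isIso ⟨by simp⟩
  · exact (Category.id_comp _).trans (Category.comp_id _).symm
  · rfl
  · exact (Category.id_comp _).trans (Category.comp_id _).symm
  · refine Sigma.hom_ext _ _ fun x => ?_
    rw [colimit.ι_desc_assoc, colimit.ι_desc_assoc]
    exact hj x

theorem isPosition_ind (n : ℕ) : IsPosition (ind n) := by
  refine ⟨?_, ?_⟩
  · let φ : Option (Fin n) → Σ c : Vertex, (ind n).obj (op c.ob) := fun o =>
      o.elim ⟨.ag n, 𝟙 _⟩ fun i => ⟨.star, (Edge.port n i).hom⟩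
    refine Finite.of_surjective φ ?_
    rintro ⟨c, z⟩
    rcases hom_ag z with ⟨rfl, rfl⟩ | ⟨rfl, i, rfl⟩
    · exact ⟨none, rfl⟩
    · exact ⟨some i, by simp [φ]⟩
  · rintro c ⟨z⟩
    exact dim_hom z

theorem IsView.isTrace {p n : ℕ} {u : Cospan (ind p) (ind n)} (h : IsView u) : IsTrace u := by
  induction h with
  | id n => exact .id (isPosition_ind n)
  | basic b => exact .action (.act b) (isAction_basic b)
  | comp _ _ hu hw => exact .comp hu hw
  | iso _ h hu => exact .iso hu h

/-! ### The categories of views -/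

/-- Views from the individual `[n]`. -/
structure View (n : ℕ) : Type 1 where
  arity : ℕ
  cospan : Cospan (ind arity) (ind n)
  isView : IsView cospan

/-- A pair `(w, α)` of a trace `w : T ⇸ [v.arity]` and a cell `α : v • w → v'` over `[n]`. -/
structure Extension {n : ℕ} (v v' : View n) : Type 1 where
  T : Diagram
  w : Cospan T (ind v.arity)
  isTrace : IsTrace w
  cell : Cell (v.cospan.comp w) v'.cospan
  bot : cell.bot = 𝟙 _

instance (n : ℕ) : Quiver.{1} (View n) := ⟨Extension⟩

/-- An extension seen in the free category. -/
def Extension.path {n : ℕ} {v v' : View n} (g : Extension v v') :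
    (Paths.of (View n)).obj v ⟶ (Paths.of (View n)).obj v' :=
  (Paths.of (View n)).map g

/-- The component on `v` of the cell of an extension. -/
abbrev Extension.onBase {n : ℕ} {v v' : View n} (g : Extension v v') :
    v.cospan.mid ⟶ v'.cospan.mid := pushout.inl v.cospan.s g.w.t ≫ g.cell.mid

/-- The component on `w` of the cell of an extension `(w, α)`. -/
abbrev Extension.onExt {n : ℕ} {v v' : View n} (g : Extension v v') :
    g.w.mid ⟶ v'.cospan.mid := pushout.inr v.cospan.s g.w.t ≫ g.cell.mid

/-- The relations between pairs `(w, α)` that define the category of views: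
* `(w', α ∘ (v • γ)) = (w, α)` for every cell `γ : w' → w` over `[v.arity]`;
* the identity of `v` is `(id, v • id ≅ v)`;
* the composite of `(w, α) : v → v'` and `(w', α') : v' → v''` is `(w • w'', δ)`, where `w''` is any
  trace with a cell `β : w'' → w'` over the upper component of `α` (such as the restriction of `w'`
  along it) and `δ` is the pasting of `α`, `β` and `α'`. -/
inductive ViewRel (n : ℕ) : HomRel (Paths (View n))
  | whisker {v v' : View n} (g g' : Extension v v') (γ : Cell g'.w g.w) (hγ : γ.bot = 𝟙 _)
      (h_top : g'.cell.top = γ.top ≫ g.cell.top)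
      (h_base : g'.onBase = g.onBase) (h_ext : g'.onExt = γ.mid ≫ g.onExt) :
      ViewRel n g'.path g.path
  | id {v : View n} (hw : IsTrace (Cospan.id (ind v.arity)))
      (α : Cell (v.cospan.comp (Cospan.id _)) v.cospan) (hα : α.bot = 𝟙 _)
      (h_top : α.top = 𝟙 _) (h_base : pushout.inl v.cospan.s (𝟙 _) ≫ α.mid = 𝟙 _) :
      ViewRel n (Extension.path ⟨_, Cospan.id _, hw, α, hα⟩) (𝟙 _)
  | comp {v v' v'' : View n} (g : Extension v v') (g' : Extension v' v'') {T : Diagram}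
      (w : Cospan T g.T) (hw : IsTrace w) (β : Cell w g'.w) (hβ : β.bot = g.cell.top)
      (δ : Cell (v.cospan.comp (g.w.comp w)) v''.cospan) (hδ : δ.bot = 𝟙 _)
      (h_top : δ.top = β.top ≫ g'.cell.top)
      (h_base : pushout.inl v.cospan.s (g.w.comp w).t ≫ δ.mid = g.onBase ≫ g'.onBase)
      (h_left : pushout.inl g.w.s w.t ≫ pushout.inr v.cospan.s (g.w.comp w).t ≫ δ.mid =
        g.onExt ≫ g'.onBase)
      (h_right : pushout.inr g.w.s w.t ≫ pushout.inr v.cospan.s (g.w.comp w).t ≫ δ.mid =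
        β.mid ≫ g'.onExt) :
      ViewRel n (g.path ≫ g'.path) (Extension.path ⟨T, g.w.comp w, .comp g.isTrace hw, δ, hδ⟩)

/-- The category of views from `[n]`. -/
abbrev ViewCat (n : ℕ) : Type 1 := CategoryTheory.Quotient (ViewRel n)

/-- A view as an object of the category of views. -/
abbrev View.ob {n : ℕ} (v : View n) : ViewCat n :=
  (Quotient.functor (ViewRel n)).obj ((Paths.of (View n)).obj v)

/-- A pair `(w, α)` as a morphism of views. -/
abbrev Extension.hom {n : ℕ} {v v' : View n} (g : Extension v v') : v.ob ⟶ v'.ob :=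
  (Quotient.functor (ViewRel n)).map g.path

/-- The vertical identity as a view. -/
abbrev View.id (n : ℕ) : View n := ⟨n, Cospan.id _, .id n⟩

/-- A basic seed as a view. -/
abbrev Basic.view {p n : ℕ} (b : Basic p n) : View n := ⟨p, b.cospan, .basic b⟩

/-- Vertical composition of views. -/
abbrev View.comp {n : ℕ} (v : View n) (w : View v.arity) : View n :=
  ⟨w.arity, v.cospan.comp w.cospan, .comp v.isView w.isView⟩

theorem oneInj_id (P : Diagram) : OneInj (𝟙 P) := fun _ _ _ _ h => h

theorem oneInj_of_isIso {P Q : Diagram} (f : P ⟶ Q) [IsIso f] : OneInj f := fun c _ x y h => by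
  have := congrArg ((inv f).app (op c.ob)) h
  rwa [← NatTrans.comp_app_apply, ← NatTrans.comp_app_apply, IsIso.hom_inv_id] at this

theorem oneInj_of_isPushout {A B C D : Diagram} {f : A ⟶ B} {g : A ⟶ C} {h : B ⟶ D} {k : C ⟶ D}
    (sq : IsPushout f g h k) (hf : OneInj f) : OneInj k := by
  intro c hc
  have sq' := sq.map ((evaluation Baseᵒᵖ Type).obj (op c.ob))
  have : Mono (((evaluation Baseᵒᵖ Type).obj (op c.ob)).map f) :=
    (mono_iff_injective _).2 (hf c hc)
  exact (mono_iff_injective _).1 (Adhesive.mono_of_isPushout_of_mono_left sq')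

theorem Extension.t_onBase {n : ℕ} {v v' : View n} (g : Extension v v') :
    v.cospan.t ≫ g.onBase = v'.cospan.t := by
  have := g.cell.w_t
  rwa [g.bot, Category.id_comp, Category.assoc] at this

theorem Extension.s_onExt {n : ℕ} {v v' : View n} (g : Extension v v') :
    g.w.s ≫ g.onExt = g.cell.top ≫ v'.cospan.s := by
  have := g.cell.w_s
  rwa [Category.assoc] at this

theorem Extension.s_onBase {n : ℕ} {v v' : View n} (g : Extension v v') :
    v.cospan.s ≫ g.onBase = g.w.t ≫ g.onExt := pushout.condition_assoc _

/-- The cell `id • v ≅ v`. -/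
abbrev View.bangExt {n : ℕ} (v : View n) : Extension (View.id n) v where
  T := ind v.arity
  w := v.cospan
  isTrace := v.isView.isTrace
  cell :=
    { top := 𝟙 _
      mid := pushout.desc v.cospan.t (𝟙 _) (by rw [Category.id_comp, Category.comp_id])
      bot := 𝟙 _
      top_inj := oneInj_id _
      mid_inj := by
        have h : IsIso (pushout.desc v.cospan.t (𝟙 _) (by rw [Category.id_comp, Category.comp_id]) :
            pushout (𝟙 (ind n)) v.cospan.t ⟶ v.cospan.mid) := by
          refine ⟨pushout.inr _ _, pushout.hom_ext ?_ ?_, pushout.inr_desc _ _ _⟩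
          · rw [pushout.inl_desc_assoc, ← pushout.condition, Category.id_comp, Category.comp_id]
          · rw [pushout.inr_desc_assoc, Category.id_comp, Category.comp_id]
        exact oneInj_of_isIso _
      bot_inj := oneInj_id _
      w_s := by
        rw [Category.assoc, pushout.inr_desc, Category.id_comp, Category.comp_id]
      w_t := by
        rw [Category.assoc, pushout.inl_desc] }
  bot := rfl

/-- The morphism `id → v` given by `(v, id • v ≅ v)`. -/
abbrev View.bang {n : ℕ} (v : View n) : (View.id n).ob ⟶ v.ob := v.bangExt.hom

theorem View.bang_id (n : ℕ) : (View.id n).bang = 𝟙 _ :=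
  CategoryTheory.Quotient.sound _ (ViewRel.id _ _ rfl rfl (pushout.inl_desc _ _ _))

theorem View.bang_comp_ext {n : ℕ} {v v' : View n} (g : Extension v v') :
    v.bang ≫ g.hom = v'.bang := by
  have hmid : (Cospan.id (ind n)).s ≫ v'.cospan.t =
      (v.cospan.comp g.w).t ≫ g.cell.mid := by
    rw [g.cell.w_t, g.bot]
  let δ : Cell ((View.id n).cospan.comp (v.cospan.comp g.w)) v'.cospan :=
    { top := g.cell.top
      mid := pushout.desc v'.cospan.t g.cell.mid hmid
      bot := 𝟙 _
      top_inj := g.cell.top_inj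
      mid_inj := by
        have h : pushout.desc v'.cospan.t g.cell.mid hmid =
            (pushout.desc (v.cospan.comp g.w).t (𝟙 _) (by rw [Category.id_comp, Category.comp_id]) :
              pushout (𝟙 (ind n)) (v.cospan.comp g.w).t ⟶ _) ≫ g.cell.mid := by
          refine pushout.hom_ext ?_ ?_
          · rw [pushout.inl_desc, pushout.inl_desc_assoc, g.cell.w_t, g.bot, Category.id_comp]
          · rw [pushout.inr_desc, pushout.inr_desc_assoc, Category.id_comp]
        have h' : IsIso (pushout.desc (v.cospan.comp g.w).t (𝟙 _)
            (by rw [Category.id_comp, Category.comp_id]) :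
              pushout (𝟙 (ind n)) (v.cospan.comp g.w).t ⟶ _) := by
          refine ⟨pushout.inr _ _, pushout.hom_ext ?_ ?_, pushout.inr_desc _ _ _⟩
          · rw [pushout.inl_desc_assoc, ← pushout.condition, Category.id_comp, Category.comp_id]
          · rw [pushout.inr_desc_assoc, Category.id_comp, Category.comp_id]
        rw [h]
        intro c hc x y hxy
        rw [NatTrans.comp_app_apply, NatTrans.comp_app_apply] at hxy
        exact oneInj_of_isIso _ c hc (g.cell.mid_inj c hc hxy)
      bot_inj := oneInj_id _
      w_s := by
        rw [← g.cell.w_s, Category.assoc, pushout.inr_desc]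
      w_t := by
        rw [Category.assoc, pushout.inl_desc, Category.id_comp] }
  let β : Cell g.w g.w :=
    ⟨𝟙 _, 𝟙 _, 𝟙 _, oneInj_id _, oneInj_id _, oneInj_id _, by simp, by simp⟩
  have h₁ := ViewRel.comp v.bangExt g g.w g.isTrace β rfl δ rfl (Category.id_comp _).symm
    (by
      refine (pushout.inl_desc _ _ _).trans (g.t_onBase.symm.trans ?_)
      exact congrArg (· ≫ g.onBase) (pushout.inl_desc _ _ _).symm)
    (by
      refine (congrArg (_ ≫ ·) (pushout.inr_desc _ _ _)).trans ((Category.id_comp _).symm.trans ?_)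
      exact congrArg (· ≫ g.onBase) (pushout.inr_desc _ _ _).symm)
    ((congrArg (_ ≫ ·) (pushout.inr_desc _ _ _)).trans (Category.id_comp _).symm)
  have h₂ := ViewRel.whisker v'.bangExt
    ⟨g.T, v.cospan.comp g.w, .comp v.isView.isTrace g.isTrace, δ, rfl⟩ g.cell g.bot
    (Category.comp_id _).symm
    ((pushout.inl_desc _ _ _).trans (pushout.inl_desc _ _ _).symm)
    ((pushout.inr_desc _ _ _).trans
      ((Category.comp_id _).symm.trans (congrArg (_ ≫ ·) (pushout.inr_desc _ _ _).symm)))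
  exact ((Quotient.functor (ViewRel n)).map_comp _ _).symm.trans
    ((CategoryTheory.Quotient.sound _ h₁).trans (CategoryTheory.Quotient.sound _ h₂))

theorem View.bang_comp {n : ℕ} {v v' : View n} (f : v.ob ⟶ v'.ob) : v.bang ≫ f = v'.bang := by
  obtain ⟨g, rfl⟩ := (Quotient.functor (ViewRel n)).map_surjective f
  change Quiver.Path v v' at g
  induction g with
  | nil => exact Category.comp_id _
  | cons g e ih =>
    rw [← View.bang_comp_ext (e : Extension _ _), ← ih, Category.assoc]
    rfl

/-- Prefixing an extension by a view: `(w, α) ↦ (w, v • α)`. -/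
abbrev View.compExt {n : ℕ} (v : View n) {w w' : View v.arity} (g : Extension w w') :
    Extension (v.comp w) (v.comp w') where
  T := g.T
  w := g.w
  isTrace := g.isTrace
  cell :=
    { top := g.cell.top
      mid := pushout.desc
        (pushout.desc (pushout.inl _ _) (g.onBase ≫ pushout.inr _ _)
          (by rw [← Category.assoc, g.t_onBase]; exact pushout.condition))
        (g.onExt ≫ pushout.inr _ _)
        (by rw [Category.assoc, pushout.inr_desc, ← Category.assoc, g.s_onBase, Category.assoc])
      bot := 𝟙 _
      top_inj := g.cell.top_inj
      mid_inj := by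
        let a : pushout w.cospan.s g.w.t ⟶ pushout (v.comp w).cospan.s g.w.t :=
          pushout.desc (pushout.inr _ _ ≫ pushout.inl _ _) (pushout.inr _ _)
            (by rw [← Category.assoc, pushout.condition])
        have sq : IsPushout g.w.t (w.cospan.s ≫ pushout.inr v.cospan.s w.cospan.t)
            (pushout.inr w.cospan.s g.w.t ≫ a) (pushout.inl _ _) := by
          rw [pushout.inr_desc]
          exact (IsPushout.of_hasPushout _ _).flip
        have sq₁ := (IsPushout.of_hasPushout v.cospan.s w.cospan.t).flip.paste_horiz
          (sq.of_top (pushout.inl_desc _ _ _) (IsPushout.of_hasPushout _ _).flip)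
        have e₁ : (w.cospan.t ≫ pushout.inl w.cospan.s g.w.t) ≫ g.cell.mid = w'.cospan.t :=
          (Category.assoc _ _ _).trans g.t_onBase
        refine oneInj_of_isPushout (IsPushout.of_left (v₁₃ := pushout.inr v.cospan.s w'.cospan.t)
          (h₁₂ := g.cell.mid) (h₁₁ := w.cospan.t ≫ pushout.inl w.cospan.s g.w.t)
          (h₂₁ := pushout.inl v.cospan.s w.cospan.t ≫ pushout.inl (v.comp w).cospan.s g.w.t)
          ?_ ?_ sq₁) g.cell.mid_inj
        · rw [e₁, Category.assoc, pushout.inl_desc, pushout.inl_desc]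
          exact (IsPushout.of_hasPushout _ _).flip
        · refine pushout.hom_ext ?_ ?_
          · have h₁ : pushout.inl w.cospan.s g.w.t ≫ a = _ := pushout.inl_desc _ _ _
            rw [reassoc_of% h₁, pushout.inl_desc, pushout.inr_desc, Category.assoc]
          · have h₁ : pushout.inr w.cospan.s g.w.t ≫ a = _ := pushout.inr_desc _ _ _
            rw [reassoc_of% h₁, pushout.inr_desc, Category.assoc]
      bot_inj := oneInj_id _
      w_s := by rw [Category.assoc, pushout.inr_desc, ← Category.assoc, g.s_onExt, Category.assoc]
      w_t := by
        rw [Category.assoc, pushout.inl_desc, Category.assoc, pushout.inl_desc, Category.id_comp] }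
  bot := rfl

theorem View.compExt_onBase {n : ℕ} (v : View n) {w w' : View v.arity} (g : Extension w w') :
    (v.compExt g).onBase = pushout.desc (pushout.inl _ _) (g.onBase ≫ pushout.inr _ _)
      (by rw [← Category.assoc, g.t_onBase]; exact pushout.condition) :=
  pushout.inl_desc _ _ _

theorem View.compExt_onExt {n : ℕ} (v : View n) {w w' : View v.arity} (g : Extension w w') :
    (v.compExt g).onExt = g.onExt ≫ pushout.inr v.cospan.s w'.cospan.t :=
  pushout.inr_desc _ _ _

/-- Prefixing by a view, on pairs. -/
abbrev View.prefixPairs {n : ℕ} (v : View n) : Paths (View v.arity) ⥤ ViewCat n :=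
  Paths.lift
    { obj := fun w => (v.comp w).ob
      map := fun g => (v.compExt g).hom }

theorem View.prefixPairs_path {n : ℕ} (v : View n) {w w' : View v.arity} (g : Extension w w') :
    v.prefixPairs.map g.path = (v.compExt g).hom :=
  Paths.lift_toPath _ _

/-- Prefixing by a view, as a functor. -/
def View.prefix {n : ℕ} (v : View n) : ViewCat v.arity ⥤ ViewCat n :=
  CategoryTheory.Quotient.lift (ViewRel v.arity) v.prefixPairs
    (by
      intro x y p q h
      cases h with
      | whisker g g' γ hγ h_top h_base h_ext =>
        refine (v.prefixPairs_path _).trans (Eq.trans ?_ (v.prefixPairs_path _).symm)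
        refine CategoryTheory.Quotient.sound _
          (ViewRel.whisker (v.compExt g) (v.compExt g') γ hγ h_top ?_ ?_)
        · rw [View.compExt_onBase, View.compExt_onBase]
          congr 2
        · rw [View.compExt_onExt, View.compExt_onExt, h_ext, Category.assoc]
      | @id w hw α hα h_top h_base =>
        refine (v.prefixPairs_path _).trans ?_
        refine CategoryTheory.Quotient.sound _ (ViewRel.id (v := v.comp w) hw
          (v.compExt (⟨_, Cospan.id _, hw, α, hα⟩ : Extension _ _)).cell rfl h_top ?_)
        have h := v.compExt_onBase (⟨_, Cospan.id _, hw, α, hα⟩ : Extension _ _)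
        refine Eq.trans h (pushout.hom_ext ?_ ?_)
        · exact (pushout.inl_desc _ _ _).trans (Category.comp_id _).symm
        · refine (pushout.inr_desc _ _ _).trans ?_
          exact (congrArg (· ≫ _) h_base).trans
            ((Category.id_comp _).trans (Category.comp_id _).symm)
      | @comp w₀ w₁ w₂ g g' T w hw β hβ δ hδ h_top h_base h_left h_right =>
        have h₁ := v.compExt_onBase
          (⟨_, g.w.comp w, .comp g.isTrace hw, δ, hδ⟩ : Extension _ _)
        have h₂ := v.compExt_onExt
          (⟨_, g.w.comp w, .comp g.isTrace hw, δ, hδ⟩ : Extension _ _)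
        refine Eq.trans (v.prefixPairs.map_comp _ _) ?_
        refine (congrArg₂ (· ≫ ·) (v.prefixPairs_path _) (v.prefixPairs_path _)).trans
          (Eq.trans ?_ (v.prefixPairs_path _).symm)
        refine ((Quotient.functor (ViewRel n)).map_comp _ _).symm.trans
          (CategoryTheory.Quotient.sound _
            (ViewRel.comp (v.compExt g) (v.compExt g') w hw β hβ _ rfl h_top ?_ ?_ ?_))
        · refine h₁.trans ?_
          rw [View.compExt_onBase, View.compExt_onBase]
          refine pushout.hom_ext ?_ ?_
          · rw [pushout.inl_desc, pushout.inl_desc_assoc, pushout.inl_desc]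
          · rw [pushout.inr_desc, pushout.inr_desc_assoc]
            refine Eq.trans ?_ ((Category.assoc _ _ _).trans
              (congrArg (g.onBase ≫ ·) (pushout.inr_desc _ _ _))).symm
            exact (congrArg (· ≫ _) h_base).trans (Category.assoc _ _ _)
        · refine (congrArg (_ ≫ ·) h₂).trans ?_
          rw [View.compExt_onExt, View.compExt_onBase]
          refine Eq.trans ?_ ((Category.assoc _ _ _).trans
            (congrArg (g.onExt ≫ ·) (pushout.inr_desc _ _ _))).symm
          have h₃ := congrArg (· ≫ pushout.inr v.cospan.s w₂.cospan.t) h_left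
          refine Eq.trans ?_ (h₃.trans (Category.assoc _ _ _))
          exact ((Category.assoc _ _ _).trans (congrArg (_ ≫ ·) (Category.assoc _ _ _))).symm
        · refine (congrArg (_ ≫ ·) h₂).trans ?_
          rw [View.compExt_onExt]
          refine (Category.assoc _ _ _).symm.trans ?_
          exact (congrArg (· ≫ _) h_right).trans (Category.assoc _ _ _))

/-- The unique morphism from the identity view to any view. -/
abbrev bang {n : ℕ} (x : ViewCat n) : (View.id n).ob ⟶ x := View.bang (x.as : View n)

theorem bang_comp {n : ℕ} {x y : ViewCat n} (f : x ⟶ y) : bang x ≫ f = bang y :=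
  View.bang_comp (v := x.as) (v' := y.as) f

/-! ### Behaviours -/

/-- Finite sets of natural numbers. -/
structure FinNat where
  carrier : Finset ℕ

/-- The category of finite sets of natural numbers and all maps. -/
instance : Category FinNat where
  Hom A B := {k // k ∈ A.carrier} → {k // k ∈ B.carrier}
  id _ := fun k => k
  comp f g := fun k => g (f k)

/-- Behaviours on the individual `[n]`. -/
abbrev IndBeh (n : ℕ) : Type 1 := (ViewCat n)ᵒᵖ ⥤ FinNat

/-- The initial states of a behaviour. -/
abbrev IndBeh.states {n : ℕ} (B : IndBeh n) : Type :=
  {k // k ∈ (B.obj (op (View.id n).ob)).carrier}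

/-- The initial state of a state over a view. -/
abbrev IndBeh.initial {n : ℕ} (B : IndBeh n) (x : (ViewCat n)ᵒᵖ)
    (k : {k // k ∈ (B.obj x).carrier}) : B.states :=
  B.map (bang x.unop).op k

theorem IndBeh.initial_map {n : ℕ} (B : IndBeh n) {x y : (ViewCat n)ᵒᵖ} (f : x ⟶ y)
    (k : {k // k ∈ (B.obj x).carrier}) : B.initial y (B.map f k) = B.initial x k := by
  have h := B.map_comp f (bang y.unop).op
  have h' : f ≫ (bang y.unop).op = (bang x.unop).op := congrArg Quiver.Hom.op (bang_comp f.unop)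
  rw [h'] at h
  exact (congrFun h k).symm

/-- The residual of a behaviour along a view: `(B · v)(w) = B (v • w)`. -/
def IndBeh.residual {n : ℕ} (B : IndBeh n) (v : View n) : IndBeh v.arity := v.prefix.op ⋙ B

/-- A state of `B` over `x` lies above the initial state `k`. -/
def IndBeh.Above {n : ℕ} (B : IndBeh n) (k : B.states) (x : (ViewCat n)ᵒᵖ) (j : ℕ) : Prop :=
  ∃ h : j ∈ (B.obj x).carrier, B.initial x ⟨j, h⟩ = k

open Classical in
/-- The restriction of a behaviour to one of its initial states. -/
def IndBeh.restr {n : ℕ} (B : IndBeh n) (k : B.states) : IndBeh n where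
  obj x := ⟨{j ∈ (B.obj x).carrier | B.Above k x j}⟩
  map {x y} f := fun j =>
    ⟨(B.map f ⟨j.1, (Finset.mem_filter.1 j.2).1⟩).1, Finset.mem_filter.2
      ⟨(B.map f ⟨j.1, (Finset.mem_filter.1 j.2).1⟩).2, (B.map f ⟨j.1, _⟩).2,
        (B.initial_map f _).trans (Finset.mem_filter.1 j.2).2.2⟩⟩
  map_id x := by
    funext j
    have h := congrArg Subtype.val (congrFun (B.map_id x) ⟨j.1, (Finset.mem_filter.1 j.2).1⟩)
    exact Subtype.ext h
  map_comp f g := by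
    funext j
    have h := congrArg Subtype.val (congrFun (B.map_comp f g) ⟨j.1, (Finset.mem_filter.1 j.2).1⟩)
    exact Subtype.ext h

/-- Definite behaviours: exactly one initial state. -/
def IndBeh.IsDefinite {n : ℕ} (B : IndBeh n) : Prop := Nonempty (Unique B.states)

theorem IndBeh.initial_id {n : ℕ} (B : IndBeh n) (k : B.states) :
    B.initial (op (View.id n).ob) k = k := by
  have h : (bang (View.id n).ob).op = 𝟙 _ := congrArg Quiver.Hom.op (View.bang_id n)
  exact (congrArg (fun f => B.map f k) h).trans (congrFun (B.map_id _) k)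

theorem IndBeh.isDefinite_restr {n : ℕ} (B : IndBeh n) (k : B.states) :
    (B.restr k).IsDefinite := by
  classical
  refine ⟨⟨⟨⟨k.1, Finset.mem_filter.2 ⟨k.2, k.2, B.initial_id k⟩⟩⟩, ?_⟩⟩
  rintro ⟨j, hj⟩
  obtain ⟨-, h, e⟩ := Finset.mem_filter.1 hj
  have h' := congrArg Subtype.val ((B.initial_id ⟨j, h⟩).symm.trans e)
  exact Subtype.ext h'

/-- Definite behaviours on `[n]`. -/
abbrev DefBeh (n : ℕ) : Type 1 := {B : IndBeh n // B.IsDefinite}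

/-- The initial states of the residual of a definite behaviour along a basic seed. -/
abbrev DefBeh.after {p n : ℕ} (D : DefBeh n) (b : Basic p n) : Type :=
  (D.1.residual b.view).states

/-- `(D · b)|_i`. -/
def DefBeh.next {p n : ℕ} (D : DefBeh n) (b : Basic p n) (i : D.after b) : DefBeh p :=
  ⟨(D.1.residual b.view).restr i, IndBeh.isDefinite_restr _ _⟩

/-! ### Positions over natural numbers, and behaviours on them -/

/-- Positions whose channels and agents are natural numbers: `(n, k) ∈ agents` means that `k` is an
`n`-ary agent. -/
structure Position where
  chan : Finset ℕ
  agents : Finset (ℕ × ℕ)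
  port : (a : {a // a ∈ agents}) → Fin a.1.1 → {c // c ∈ chan}

namespace Position

/-- Agents of a position. -/
abbrev Agent (X : Position) : Type := {a // a ∈ X.agents}

/-- The arity of an agent. -/
abbrev Agent.arity {X : Position} (a : X.Agent) : ℕ := a.1.1

/-- The elements of the presheaf associated to a position. -/
abbrev elems (X : Position) : Vertex → Type
  | .star => {c // c ∈ X.chan}
  | .ag n => {k // (n, k) ∈ X.agents}
  | .act _ => PEmpty
  | .fork _ => PEmpty
  | .sync _ _ _ _ _ => PEmpty

/-- The action of the generating arrows on the presheaf associated to a position. -/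
def action (X : Position) : {a b : Vertex} → Edge a b → X.elems b → X.elems a
  | _, _, .port n i => fun k => X.port ⟨(n, k.1), k.2⟩ i
  | _, _, .src _ => PEmpty.elim
  | _, _, .tgt _ => PEmpty.elim
  | _, _, .left _ => PEmpty.elim
  | _, _, .right _ => PEmpty.elim
  | _, _, .rho _ _ _ _ _ => PEmpty.elim
  | _, _, .eps _ _ _ _ _ => PEmpty.elim

/-- The string diagram of a position. -/
def diagram (X : Position) : Diagram :=
  Functor.leftOp (CategoryTheory.Quotient.lift BaseRel
    (Paths.lift
      { obj := fun c => op (X.elems c)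
        map := fun e => Quiver.Hom.op (↾ X.action e) })
    (by
      intro a b p q h
      apply Quiver.Hom.unop_inj
      ext x
      cases h <;> exact x.elim))

/-- The map from an individual that picks an agent. -/
abbrev agentMap (X : Position) (a : X.Agent) : ind a.arity ⟶ X.diagram :=
  nameOf (P := X.diagram) (c := .ag a.arity) (⟨a.1.2, a.2⟩ : X.elems (.ag a.arity))

/-- The action of a map of positions on agents. -/
def mapAgent {X Y : Position} (h : X.diagram ⟶ Y.diagram) (a : X.Agent) : Y.Agent :=
  let k : Y.elems (.ag a.arity) :=
    h.app (op (Vertex.ag a.arity).ob) (⟨a.1.2, a.2⟩ : X.elems (.ag a.arity))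
  ⟨(a.arity, k.1), k.2⟩

/-- The map `I_X → Y` when `X` and `Y` have the same channels. -/
abbrev interfaceTo (X Y : Position) (e : X.chan = Y.chan) : interface X.diagram ⟶ Y.diagram :=
  Sigma.desc fun c : X.elems .star =>
    nameOf (P := Y.diagram) (c := .star) (⟨c.1, e ▸ c.2⟩ : Y.elems .star)

/-- Views in a position: an agent together with a view from it. -/
abbrev Views (X : Position) : Type 1 := Σ a : X.Agent, ViewCat a.arity

end Position

/-- Behaviours on a position. -/
abbrev Beh (X : Position) : Type 1 := (X.Views)ᵒᵖ ⥤ FinNat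

/-- `B · x`, the behaviour of an agent. -/
def Beh.at {X : Position} (B : Beh X) (a : X.Agent) : IndBeh a.arity :=
  (Sigma.incl (C := fun a : X.Agent => ViewCat a.arity) a).op ⋙ B

/-- `B · h`, the pullback of a behaviour along a map of positions. -/
def Beh.pull {X Y : Position} (B : Beh Y) (h : X.diagram ⟶ Y.diagram) : Beh X :=
  (Sigma.desc (C := fun a : X.Agent => ViewCat a.arity) fun a =>
    Sigma.incl (C := fun a : Y.Agent => ViewCat a.arity) (Position.mapAgent h a)).op ⋙ B

/-- Definite behaviours on a position. -/
def Beh.IsDefinite {X : Position} (B : Beh X) : Prop := ∀ a : X.Agent, (B.at a).IsDefinite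

/-! ### Labelled graphs, fair testing and bisimilarity -/

/-- The edges of the graph `Σ` with one vertex: the identity edge `id` and a further edge `♥`. -/
inductive Label : Type
  | id : Label
  | heart : Label

/-- `FreeStep step k x y`: the free category on a graph over `Σ` has an edge from `x` to `y` over
`♥ ^ k`, i.e. there is a path from `x` to `y` with exactly `k` edges over `♥`. -/
inductive FreeStep {V : Type*} (step : Label → V → V → Prop) : ℕ → V → V → Prop
  | nil (x : V) : FreeStep step 0 x x
  | silent {k : ℕ} {x y z : V} (h : FreeStep step k x y) (e : step .id y z) : FreeStep step k x z
  | heart {k : ℕ} {x y z : V} (h : FreeStep step k x y) (e : step .heart y z) :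
      FreeStep step (k + 1) x z

/-- The pole of fair testing: any `y` reached silently can reach some `z` over `♥`. -/
def Pole {V : Type*} (step : Label → V → V → Prop) (x : V) : Prop :=
  ∀ y, FreeStep step 0 x y → ∃ z, FreeStep step 1 y z

/-- `z` is a test for `x`: the pair `(x, z)` is in the domain of the testing relation, where
`test x z u` stands for `u ∈ (x | z)`. -/
def Coh {V : Type*} (test : V → V → V → Prop) (x z : V) : Prop := ∃ u, test x z u

/-- `x` passes the test `z`. -/
def Passes {V : Type*} (step : Label → V → V → Prop) (test : V → V → V → Prop) (x z : V) : Prop :=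
  ∃ u, test x z u ∧ Pole step u

/-- Fair testing equivalence for the free graph with testing on `step` and `test`. -/
def FairEq {V : Type*} (step : Label → V → V → Prop) (test : V → V → V → Prop) (x y : V) : Prop :=
  Coh test x y ∧ ∀ z, Coh test z x → (Passes step test x z ↔ Passes step test y z)

/-- Strong bisimulations over `Σ` between two graphs over `Σ`. -/
def IsBisimulation {V W : Type*} (step : Label → V → V → Prop) (step' : Label → W → W → Prop)
    (R : V → W → Prop) : Prop :=
  ∀ x y, R x y →
    (∀ α x', step α x x' → ∃ y', step' α y y' ∧ R x' y') ∧
    (∀ α y', step' α y y' → ∃ x', step α x x' ∧ R x' y')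

/-- Strong bisimilarity over `Σ`. -/
def Bisimilar {V W : Type*} (step : Label → V → V → Prop) (step' : Label → W → W → Prop)
    (x : V) (y : W) : Prop :=
  ∃ R, IsBisimulation step step' R ∧ R x y

/-! ### The graph `𝕊` -/

/-- The vertices of `𝕊`: pairs of a position and a definite behaviour on it. -/
structure SVertex where
  pos : Position
  beh : Beh pos
  definite : beh.IsDefinite

/-- Closed-world seeds, with their projection to `Σ`. -/
inductive ClosedWorld : Label → Seed → Prop
  | tick (n : ℕ) : ClosedWorld .heart (.act (.tick n))
  | tau (n : ℕ) : ClosedWorld .id (.act (.tau n))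
  | nu (n : ℕ) : ClosedWorld .id (.act (.nu n))
  | fork (n : ℕ) : ClosedWorld .id (.fork n)
  | sync (n : ℕ) (a : Fin n) (m : ℕ) (c d : Fin m) : ClosedWorld .id (.sync n a m c d)

/-- `SResidue D D' M`: for every agent `y` of the final position there is a state `σ` of
`D · M · y` such that `D' · y ≅ (D · M · y)|_σ`.  Here `D · M · y = D · x · v`, where `v` is the view
of `y` in `M`, namely the view with a cell `v → M` from `y` to some agent `x`. -/
def SResidue {X Y : Position} (D : Beh X) (D' : Beh Y) (M : Cospan Y.diagram X.diagram) : Prop :=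
  ∀ y : Y.Agent, ∃ (x : X.Agent) (c : Cospan (ind y.arity) (ind x.arity)) (hc : IsView c)
    (α : Cell c M) (σ : ((D.at x).residual ⟨y.arity, c, hc⟩).states),
    α.top = Y.agentMap y ∧ α.bot = X.agentMap x ∧
      Nonempty (D'.at y ≅ ((D.at x).residual ⟨y.arity, c, hc⟩).restr σ)

/-- The edges of `𝕊`. -/
inductive SStep : Label → SVertex → SVertex → Prop
  | refl (x : SVertex) : SStep .id x x
  | action {x y : SVertex} {α : Label} {σ : Seed} (hσ : ClosedWorld α σ)
      (M : Cospan y.pos.diagram x.pos.diagram) (hM : IsActionOf σ M)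
      (h : SResidue x.beh y.beh M) : SStep α x y

/-- The testing relation of `𝕊`: `z ∈ (x | y)`. -/
def STest (x y z : SVertex) : Prop :=
  ∃ (e : x.pos.chan = y.pos.chan) (l : x.pos.diagram ⟶ z.pos.diagram)
    (r : y.pos.diagram ⟶ z.pos.diagram),
    IsPushout (interfaceMap x.pos.diagram) (x.pos.interfaceTo y.pos e) l r ∧
      Nonempty (x.beh ≅ z.beh.pull l) ∧ Nonempty (y.beh ≅ z.beh.pull r)

/-! ### The graph `𝕄` -/

/-- A definite behaviour `D[σ]` under a substitution `σ` into `γ`. -/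
structure Item (γ : Finset ℕ) where
  arity : ℕ
  beh : DefBeh arity
  sub : Fin arity → {c // c ∈ γ}

/-- `D[σ]` with `σ` postcomposed with an inclusion. -/
def Item.weaken {γ γ' : Finset ℕ} (h : γ ⊆ γ') (d : Item γ) : Item γ' :=
  ⟨d.arity, d.beh, fun i => ⟨d.sub i, h (d.sub i).2⟩⟩

/-- Mixed behaviours. -/
structure Mixed where
  chan : Finset ℕ
  items : Multiset (Item chan)

/-- The edges of `𝕄`. -/
inductive MStep : Label → Mixed → Mixed → Prop
  | fork {γ : Finset ℕ} {n : ℕ} (D : DefBeh n) (σ : Fin n → {c // c ∈ γ})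
      (i : D.after (.forkL n)) (j : D.after (.forkR n)) :
      MStep .id ⟨γ, {⟨n, D, σ⟩}⟩ ⟨γ, {⟨n, D.next _ i, σ⟩, ⟨n, D.next _ j, σ⟩}⟩
  | tau {γ : Finset ℕ} {n : ℕ} (D : DefBeh n) (σ : Fin n → {c // c ∈ γ})
      (i : D.after (.tau n)) :
      MStep .id ⟨γ, {⟨n, D, σ⟩}⟩ ⟨γ, {⟨n, D.next _ i, σ⟩}⟩
  | tick {γ : Finset ℕ} {n : ℕ} (D : DefBeh n) (σ : Fin n → {c // c ∈ γ})
      (i : D.after (.tick n)) :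
      MStep .heart ⟨γ, {⟨n, D, σ⟩}⟩ ⟨γ, {⟨n, D.next _ i, σ⟩}⟩
  | nu {γ : Finset ℕ} {n : ℕ} (D : DefBeh n) (σ : Fin n → {c // c ∈ γ})
      (i : D.after (.nu n)) (a : ℕ) (ha : a ∉ γ) :
      MStep .id ⟨γ, {⟨n, D, σ⟩}⟩
        ⟨insert a γ, {⟨n + 1, D.next _ i,
          Fin.snoc (α := fun _ => {c // c ∈ insert a γ})
            (fun k => ⟨σ k, Finset.mem_insert_of_mem (σ k).2⟩) ⟨a, Finset.mem_insert_self a γ⟩⟩}⟩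
  | sync {γ : Finset ℕ} {n₁ n₂ : ℕ} (D₁ : DefBeh n₁) (σ₁ : Fin n₁ → {c // c ∈ γ})
      (D₂ : DefBeh n₂) (σ₂ : Fin n₂ → {c // c ∈ γ}) (a₁ : Fin n₁) (a₂ b₂ : Fin n₂)
      (i : D₁.after (.inp n₁ a₁)) (j : D₂.after (.out n₂ a₂ b₂)) (h : σ₁ a₁ = σ₂ a₂) :
      MStep .id ⟨γ, {⟨n₁, D₁, σ₁⟩, ⟨n₂, D₂, σ₂⟩}⟩
        ⟨γ, {⟨n₁ + 1, D₁.next _ i, Fin.snoc (α := fun _ => {c // c ∈ γ}) σ₁ (σ₂ b₂)⟩,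
          ⟨n₂, D₂.next _ j, σ₂⟩}⟩
  | context {α : Label} {γ₁ γ₂ : Finset ℕ} {S₁ : Multiset (Item γ₁)} {S₂ : Multiset (Item γ₂)}
      (S : Multiset (Item γ₁)) (hγ : γ₁ ⊆ γ₂) (h : MStep α ⟨γ₁, S₁⟩ ⟨γ₂, S₂⟩) :
      MStep α ⟨γ₁, S + S₁⟩ ⟨γ₂, S.map (Item.weaken hγ) + S₂⟩
  | refl (x : Mixed) : MStep .id x x

/-- The testing relation of `𝕄`: the graph of the partial map `(γ ⊢ S) @ (γ ⊢ S') = γ ⊢ S ∪ S'`. -/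
inductive MTest : Mixed → Mixed → Mixed → Prop
  | mk (γ : Finset ℕ) (S S' : Multiset (Item γ)) : MTest ⟨γ, S⟩ ⟨γ, S'⟩ ⟨γ, S + S'⟩

/-- The map `𝕞`: the mixed behaviour of a position equipped with a definite behaviour. -/
def mixed (x : SVertex) : Mixed where
  chan := x.pos.chan
  items := x.pos.agents.attach.val.map fun a => ⟨a.1.1, ⟨x.beh.at a, x.definite a⟩, x.pos.port a⟩

end PiTraces

end

open CategoryTheory CategoryTheory.Limits Opposite

noncomputable section

namespace PiTraces

/-! Up to names, a position with a definite behaviour is a finite set of channels together with a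
multiset of agents, each carrying a behaviour and a tuple of channels. The point is that an edge of
`SStep`, although defined by pushouts and views, rewrites just one or two entries of this multiset,
as an edge of `MStep` does. The two graphs are compared by `Matches`, which allows a bijective
renaming of channels and isomorphisms of behaviours: the looseness is needed because edges of
`SStep` fix residuals only up to isomorphism and name channels freely, whereas the rules of `MStep`
are strict. `Matches` contains the graph of `mixed` and is a strong bisimulation
(`isBisimulation_matches`).

Three facts about an action make the simulation work. First, views: a view is empty, basic, or
contains two consecutive basic actions (`IsView.short`). Colouring the agents of an action as idle,
initial or final excludes the last case (`ActionData.no_chain`), so the residual of a final agent is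
taken along the empty view or along one basic action; `sResidue_iff` restates `SResidue` in terms of
elements, without cells. Residuals respect isomorphisms of views and behaviours, and the residual
along the empty view is the behaviour itself; this needs the study of prefix functors (`prefixIso`,
`prefixId`). Second, agents: interfaces have no agents, so those of the initial and final positions
split as passive agents plus agents of the seed (`ag_bijective`). Third, channels: the final
position has all the channels of the action, and so has the initial one except that ν adds one
channel (`ActionData.exists_names`, `ActionData.exists_names_nu`). Conversely every rule of `MStep`
is realised by an action constructed explicitly (`exists_actionData`).

For testing, a pushout over the interface adds the multisets of agents and identifies the channels,
so a test in `STest` matches the union of multisets (`STest.exists_mTest`), and it exists as soon as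
the channels agree (`exists_sTest`). Bisimulations preserve the pole, so `mixed` preserves and
reflects both the existence and the success of tests. Since `mixed` is surjective, quantifying over
tests on either side is the same, which gives the equivalence; surjectivity also gives the second
clause. -/

variable {P Q : Diagram}

/-! ### Diagrams through their elements and generating arrows -/

/-- The elements of a diagram over a vertex. -/
abbrev el (P : Diagram) (c : Vertex) : Type := P.obj (op c.ob)

/-- The action of a generating arrow on the elements of a diagram. -/
abbrev Edge.act (P : Diagram) {a b : Vertex} (e : Edge a b) : el P b → el P a :=
  P.map e.hom.op

/-- Morphisms of the quotient are represented by paths, and a path grows at its codomain end. This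
yields the possible shapes of a morphism with given domain. -/
theorem hom_induction {a : Vertex} {motive : ∀ {b : Vertex}, (a.ob ⟶ b.ob) → Prop}
    (id : motive (𝟙 a.ob))
    (comp : ∀ {b c : Vertex} (g : a.ob ⟶ b.ob) (e : Edge b c), motive g → motive (g ≫ e.hom))
    {b : Vertex} (g : a.ob ⟶ b.ob) : motive g := by
  obtain ⟨g, rfl⟩ := (Quotient.functor BaseRel).map_surjective g
  change Quiver.Path a b at g
  induction g with
  | nil => exact id
  | cons p e ih => exact comp _ e ih

theorem Diagram.naturality_of_edges (f : ∀ c : Vertex, el P c → el Q c)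
    (h : ∀ {a b : Vertex} (e : Edge a b) (x : el P b), f a (e.act P x) = e.act Q (f b x))
    {a b : Vertex} (g : a.ob ⟶ b.ob) (x : el P b) : f a (P.map g.op x) = Q.map g.op (f b x) := by
  induction g using hom_induction with
  | id => rw [op_id, P.map_id, Q.map_id]; rfl
  | comp g e ih =>
    rw [op_comp, P.map_comp, Q.map_comp]
    exact (ih _).trans (congrArg _ (h e x))

/-- A map of diagrams from a family compatible with the generating arrows. -/
def Diagram.homMk (f : ∀ c : Vertex, el P c → el Q c)
    (h : ∀ {a b : Vertex} (e : Edge a b) (x : el P b), f a (e.act P x) = e.act Q (f b x)) :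
    P ⟶ Q where
  app c := ↾ (f c.unop.as)
  naturality a b g := by
    ext x
    exact Diagram.naturality_of_edges f h g.unop x

@[simp] theorem Diagram.homMk_app (f : ∀ c : Vertex, el P c → el Q c)
    (h : ∀ {a b : Vertex} (e : Edge a b) (x : el P b), f a (e.act P x) = e.act Q (f b x))
    (c : Vertex) (x : el P c) : (Diagram.homMk f h).app (op c.ob) x = f c x := rfl

theorem Diagram.hom_ext {f g : P ⟶ Q}
    (h : ∀ (c : Vertex) (x : el P c), f.app (op c.ob) x = g.app (op c.ob) x) : f = g := by
  ext c x
  exact h c.unop.as x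

theorem Edge.act_app (f : P ⟶ Q) {a b : Vertex} (e : Edge a b) (x : el P b) :
    f.app (op a.ob) (e.act P x) = e.act Q (f.app (op b.ob) x) :=
  ConcreteCategory.congr_hom (f.naturality e.hom.op) x

theorem isPushout_at {A B C D : Diagram} {f : A ⟶ B} {g : A ⟶ C} {h : B ⟶ D} {k : C ⟶ D}
    (sq : IsPushout f g h k) (c : Vertex) :
    IsPushout (f.app (op c.ob)) (g.app (op c.ob)) (h.app (op c.ob)) (k.app (op c.ob)) :=
  sq.map ((evaluation Baseᵒᵖ Type).obj (op c.ob))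

/-- A diagram given by its elements and the action of the generating arrows. -/
structure Pre where
  el : Vertex → Type
  act : ∀ {a b : Vertex}, Edge a b → el b → el a
  st : ∀ {p n : ℕ} (b : Basic p n) (i : Fin n) (x : el (.act b)),
    act (.port p (Fin.castLE b.le i)) (act (.src b) x) = act (.port n i) (act (.tgt b) x)
  fork : ∀ (n : ℕ) (x : el (.fork n)),
    act (.tgt (.forkL n)) (act (.left n) x) = act (.tgt (.forkR n)) (act (.right n) x)
  subj : ∀ (n : ℕ) (a : Fin n) (m : ℕ) (c d : Fin m) (x : el (.sync n a m c d)),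
    act (.port n a) (act (.tgt (.inp n a)) (act (.rho n a m c d) x)) =
      act (.port m c) (act (.tgt (.out m c d)) (act (.eps n a m c d) x))
  obj : ∀ (n : ℕ) (a : Fin n) (m : ℕ) (c d : Fin m) (x : el (.sync n a m c d)),
    act (.port (n + 1) (Fin.last n)) (act (.src (.inp n a)) (act (.rho n a m c d) x)) =
      act (.port m d) (act (.src (.out m c d)) (act (.eps n a m c d) x))

/-- The diagram with given elements. -/
def Pre.diagram (X : Pre) : Diagram :=
  Functor.leftOp (CategoryTheory.Quotient.lift BaseRel
    (Paths.lift
      { obj := fun c => op (X.el c)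
        map := fun e => Quiver.Hom.op (↾ X.act e) })
    (by
      intro a b p q h
      apply Quiver.Hom.unop_inj
      ext x
      cases h
      · exact X.st _ _ _
      · exact X.fork _ _
      · exact X.subj _ _ _ _ _ _
      · exact X.obj _ _ _ _ _ _))

theorem Pre.act_diagram (X : Pre) {a b : Vertex} (e : Edge a b) (x : X.el b) :
    e.act X.diagram x = X.act e x := rfl

theorem Position.act_diagram (X : Position) {a b : Vertex} (e : Edge a b) (x : X.elems b) :
    e.act X.diagram x = X.action e x := rfl

/-! ### Morphisms of the base category -/

/-- The morphisms out of a basic action. -/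
inductive ActHom : ∀ {p n : ℕ} (_ : Basic p n) {V : Vertex}, ((Vertex.act ‹_›).ob ⟶ V.ob) → Prop
  | id {p n : ℕ} (b : Basic p n) : ActHom b (𝟙 _)
  | left (n : ℕ) : ActHom (.forkL n) (Edge.left n).hom
  | right (n : ℕ) : ActHom (.forkR n) (Edge.right n).hom
  | rho (n : ℕ) (a : Fin n) (m : ℕ) (c d : Fin m) : ActHom (.inp n a) (Edge.rho n a m c d).hom
  | eps (n : ℕ) (a : Fin n) (m : ℕ) (c d : Fin m) : ActHom (.out m c d) (Edge.eps n a m c d).hom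

/-- No generating arrow leaves a fork or a synchronisation, so a path that starts at a basic action
has length at most one. -/
theorem actHom {p n : ℕ} (b : Basic p n) {V : Vertex} (f : (Vertex.act b).ob ⟶ V.ob) :
    ActHom b f := by
  induction f using hom_induction with
  | id => exact .id b
  | comp g e ih =>
    cases ih with
    | id =>
      rw [Category.id_comp]
      cases e with
      | left => exact .left _
      | right => exact .right _
      | rho => exact .rho _ _ _ _ _
      | eps => exact .eps _ _ _ _ _
    | left => exact nomatch e
    | right => exact nomatch e
    | rho => exact nomatch e
    | eps => exact nomatch e

/-- Factors a non-identity morphism through its first generator; combined with `actHom`, this lists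
all agents of the representables. -/
theorem agHom {k : ℕ} {V : Vertex} (f : (Vertex.ag k).ob ⟶ V.ob) :
    (∃ h : Vertex.ag k = V, f = eqToHom (by rw [h])) ∨
      (∃ (n : ℕ) (b : Basic k n) (g : (Vertex.act b).ob ⟶ V.ob), f = (Edge.src b).hom ≫ g) ∨
      ∃ (p : ℕ) (b : Basic p k) (g : (Vertex.act b).ob ⟶ V.ob), f = (Edge.tgt b).hom ≫ g := by
  induction f using hom_induction with
  | id => exact .inl ⟨rfl, rfl⟩
  | comp g e ih =>
    rcases ih with ⟨rfl, rfl⟩ | ⟨n, b, g, rfl⟩ | ⟨p, b, g, rfl⟩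
    · rw [eqToHom_refl, Category.id_comp]
      cases e with
      | src b => exact .inr (.inl ⟨_, b, 𝟙 _, (Category.comp_id _).symm⟩)
      | tgt b => exact .inr (.inr ⟨_, b, 𝟙 _, (Category.comp_id _).symm⟩)
    · exact .inr (.inl ⟨_, b, g ≫ e.hom, Category.assoc _ _ _⟩)
    · exact .inr (.inr ⟨_, b, g ≫ e.hom, Category.assoc _ _ _⟩)

theorem starHom {V : Vertex} (f : Vertex.star.ob ⟶ V.ob) :
    (∃ h : Vertex.star = V, f = eqToHom (by rw [h])) ∨
      ∃ (n : ℕ) (i : Fin n) (g : (Vertex.ag n).ob ⟶ V.ob), f = (Edge.port n i).hom ≫ g := by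
  induction f using hom_induction with
  | id => exact .inl ⟨rfl, rfl⟩
  | comp g e ih =>
    rcases ih with ⟨rfl, rfl⟩ | ⟨n, i, g, rfl⟩
    · rw [eqToHom_refl, Category.id_comp]
      cases e with
      | port n i => exact .inr ⟨_, i, 𝟙 _, (Category.comp_id _).symm⟩
    · exact .inr ⟨_, i, g ≫ e.hom, Category.assoc _ _ _⟩

/-- The generic element of a representable diagram. -/
abbrev gen (V : Vertex) : el (rep V) V := 𝟙 V.ob

theorem nameOf_gen {c : Vertex} (x : el P c) : (nameOf (P := P) x).app (op c.ob) (gen c) = x := by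
  simp [gen]

theorem Edge.act_gen {a b : Vertex} (e : Edge a b) : e.act (PiTraces.rep b) (gen b) = e.hom :=
  Category.comp_id e.hom

theorem Edge.rep_gen {a b : Vertex} (e : Edge a b) : e.rep.app (op a.ob) (gen a) = e.hom :=
  Category.id_comp e.hom

theorem rep_hom_ext {V : Vertex} {f g : rep V ⟶ P}
    (h : f.app (op V.ob) (gen V) = g.app (op V.ob) (gen V)) : f = g :=
  yonedaEquiv.injective h

theorem el_ind {n k : ℕ} (x : el (ind n) (.ag k)) :
    ∃ h : k = n, x = h ▸ gen (.ag k) := by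
  rcases hom_ag x with ⟨h, hx⟩ | ⟨h, -⟩
  · cases h
    exact ⟨rfl, hx⟩
  · exact nomatch h

instance {n k : ℕ} : Subsingleton (el (ind n) (.ag k)) := ⟨fun x y => by
  obtain ⟨rfl, rfl⟩ := el_ind x
  obtain ⟨_, rfl⟩ := el_ind y
  rfl⟩

/-! ### Views of length at most one -/

theorem Cospan.Iso.symm {Y X : Diagram} {u u' : Cospan Y X} (h : u.Iso u') : u'.Iso u := by
  obtain ⟨f, hs, ht⟩ := h
  exact ⟨f.symm, by rw [← hs]; simp, by rw [← ht]; simp⟩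

theorem Cospan.Iso.trans {Y X : Diagram} {u u' u'' : Cospan Y X} (h : u.Iso u') (h' : u'.Iso u'') :
    u.Iso u'' := by
  obtain ⟨f, hs, ht⟩ := h
  obtain ⟨f', hs', ht'⟩ := h'
  exact ⟨f ≪≫ f', by rw [← hs', ← hs]; simp, by rw [← ht', ← ht]; simp⟩

/-- Both legs of `u` are the same isomorphism, so the pushout along `u.s` is again an isomorphism
and the pushout condition also handles `u.t`. -/
theorem Cospan.comp_iso_of_left {T Y : Diagram} {u : Cospan Y Y} (h : (Cospan.id Y).Iso u)
    (w : Cospan T Y) : w.Iso (u.comp w) := by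
  obtain ⟨f, hs, ht⟩ := h
  have : IsIso u.s := by rw [← hs]; infer_instance
  refine ⟨asIso (pushout.inr u.s w.t), rfl, ?_⟩
  have e : u.s = u.t := by rw [← hs, ← ht]
  exact pushout.condition.symm.trans (congrArg (· ≫ _) e)

theorem Cospan.comp_iso_of_right {Y X : Diagram} (u : Cospan Y X) {w : Cospan Y Y}
    (h : (Cospan.id Y).Iso w) : u.Iso (u.comp w) := by
  obtain ⟨f, hs, ht⟩ := h
  have : IsIso w.t := by rw [← ht]; infer_instance
  refine ⟨asIso (pushout.inl u.s w.t), ?_, rfl⟩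
  have e : w.s = w.t := by rw [← hs, ← ht]
  exact pushout.condition.trans (congrArg (· ≫ _) e.symm)

/-- A cospan isomorphic to an empty view or to a basic seed, or with two consecutive basic
actions. -/
inductive Short : ∀ {p n : ℕ}, Cospan (ind p) (ind n) → Prop
  | id {n : ℕ} {c : Cospan (ind n) (ind n)} (h : (Cospan.id (ind n)).Iso c) : Short c
  | basic {p n : ℕ} (b : Basic p n) {c : Cospan (ind p) (ind n)} (h : b.cospan.Iso c) : Short c
  | chain {p n : ℕ} {c : Cospan (ind p) (ind n)} {k q r : ℕ} (b : Basic k q) (b' : Basic q r)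
      (x : el c.mid (.act b)) (x' : el c.mid (.act b'))
      (h : (Edge.tgt b).act c.mid x = (Edge.src b').act c.mid x') : Short c

theorem Short.iso {p n : ℕ} {c c' : Cospan (ind p) (ind n)} (hc : Short c) (h : c.Iso c') :
    Short c' := by
  cases hc with
  | id h' => exact .id (h'.trans h)
  | basic b h' => exact .basic b (h'.trans h)
  | chain b b' x x' e =>
    obtain ⟨f, -, -⟩ := h
    refine .chain b b' (f.hom.app _ x) (f.hom.app _ x') ?_
    rw [← Edge.act_app, ← Edge.act_app, e]

/-- In a composite of two basic views, gluing identifies the initial agent of the upper one with the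
final agent of the lower one, which is a chain. A chain survives any further composition because the
pushout inclusions are maps of diagrams. A chain is not claimed to determine the view: it only has
to be excluded later. -/
theorem IsView.short {p n : ℕ} {c : Cospan (ind p) (ind n)} (hc : IsView c) : Short c := by
  induction hc with
  | id n => exact .id ⟨Iso.refl _, rfl, rfl⟩
  | basic b => exact .basic b ⟨Iso.refl _, Category.comp_id _, Category.comp_id _⟩
  | iso _ h ih => exact ih.iso h
  | @comp q p n u w _ _ hu hw =>
    cases hu with
    | id h => exact hw.iso (Cospan.comp_iso_of_left h w)
    | chain b b' x x' e =>
      refine .chain b b' ((pushout.inl u.s w.t).app _ x) ((pushout.inl u.s w.t).app _ x') ?_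
      rw [← Edge.act_app, ← Edge.act_app, e]
    | basic b h =>
      cases hw with
      | id h' => exact Short.iso (.basic b h) (Cospan.comp_iso_of_right u h')
      | chain b b' x x' e =>
        refine .chain b b' ((pushout.inr u.s w.t).app _ x) ((pushout.inr u.s w.t).app _ x') ?_
        rw [← Edge.act_app, ← Edge.act_app, e]
      | basic b' h' =>
        obtain ⟨f, hs, ht⟩ := h
        obtain ⟨f', hs', ht'⟩ := h'
        refine .chain b' b ((f'.hom ≫ pushout.inr u.s w.t).app _ (gen _))
          ((f.hom ≫ pushout.inl u.s w.t).app _ (gen _)) ?_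
        rw [← Edge.act_app, ← Edge.act_app, Edge.act_gen, Edge.act_gen, ← Edge.rep_gen,
          ← Edge.rep_gen, ← NatTrans.comp_app_apply, ← NatTrans.comp_app_apply]
        have e : (Edge.tgt b').rep ≫ f'.hom ≫ pushout.inr u.s w.t =
            (Edge.src b).rep ≫ f.hom ≫ pushout.inl u.s w.t := by
          rw [← Category.assoc, ← Category.assoc]
          exact (congrArg (· ≫ _) ht').trans
            (pushout.condition.symm.trans (congrArg (· ≫ _) hs).symm)
        rw [e]

/-! ### Positions are closed under pushouts -/

theorem el_eq_or_eq {A B C D : Diagram} {f : A ⟶ B} {g : A ⟶ C} {h : B ⟶ D} {k : C ⟶ D}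
    (sq : IsPushout f g h k) {c : Vertex} (x : el D c) :
    (∃ y : el B c, h.app _ y = x) ∨ ∃ z : el C c, k.app _ z = x :=
  Types.eq_or_eq_of_isPushout (isPushout_at sq c) x

theorem IsPosition.of_isPushout {A B C D : Diagram} {f : A ⟶ B} {g : A ⟶ C} {h : B ⟶ D} {k : C ⟶ D}
    (sq : IsPushout f g h k) (hB : IsPosition B) (hC : IsPosition C) : IsPosition D := by
  have := hB.finite
  have := hC.finite
  refine ⟨?_, ?_⟩
  · refine Finite.of_surjective
      (Sum.elim (fun x : Σ c : Vertex, el B c => (⟨x.1, h.app _ x.2⟩ : Σ c : Vertex, el D c))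
        (fun x : Σ c : Vertex, el C c => (⟨x.1, k.app _ x.2⟩ : Σ c : Vertex, el D c))) ?_
    rintro ⟨c, x⟩
    rcases el_eq_or_eq sq x with ⟨y, rfl⟩ | ⟨y, rfl⟩
    · exact ⟨.inl ⟨c, y⟩, rfl⟩
    · exact ⟨.inr ⟨c, y⟩, rfl⟩
  · rintro c ⟨x⟩
    rcases el_eq_or_eq sq x with ⟨y, rfl⟩ | ⟨y, rfl⟩
    · exact hB.dim_le c ⟨y⟩
    · exact hC.dim_le c ⟨y⟩

theorem Seed.isPosition_final (σ : Seed) : IsPosition σ.final := by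
  cases σ with
  | act b => exact isPosition_ind _
  | fork n => exact .of_isPushout (.of_hasPushout _ _) (isPosition_ind _) (isPosition_ind _)
  | sync => exact .of_isPushout (.of_hasPushout _ _) (isPosition_ind _) (isPosition_ind _)

theorem Seed.isPosition_init (σ : Seed) : IsPosition σ.init := by
  cases σ with
  | act b => exact isPosition_ind _
  | fork n => exact isPosition_ind _
  | sync => exact .of_isPushout (.of_hasPushout _ _) (isPosition_ind _) (isPosition_ind _)

/-- Empty traces exist on positions only, so this is what allows an empty trace to be appended after
a given one. -/
theorem IsTrace.isPosition_final {Y X : Diagram} {u : Cospan Y X} (h : IsTrace u) :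
    IsPosition Y := by
  induction h with
  | id h => exact h
  | action σ h =>
    obtain ⟨Z, hZ, h, j, x, zx, μ, zu, y, zy, -, -, -, sq, -⟩ := h
    exact .of_isPushout sq σ.isPosition_final hZ
  | comp _ _ _ h => exact h
  | iso _ _ h => exact h

/-! ### Isomorphic views have isomorphic prefix functors -/

theorem OneInj.comp {A B C : Diagram} {f : A ⟶ B} {g : B ⟶ C} (hf : OneInj f) (hg : OneInj g) :
    OneInj (f ≫ g) := by
  intro c hc x y h
  rw [NatTrans.comp_app_apply, NatTrans.comp_app_apply] at h
  exact hf c hc (hg c hc h)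

/-- Precomposition of an extension `(w, α)` with a cell `w' → w` over the base. -/
abbrev Extension.whisker {n : ℕ} {v v' : View n} (g : Extension v v') {T : Diagram}
    (w : Cospan T (ind v.arity)) (hw : IsTrace w) (γ : Cell w g.w) (hγ : γ.bot = 𝟙 _) :
    Extension v v' where
  T := T
  w := w
  isTrace := hw
  cell :=
    { top := γ.top ≫ g.cell.top
      mid := pushout.desc (pushout.inl _ _) (γ.mid ≫ pushout.inr _ _)
        (by rw [← Category.assoc, γ.w_t, hγ, Category.id_comp, pushout.condition]) ≫ g.cell.mid
      bot := 𝟙 _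
      top_inj := γ.top_inj.comp g.cell.top_inj
      mid_inj := by
        -- By cancellation of pushouts, the map from `v • w` to `v • g.w` is a pushout of `γ.mid`,
        -- hence inherits its `1`-injectivity.
        refine OneInj.comp (oneInj_of_isPushout
          (IsPushout.of_left (v₁₃ := pushout.inr v.cospan.s g.w.t) (h₁₂ := γ.mid) (h₁₁ := w.t)
            (v₁₂ := pushout.inr v.cospan.s w.t)
            (h₂₁ := pushout.inl v.cospan.s w.t) (v₁₁ := v.cospan.s) ?_ ?_
            (IsPushout.of_hasPushout _ _).flip) γ.mid_inj) g.cell.mid_inj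
        · have e : w.t ≫ γ.mid = g.w.t := by rw [γ.w_t, hγ, Category.id_comp]
          rw [pushout.inl_desc]
          simp only [e]
          exact (IsPushout.of_hasPushout _ _).flip
        · rw [pushout.inr_desc]
      bot_inj := oneInj_id _
      w_s := by
        rw [Category.assoc, pushout.inr_desc_assoc, Category.assoc, ← Category.assoc, γ.w_s,
          Category.assoc, Category.assoc, g.s_onExt]
      w_t := by
        rw [Category.assoc, pushout.inl_desc_assoc, Category.id_comp, g.t_onBase] }
  bot := rfl

/-- The defining equivalence in usable form: the trace of an extension may be replaced by an
isomorphic one, such as `id • w` in place of `w`. -/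
theorem Extension.whisker_hom {n : ℕ} {v v' : View n} (g : Extension v v') {T : Diagram}
    (w : Cospan T (ind v.arity)) (hw : IsTrace w) (γ : Cell w g.w) (hγ : γ.bot = 𝟙 _) :
    (g.whisker w hw γ hγ).hom = g.hom :=
  CategoryTheory.Quotient.sound _ (ViewRel.whisker g (g.whisker w hw γ hγ) γ hγ rfl
    (pushout.inl_desc_assoc _ _ _ _)
      ((pushout.inr_desc_assoc _ _ _ _).trans (Category.assoc _ _ _)))

section IsoExt

variable {n p : ℕ} {c c' : Cospan (ind p) (ind n)} (hc : IsView c) (hc' : IsView c')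
  (f : c.mid ≅ c'.mid) (hs : c.s ≫ f.hom = c'.s) (ht : c.t ≫ f.hom = c'.t)

/-- The extension between isomorphic views. -/
abbrev isoExt : Extension (⟨p, c, hc⟩ : View n) ⟨p, c', hc'⟩ where
  T := ind p
  w := Cospan.id _
  isTrace := .id (isPosition_ind p)
  cell :=
    { top := 𝟙 _
      mid := pushout.desc f.hom c'.s (by rw [hs, Category.id_comp])
      bot := 𝟙 _
      top_inj := oneInj_id _
      mid_inj := by
        have h : IsIso (pushout.desc f.hom c'.s (by rw [hs, Category.id_comp]) :
            pushout c.s (𝟙 _) ⟶ c'.mid) := by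
          refine ⟨f.inv ≫ pushout.inl _ _, pushout.hom_ext ?_ ?_, ?_⟩
          · rw [pushout.inl_desc_assoc, f.hom_inv_id_assoc, Category.comp_id]
          · rw [pushout.inr_desc_assoc, ← hs, Category.assoc, f.hom_inv_id_assoc, Category.comp_id,
              pushout.condition, Category.id_comp]
          · rw [Category.assoc, pushout.inl_desc, f.inv_hom_id]
        exact oneInj_of_isIso _
      bot_inj := oneInj_id _
      w_s := by rw [Category.assoc, pushout.inr_desc]
      w_t := by rw [Category.assoc, pushout.inl_desc, ht, Category.id_comp] }
  bot := rfl

/-- The composite of an isomorphism of views with an extension. -/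
abbrev isoExtComp {v : View n} (g : Extension (⟨p, c', hc'⟩ : View n) v) :
    Extension (⟨p, c, hc⟩ : View n) v where
  T := g.T
  w := g.w
  isTrace := g.isTrace
  cell :=
    { top := g.cell.top
      mid := pushout.map c.s g.w.t c'.s g.w.t f.hom (𝟙 _) (𝟙 _) (by rw [hs, Category.id_comp])
        (by rw [Category.comp_id, Category.id_comp]) ≫ g.cell.mid
      bot := 𝟙 _
      top_inj := g.cell.top_inj
      mid_inj := (oneInj_of_isIso _).comp g.cell.mid_inj
      bot_inj := oneInj_id _
      w_s := by
        rw [Category.assoc, pushout.inr_desc_assoc, Category.id_comp, g.s_onExt]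
      w_t := by
        rw [Category.assoc, pushout.inl_desc_assoc, ← g.t_onBase, ← ht, Category.id_comp]
        simp only [Category.assoc] }
  bot := rfl

/-- The composition rule produces a pair whose trace is `id • g.w`; whiskering by the cell `id • g.w
≅ g.w` brings the trace back to `g.w`, so that composites can be compared strictly. -/
theorem isoExt_comp {v : View n} (g : Extension (⟨p, c', hc'⟩ : View n) v) :
    (isoExt hc hc' f hs ht).hom ≫ g.hom = (isoExtComp hc hc' f hs ht g).hom := by
  let γ : Cell ((Cospan.id (ind p)).comp g.w) g.w :=
    { top := 𝟙 _
      mid := pushout.desc g.w.t (𝟙 _) (by rw [Category.id_comp, Category.comp_id])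
      bot := 𝟙 _
      top_inj := oneInj_id _
      mid_inj := by
        have h : IsIso (pushout.desc g.w.t (𝟙 _) (by rw [Category.id_comp, Category.comp_id]) :
            pushout (𝟙 (ind p)) g.w.t ⟶ g.w.mid) := by
          refine ⟨pushout.inr _ _, pushout.hom_ext ?_ ?_, pushout.inr_desc _ _ _⟩
          · rw [pushout.inl_desc_assoc, ← pushout.condition, Category.id_comp, Category.comp_id]
          · rw [pushout.inr_desc_assoc, Category.id_comp, Category.comp_id]
        exact oneInj_of_isIso _
      bot_inj := oneInj_id _
      w_s := by rw [Category.assoc, pushout.inr_desc, Category.id_comp, Category.comp_id]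
      w_t := by rw [Category.assoc, pushout.inl_desc] }
  let β : Cell g.w g.w :=
    ⟨𝟙 _, 𝟙 _, 𝟙 _, oneInj_id _, oneInj_id _, oneInj_id _, by simp, by simp⟩
  have h₁ : pushout.inl (𝟙 (ind p)) g.w.t ≫ γ.mid = g.w.t := pushout.inl_desc _ _ _
  have h₂ : pushout.inr (𝟙 (ind p)) g.w.t ≫ γ.mid = 𝟙 _ := pushout.inr_desc _ _ _
  have hw : IsTrace ((Cospan.id (ind p)).comp g.w) := .comp (.id (isPosition_ind p)) g.isTrace
  -- The right-hand side is replaced by its representative over the trace `id • g.w`, which is the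
  -- shape of `ViewRel.comp`.
  rw [← (isoExtComp hc hc' f hs ht g).whisker_hom _ hw γ rfl]
  refine ((Quotient.functor (ViewRel n)).map_comp _ _).symm.trans (CategoryTheory.Quotient.sound _
    (ViewRel.comp (isoExt hc hc' f hs ht) g g.w g.isTrace β rfl _ rfl rfl ?_ ?_ ?_))
  · refine (pushout.inl_desc_assoc _ _ _ _).trans ((pushout.inl_desc_assoc _ _ _ _).trans ?_)
    refine (Category.assoc _ _ _).trans (congrArg (· ≫ g.onBase) (pushout.inl_desc _ _ _).symm)
  · refine (congrArg (_ ≫ ·) (pushout.inr_desc_assoc _ _ _ _)).trans ?_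
    refine (congrArg (_ ≫ ·) (Category.assoc _ _ _)).trans
      ((Category.assoc _ _ _).symm.trans ((congrArg (· ≫ _) h₁).trans ?_))
    refine (congrArg (g.w.t ≫ ·) (pushout.inr_desc_assoc _ _ _ _)).trans ?_
    rw [Category.id_comp, ← g.s_onBase]
    exact congrArg (· ≫ g.onBase) (pushout.inr_desc _ _ _).symm
  · refine (congrArg (_ ≫ ·) (pushout.inr_desc_assoc _ _ _ _)).trans ?_
    refine (congrArg (_ ≫ ·) (Category.assoc _ _ _)).trans
      ((Category.assoc _ _ _).symm.trans ((congrArg (· ≫ _) h₂).trans ?_))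
    rw [Category.id_comp]
    refine (pushout.inr_desc_assoc _ _ _ _).trans ?_
    rw [Category.id_comp]
    exact (Category.id_comp _).symm

/-- The composite of an extension with an isomorphism of views. -/
abbrev compIsoExt {v : View n} (g : Extension v (⟨p, c, hc⟩ : View n)) :
    Extension v (⟨p, c', hc'⟩ : View n) where
  T := g.T
  w := g.w
  isTrace := g.isTrace
  cell :=
    { top := g.cell.top
      mid := g.cell.mid ≫ f.hom
      bot := 𝟙 _
      top_inj := g.cell.top_inj
      mid_inj := g.cell.mid_inj.comp (oneInj_of_isIso _)
      bot_inj := oneInj_id _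
      w_s := by rw [← Category.assoc, g.cell.w_s, Category.assoc, hs]
      w_t := by rw [← Category.assoc, g.cell.w_t, Category.assoc, ht, g.bot] }
  bot := rfl

/-- Dual to `isoExt_comp`: the empty trace of the isomorphism restricts along `g.cell.top` to the
empty trace on `g.T`, and `g.w • id` is normalised to `g.w`. -/
theorem comp_isoExt {v : View n} (g : Extension v (⟨p, c, hc⟩ : View n)) :
    g.hom ≫ (isoExt hc hc' f hs ht).hom = (compIsoExt hc hc' f hs ht g).hom := by
  have hT := g.isTrace.isPosition_final
  let γ : Cell (g.w.comp (Cospan.id g.T)) g.w :=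
    { top := 𝟙 _
      mid := pushout.desc (𝟙 _) g.w.s (by rw [Category.id_comp, Category.comp_id])
      bot := 𝟙 _
      top_inj := oneInj_id _
      mid_inj := by
        have h : IsIso (pushout.desc (𝟙 _) g.w.s (by rw [Category.id_comp, Category.comp_id]) :
            pushout g.w.s (𝟙 g.T) ⟶ g.w.mid) := by
          refine ⟨pushout.inl _ _, pushout.hom_ext ?_ ?_, pushout.inl_desc _ _ _⟩
          · rw [pushout.inl_desc_assoc, Category.id_comp, Category.comp_id]
          · rw [pushout.inr_desc_assoc, pushout.condition, Category.id_comp, Category.comp_id]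
        exact oneInj_of_isIso _
      bot_inj := oneInj_id _
      w_s := by rw [Category.assoc, pushout.inr_desc]
      w_t := by rw [Category.assoc, pushout.inl_desc, Category.id_comp, Category.comp_id] }
  let β : Cell (Cospan.id g.T) (Cospan.id (ind p)) :=
    ⟨g.cell.top, g.cell.top, g.cell.top, g.cell.top_inj, g.cell.top_inj, g.cell.top_inj,
      by simp, by simp⟩
  have h₁ : pushout.inl g.w.s (𝟙 g.T) ≫ γ.mid = 𝟙 _ := pushout.inl_desc _ _ _
  have h₂ : pushout.inr g.w.s (𝟙 g.T) ≫ γ.mid = g.w.s := pushout.inr_desc _ _ _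
  have hw : IsTrace (g.w.comp (Cospan.id g.T)) := .comp g.isTrace (.id hT)
  rw [← (compIsoExt hc hc' f hs ht g).whisker_hom _ hw γ rfl]
  refine ((Quotient.functor (ViewRel n)).map_comp _ _).symm.trans (CategoryTheory.Quotient.sound _
    (ViewRel.comp g (isoExt hc hc' f hs ht) (Cospan.id g.T) (.id hT) β rfl _ rfl ?_ ?_ ?_ ?_))
  · exact (Category.id_comp _).trans (Category.comp_id _).symm
  · refine (pushout.inl_desc_assoc _ _ _ _).trans ((Category.assoc _ _ _).symm.trans ?_)
    exact congrArg (g.onBase ≫ ·) (pushout.inl_desc _ _ _).symm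
  · refine (congrArg (_ ≫ ·) (pushout.inr_desc_assoc _ _ _ _)).trans ?_
    refine (congrArg (_ ≫ ·) (Category.assoc _ _ _)).trans
      ((Category.assoc _ _ _).symm.trans ((congrArg (· ≫ _) h₁).trans ?_))
    rw [Category.id_comp]
    exact (Category.assoc _ _ _).symm.trans (congrArg (g.onExt ≫ ·) (pushout.inl_desc _ _ _).symm)
  · refine (congrArg (_ ≫ ·) (pushout.inr_desc_assoc _ _ _ _)).trans ?_
    refine (congrArg (_ ≫ ·) (Category.assoc _ _ _)).trans
      ((Category.assoc _ _ _).symm.trans ((congrArg (· ≫ _) h₂).trans ?_))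
    have h₃ := g.s_onExt
    refine (congrArg (g.w.s ≫ ·) (Category.assoc _ _ _).symm).trans
      ((Category.assoc _ _ _).symm.trans
      ((congrArg (· ≫ f.hom) h₃).trans ?_))
    rw [Category.assoc]
    refine congrArg (g.cell.top ≫ ·) (Eq.trans ?_ (pushout.inr_desc _ _ _).symm)
    exact hs

/-- After `comp_isoExt` the composite is carried by the empty trace, and the rule for identities
applies. -/
theorem isoExt_hom_inv (hs' : c'.s ≫ f.inv = c.s) (ht' : c'.t ≫ f.inv = c.t) :
    (isoExt hc hc' f hs ht).hom ≫ (isoExt hc' hc f.symm hs' ht').hom = 𝟙 _ := by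
  rw [comp_isoExt]
  refine CategoryTheory.Quotient.sound _ (ViewRel.id _ _ rfl rfl ?_)
  refine (pushout.inl_desc_assoc _ _ _ _).trans f.hom_inv_id

/-- Isomorphic views are isomorphic in the category of views. -/
abbrev isoOfIso : (⟨p, c, hc⟩ : View n).ob ≅ (⟨p, c', hc'⟩ : View n).ob :=
  have hs' : c'.s ≫ f.inv = c.s := by rw [← hs, Category.assoc, f.hom_inv_id, Category.comp_id]
  have ht' : c'.t ≫ f.inv = c.t := by rw [← ht, Category.assoc, f.hom_inv_id, Category.comp_id]
  ⟨(isoExt hc hc' f hs ht).hom, (isoExt hc' hc f.symm hs' ht').hom,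
    isoExt_hom_inv _ _ _ _ _ _ _, isoExt_hom_inv hc' hc f.symm hs' ht' hs ht⟩

end IsoExt

/-- Natural isomorphisms between functors on categories of views. -/
def natIsoOfExt {n p : ℕ} {F G : ViewCat p ⥤ ViewCat n} (φ : ∀ w : View p, F.obj w.ob ≅ G.obj w.ob)
    (h : ∀ {w w' : View p} (g : Extension w w'),
      F.map g.hom ≫ (φ w').hom = (φ w).hom ≫ G.map g.hom) : F ≅ G :=
  CategoryTheory.Quotient.natIsoLift _ (Paths.liftNatIso φ fun g => h g)

/-- The lower components are both the identity and all other fields are proofs, so only these four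
data can differ. -/
theorem Extension.hom_eq {n : ℕ} {v v' : View n} {g g' : Extension v v'} (hT : g.T = g'.T)
    (hw : HEq g.w g'.w) (htop : HEq g.cell.top g'.cell.top) (hmid : HEq g.cell.mid g'.cell.mid) :
    g.hom = g'.hom := by
  obtain ⟨T, w, ht, ⟨top, mid, bot, _, _, _, _, _⟩, hb⟩ := g
  obtain ⟨T', w', ht', ⟨top', mid', bot', _, _, _, _, _⟩, hb'⟩ := g'
  cases hT
  cases hw
  cases htop
  cases hmid
  cases hb
  cases hb'
  rfl

/-- Prefixing by isomorphic views. -/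
def prefixIso {n p : ℕ} {c c' : Cospan (ind p) (ind n)} (hc : IsView c) (hc' : IsView c')
    (f : c.mid ≅ c'.mid) (hs : c.s ≫ f.hom = c'.s) (ht : c.t ≫ f.hom = c'.t) :
    (⟨p, c, hc⟩ : View n).prefix ≅ (⟨p, c', hc'⟩ : View n).prefix :=
  let φ (w : View p) : pushout c.s w.cospan.t ≅ pushout c'.s w.cospan.t :=
    asIso (pushout.map c.s w.cospan.t c'.s w.cospan.t f.hom (𝟙 _) (𝟙 _)
        (by rw [hs, Category.id_comp]) (by rw [Category.comp_id, Category.id_comp]))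
  have hl (w : View p) : pushout.inl _ _ ≫ (φ w).hom = f.hom ≫ pushout.inl _ _ :=
    pushout.inl_desc _ _ _
  have hr (w : View p) : pushout.inr _ _ ≫ (φ w).hom = pushout.inr _ _ :=
    (pushout.inr_desc _ _ _).trans (Category.id_comp _)
  natIsoOfExt (fun w => isoOfIso (c := c.comp w.cospan) (c' := c'.comp w.cospan)
      (.comp hc w.isView) (.comp hc' w.isView) (φ w)
      (by rw [Category.assoc, hr]) (by rw [Category.assoc, hl, reassoc_of% ht]))
    (by
      intro w w' g
      refine (congrArg (· ≫ _) (View.prefixPairs_path _ g)).trans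
        (Eq.trans ?_ (congrArg (_ ≫ ·) (View.prefixPairs_path (⟨p, c', hc'⟩ : View n) g)).symm)
      refine (comp_isoExt _ _ _ _ _ _).trans (Eq.trans ?_ (isoExt_comp _ _ _ _ _ _).symm)
      -- Both sides of the naturality square have trace `g.w` and the same top, so it remains to
      -- compare two maps out of an iterated pushout on its three pieces.
      refine Extension.hom_eq rfl HEq.rfl HEq.rfl (heq_of_eq ?_)
      refine pushout.hom_ext (pushout.hom_ext ?_ ?_) ?_
      · rw [pushout.inl_desc_assoc, pushout.inl_desc_assoc, pushout.inl_desc_assoc, hl,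
          Category.assoc]
        exact ((Category.assoc _ _ _).symm.trans ((congrArg (· ≫ _) (hl w)).trans
          ((Category.assoc _ _ _).trans (congrArg (f.hom ≫ ·)
            ((congrArg (_ ≫ ·) (View.compExt_onBase (⟨p, c', hc'⟩ : View n) g)).trans
                (pushout.inl_desc _ _ _)))))).symm
      · rw [pushout.inl_desc_assoc, pushout.inr_desc_assoc, pushout.inl_desc_assoc, Category.assoc,
          hr, Category.assoc]
        exact ((Category.assoc _ _ _).symm.trans ((congrArg (· ≫ _) (hr w)).trans
          ((congrArg (_ ≫ ·) (View.compExt_onBase (⟨p, c', hc'⟩ : View n) g)).trans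
              (pushout.inr_desc _ _ _)))).symm
      · rw [pushout.inr_desc_assoc, pushout.inr_desc_assoc, Category.id_comp, pushout.inr_desc]
        exact (Category.assoc _ _ _).trans (congrArg (g.onExt ≫ ·) (hr w')))

/-- Prefixing by the identity. -/
def prefixId (n : ℕ) : (View.id n).prefix ≅ 𝟭 (ViewCat n) :=
  let φ (w : View n) : pushout (𝟙 (ind n)) w.cospan.t ≅ w.cospan.mid :=
    (asIso (pushout.inr (𝟙 (ind n)) w.cospan.t)).symm
  have hr (w : View n) : pushout.inr _ _ ≫ (φ w).hom = 𝟙 _ := IsIso.hom_inv_id _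
  have hl (w : View n) : pushout.inl _ _ ≫ (φ w).hom = w.cospan.t := by
    have h : pushout.inl (𝟙 (ind n)) w.cospan.t = w.cospan.t ≫ pushout.inr _ _ :=
      (Category.id_comp _).symm.trans pushout.condition
    rw [h, Category.assoc, hr, Category.comp_id]
  natIsoOfExt (fun w => isoOfIso (c := (Cospan.id (ind n)).comp w.cospan) (c' := w.cospan)
      (.comp (.id n) w.isView) w.isView (φ w)
      (by rw [Category.assoc, hr, Category.comp_id])
        ((congrArg (· ≫ _) (Category.id_comp _)).trans (hl w)))
    (by
      intro w w' g
      refine (congrArg (· ≫ _) (View.prefixPairs_path _ g)).trans ?_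
      refine (comp_isoExt _ _ _ _ _ _).trans (Eq.trans ?_ (isoExt_comp _ _ _ _ _ _).symm)
      -- As for `prefixIso`, only the middle components have to be compared, piece by piece.
      refine Extension.hom_eq rfl HEq.rfl HEq.rfl (heq_of_eq ?_)
      refine pushout.hom_ext (pushout.hom_ext ?_ ?_) ?_
      · rw [pushout.inl_desc_assoc, pushout.inl_desc_assoc, pushout.inl_desc_assoc, hl,
          Category.assoc]
        exact ((Category.assoc _ _ _).symm.trans ((congrArg (· ≫ _) (hl w)).trans g.t_onBase)).symm
      · rw [pushout.inl_desc_assoc, pushout.inr_desc_assoc, pushout.inl_desc_assoc, Category.assoc,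
          hr, Category.assoc, Category.comp_id]
        exact ((Category.assoc _ _ _).symm.trans
          ((congrArg (· ≫ _) (hr w)).trans (Category.id_comp _))).symm
      · rw [pushout.inr_desc_assoc, pushout.inr_desc_assoc]
        exact ((Category.assoc _ _ _).trans (congrArg (g.onExt ≫ ·) (hr w'))).trans
          ((Category.comp_id _).trans (congrArg (· ≫ g.cell.mid) (Category.id_comp _)).symm))

/-! ### Isomorphisms of behaviours -/

theorem FinNat.hom_inv {A B : FinNat} (e : A ≅ B) (k : {k // k ∈ A.carrier}) :
    e.inv (e.hom k) = k := congrFun e.hom_inv_id k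

theorem FinNat.inv_hom {A B : FinNat} (e : A ≅ B) (k : {k // k ∈ B.carrier}) :
    e.hom (e.inv k) = k := congrFun e.inv_hom_id k

/-- The states of isomorphic behaviours correspond. -/
abbrev IndBeh.mapStates {n : ℕ} {B B' : IndBeh n} (e : B ≅ B') (k : B.states) : B'.states :=
  e.hom.app _ k

theorem IndBeh.initial_app {n : ℕ} {B B' : IndBeh n} (e : B ≅ B') (x : (ViewCat n)ᵒᵖ)
    (k : {k // k ∈ (B.obj x).carrier}) :
    B'.initial x (e.hom.app x k) = mapStates e (B.initial x k) :=
  (congrFun (e.hom.naturality (bang x.unop).op) k).symm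

theorem IndBeh.Above.map {n : ℕ} {B B' : IndBeh n} (e : B ≅ B') {k : B.states}
    {x : (ViewCat n)ᵒᵖ} {j : ℕ} (hj : j ∈ (B.obj x).carrier) (h : B.Above k x j) :
    B'.Above (mapStates e k) x (e.hom.app x ⟨j, hj⟩).1 := by
  obtain ⟨_, h⟩ := h
  exact ⟨(e.hom.app x ⟨j, hj⟩).2, (IndBeh.initial_app e x ⟨j, hj⟩).trans (congrArg _ h)⟩

theorem IndBeh.mem_restr {n : ℕ} {B : IndBeh n} {k : B.states} {x : (ViewCat n)ᵒᵖ} {j : ℕ} :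
    j ∈ ((B.restr k).obj x).carrier ↔ j ∈ (B.obj x).carrier ∧ B.Above k x j := by
  classical
  exact Finset.mem_filter

/-- The map of restrictions induced by an isomorphism of behaviours. -/
def IndBeh.restrMap {n : ℕ} {B B' : IndBeh n} (e : B ≅ B') (k : B.states) (k' : B'.states)
    (hk : mapStates e k = k') : B.restr k ⟶ B'.restr k' where
  app x := fun j => ⟨(e.hom.app x ⟨j.1, (IndBeh.mem_restr.1 j.2).1⟩).1, by
    subst hk
    exact IndBeh.mem_restr.2 ⟨(e.hom.app x ⟨j.1, (IndBeh.mem_restr.1 j.2).1⟩).2,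
      IndBeh.Above.map e _ (IndBeh.mem_restr.1 j.2).2⟩⟩
  naturality x y f := by
    funext j
    have h := congrArg Subtype.val
      (congrFun (e.hom.naturality f) ⟨j.1, (IndBeh.mem_restr.1 j.2).1⟩)
    exact Subtype.ext h

/-- Restrictions of isomorphic behaviours at corresponding states. -/
def IndBeh.restrIso {n : ℕ} {B B' : IndBeh n} (e : B ≅ B') (k : B.states) :
    B.restr k ≅ B'.restr (mapStates e k) where
  hom := IndBeh.restrMap e k _ rfl
  -- Going back and forth returns to `k` only propositionally; this is why `restrMap` takes an
  -- equation between states.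
  inv := IndBeh.restrMap e.symm _ k (FinNat.hom_inv (e.app _) k)
  hom_inv_id := by
    ext x
    funext j
    have h := congrArg Subtype.val
      (FinNat.hom_inv (e.app x) ⟨j.1, (IndBeh.mem_restr.1 j.2).1⟩)
    exact Subtype.ext h
  inv_hom_id := by
    ext x
    funext j
    have h := congrArg Subtype.val
      (FinNat.inv_hom (e.app x) ⟨j.1, (IndBeh.mem_restr.1 j.2).1⟩)
    exact Subtype.ext h

/-- A definite behaviour is its own restriction. -/
def IndBeh.IsDefinite.restrIso {n : ℕ} {B : IndBeh n} (h : B.IsDefinite) (k : B.states) :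
    B.restr k ≅ B where
  hom :=
    { app := fun x j => ⟨j.1, (IndBeh.mem_restr.1 j.2).1⟩
      naturality := fun _ _ _ => rfl }
  inv :=
    { app := fun x j => ⟨j.1, by
        obtain ⟨u⟩ := h
        exact IndBeh.mem_restr.2 ⟨j.2, j.2, Subsingleton.elim _ _⟩⟩
      naturality := fun _ _ _ => rfl }
  hom_inv_id := rfl
  inv_hom_id := rfl

/-- Residuals of isomorphic behaviours. -/
def IndBeh.residualIso {n : ℕ} {B B' : IndBeh n} (e : B ≅ B') (v : View n) :
    B.residual v ≅ B'.residual v := Functor.isoWhiskerLeft _ e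

/-- Residuals along isomorphic views. -/
def IndBeh.residualIsoOfIso {n p : ℕ} (B : IndBeh n) {c c' : Cospan (ind p) (ind n)}
    (hc : IsView c) (hc' : IsView c')
    (f : c.mid ≅ c'.mid) (hs : c.s ≫ f.hom = c'.s) (ht : c.t ≫ f.hom = c'.t) :
    B.residual ⟨p, c, hc⟩ ≅ B.residual ⟨p, c', hc'⟩ :=
  Functor.isoWhiskerRight (NatIso.op (prefixIso hc hc' f hs ht).symm) B

/-- The residual along the identity. -/
def IndBeh.residualId {n : ℕ} (B : IndBeh n) : B.residual (View.id n) ≅ B :=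
  Functor.isoWhiskerRight (NatIso.op (prefixId n).symm) B ≪≫ Functor.leftUnitor B

/-- `(B · v)|_k` for some state `k`. -/
def IndBeh.Next {n : ℕ} (B : IndBeh n) (v : View n) (B' : IndBeh v.arity) : Prop :=
  ∃ k : (B.residual v).states, Nonempty (B' ≅ (B.residual v).restr k)

/-- The view of an agent in an action is unique only up to isomorphism; this makes the choice
irrelevant. `Next.congr` does the same for the behaviours. -/
theorem IndBeh.Next.of_iso {n p : ℕ} {B : IndBeh n} {c c' : Cospan (ind p) (ind n)}
    {hc : IsView c} {B' : IndBeh p} (h : B.Next ⟨p, c, hc⟩ B') (hi : c.Iso c') (hc' : IsView c') :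
    B.Next ⟨p, c', hc'⟩ B' := by
  obtain ⟨k, ⟨e⟩⟩ := h
  obtain ⟨f, hs, ht⟩ := hi
  exact ⟨_, ⟨e ≪≫ IndBeh.restrIso (B.residualIsoOfIso hc hc' f hs ht) k⟩⟩

theorem IndBeh.Next.congr {n : ℕ} {B B₁ : IndBeh n} {v : View n} {B' B₁' : IndBeh v.arity}
    (h : B.Next v B') (e : B ≅ B₁) (e' : B' ≅ B₁') : B₁.Next v B₁' := by
  obtain ⟨k, ⟨i⟩⟩ := h
  exact ⟨_, ⟨e'.symm ≪≫ i ≪≫ IndBeh.restrIso (residualIso e v) k⟩⟩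

/-- Definiteness enters here: restricting to the only initial state changes nothing, so an agent
that does not act keeps its behaviour. -/
theorem IndBeh.next_id {n : ℕ} {B B' : IndBeh n} (h : B.IsDefinite) :
    B.Next (View.id n) B' ↔ Nonempty (B' ≅ B) := by
  constructor
  · rintro ⟨k, ⟨e⟩⟩
    exact ⟨e ≪≫ IndBeh.restrIso B.residualId k ≪≫ h.restrIso _⟩
  · rintro ⟨e⟩
    obtain ⟨u⟩ := h
    let k : (B.residual (View.id n)).states := IndBeh.mapStates B.residualId.symm u.default
    exact ⟨k, ⟨e ≪≫ ((IndBeh.restrIso B.residualId k) ≪≫ IndBeh.IsDefinite.restrIso ⟨u⟩ _).symm⟩⟩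

/-! ### Behaviours on positions from families -/

/-- The behaviour on a position with given components. -/
def Beh.ofFamily {X : Position} (B : ∀ a : X.Agent, IndBeh a.arity) : Beh X where
  obj x := (B x.unop.1).obj (op x.unop.2)
  -- Views of a position form a coproduct of categories, so a morphism stays in the summand of one
  -- agent.
  map {x y} f := match x, y, f with
    | op ⟨_, _⟩, op ⟨_, _⟩, ⟨.mk g⟩ => (B _).map g.op
  map_id := by
    rintro ⟨⟨a, x⟩⟩
    exact (B a).map_id _
  map_comp := by
    rintro ⟨⟨a, x⟩⟩ ⟨⟨b, y⟩⟩ ⟨⟨c, z⟩⟩ ⟨⟨g⟩⟩ ⟨⟨h⟩⟩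
    exact (B _).map_comp _ _

/-- Behaviours on a position are isomorphic when their components are. -/
def Beh.isoOfAt {X : Position} {B B' : Beh X} (e : ∀ a, B.at a ≅ B'.at a) : B ≅ B' :=
  NatIso.ofComponents (fun x => (e x.unop.1).app (op x.unop.2)) (by
    rintro ⟨⟨a, x⟩⟩ ⟨⟨b, y⟩⟩ ⟨⟨g⟩⟩
    exact (e _).hom.naturality g.op)

/-- The components of an isomorphism of behaviours. -/
def Beh.atIso {X : Position} {B B' : Beh X} (e : B ≅ B') (a : X.Agent) : B.at a ≅ B'.at a :=
  Functor.isoWhiskerLeft _ e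

/-! ### Interfaces -/

theorem interface_el {c : Vertex} (z : el (interface P) c) :
    ∃ (x : el P .star) (g : c.ob ⟶ Vertex.star.ob),
      z = (Sigma.ι (fun _ : el P .star => rep .star) x).app (op c.ob) g := by
  have hc := isColimitOfPreserves ((evaluation Baseᵒᵖ Type).obj (op c.ob))
    (colimit.isColimit (Discrete.functor fun _ : el P .star => rep Vertex.star))
  obtain ⟨⟨x⟩, g, hg⟩ := Types.jointly_surjective _ hc z
  exact ⟨x, g, hg.symm⟩

theorem isEmpty_interface {c : Vertex} (hc : 0 < c.dim) : IsEmpty (el (interface P) c) := by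
  refine ⟨fun z => ?_⟩
  obtain ⟨-, g, -⟩ := interface_el z
  obtain ⟨rfl, -⟩ := hom_star g
  exact lt_irrefl _ hc

theorem interface_ext {f g : interface P ⟶ Q}
    (h : ∀ x : el P .star, Sigma.ι (fun _ : el P .star => rep .star) x ≫ f =
      Sigma.ι (fun _ : el P .star => rep .star) x ≫ g) : f = g := Sigma.hom_ext _ _ h

/-- The element of the interface on a channel. -/
abbrev interfaceEl (x : el P .star) : el (interface P) .star :=
  (Sigma.ι (fun _ : el P .star => rep .star) x).app (op Vertex.star.ob) (gen .star)

theorem interfaceEl_surjective : Function.Surjective (interfaceEl (P := P)) := by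
  intro z
  obtain ⟨x, g, rfl⟩ := interface_el z
  obtain ⟨-, rfl⟩ := hom_star g
  exact ⟨x, rfl⟩

theorem desc_interfaceEl (f : el P .star → el Q .star) (x : el P .star) :
    (Sigma.desc fun x => nameOf (P := Q) (f x) : interface P ⟶ Q).app _ (interfaceEl x) = f x := by
  rw [interfaceEl, ← NatTrans.comp_app_apply, colimit.ι_desc]
  exact nameOf_gen _

theorem interfaceMap_el (x : el P .star) : (interfaceMap P).app _ (interfaceEl x) = x :=
  desc_interfaceEl (fun x => x) x

theorem interfaceMap_bijective (P : Diagram) :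
    Function.Bijective ((interfaceMap P).app (op Vertex.star.ob)) := by
  refine ⟨fun z z' h => ?_, fun x => ⟨_, interfaceMap_el x⟩⟩
  obtain ⟨x, rfl⟩ := interfaceEl_surjective z
  obtain ⟨x', rfl⟩ := interfaceEl_surjective z'
  rw [interfaceMap_el, interfaceMap_el] at h
  rw [h]

theorem hom_ext_interface {f g : interface P ⟶ Q}
    (h : ∀ x : el P .star, f.app _ (interfaceEl x) = g.app _ (interfaceEl x)) : f = g := by
  refine interface_ext fun x => rep_hom_ext ?_
  rw [NatTrans.comp_app_apply, NatTrans.comp_app_apply]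
  exact h x

/-! ### Elements of pushouts -/

section Pushout

variable {A B C D : Diagram} {f : A ⟶ B} {g : A ⟶ C} {h : B ⟶ D} {k : C ⟶ D}

/-- Over `c` the leg out of the empty set is injective, so the pushout of types is also a pullback,
and a common image would come from an element of `A`. -/
theorem pushout_ne (sq : IsPushout f g h k) {c : Vertex} (he : IsEmpty (el A c)) (x : el B c)
    (y : el C c) : h.app _ x ≠ k.app _ y := fun e => by
  have := Types.isPullback_of_isPushout (isPushout_at sq c) (fun a => he.elim a)
  obtain ⟨a, -⟩ := Types.exists_of_isPullback this x y e
  exact he.elim a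

theorem pushout_inr_injective (sq : IsPushout f g h k) {c : Vertex}
    (hf : Function.Injective (f.app (op c.ob))) : Function.Injective (k.app (op c.ob)) := by
  have : Mono (f.app (op c.ob)) := (mono_iff_injective _).2 hf
  exact (mono_iff_injective _).1 (Adhesive.mono_of_isPushout_of_mono_left (isPushout_at sq c))

theorem pushout_inr_bijective (sq : IsPushout f g h k) {c : Vertex}
    (hf : Function.Bijective (f.app (op c.ob))) : Function.Bijective (k.app (op c.ob)) := by
  refine ⟨pushout_inr_injective sq hf.1, fun x => ?_⟩
  rcases el_eq_or_eq sq x with ⟨y, rfl⟩ | h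
  · obtain ⟨a, rfl⟩ := hf.2 y
    exact ⟨_, (ConcreteCategory.congr_hom (isPushout_at sq c).w a).symm⟩
  · exact h

end Pushout

/-! ### The data of an action -/

/-- The pushouts that exhibit a cospan as an action. -/
structure ActionData (σ : Seed) {Y X : Diagram} (u : Cospan Y X) where
  Z : Diagram
  isPosition : IsPosition Z
  h : interface σ.init ⟶ Z
  j : interface σ.init ⟶ σ.final
  x : σ.init ⟶ X
  zx : Z ⟶ X
  μ : σ.cospan.mid ⟶ u.mid
  zu : Z ⟶ u.mid
  y : σ.final ⟶ Y
  zy : Z ⟶ Y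
  hj : j ≫ σ.cospan.s = interfaceMap σ.init ≫ σ.cospan.t
  sqX : IsPushout (interfaceMap σ.init) h x zx
  sqU : IsPushout (interfaceMap σ.init ≫ σ.cospan.t) h μ zu
  sqY : IsPushout j h y zy
  x_t : x ≫ u.t = σ.cospan.t ≫ μ
  zx_t : zx ≫ u.t = zu
  y_s : y ≫ u.s = σ.cospan.s ≫ μ
  zy_s : zy ≫ u.s = zu

theorem IsActionOf.data {σ : Seed} {Y X : Diagram} {u : Cospan Y X} (h : IsActionOf σ u) :
    Nonempty (ActionData σ u) := by
  obtain ⟨Z, hZ, h, j, x, zx, μ, zu, y, zy, h₁, h₂, h₃, h₄, h₅, h₆, h₇, h₈⟩ := h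
  exact ⟨⟨Z, hZ, h, j, x, zx, μ, zu, y, zy, h₁, h₂, h₃, h₄, h₅, h₆, h₇, h₈⟩⟩

namespace ActionData

variable {σ : Seed} {Y X : Diagram} {u : Cospan Y X} (d : ActionData σ u)

theorem isActionOf (d : ActionData σ u) : IsActionOf σ u :=
  ⟨d.Z, d.isPosition, d.h, d.j, d.x, d.zx, d.μ, d.zu, d.y, d.zy, d.hj, d.sqX, d.sqU, d.sqY, d.x_t,
    d.zx_t, d.y_s, d.zy_s⟩

/-- Cancelling `sqX` from `sqU` shows that `u.t` is a pushout of the initial leg of the seed; `sqS`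
is the analogue for the final leg. Facts about channels of seeds thereby pass to actions. -/
theorem sqT : IsPushout σ.cospan.t d.x d.μ u.t :=
  IsPushout.of_left (h₁₁ := interfaceMap σ.init) (v₁₁ := d.h) (h₂₁ := d.zx)
    (by rw [d.zx_t]; exact d.sqU) d.x_t.symm d.sqX

theorem sqS : IsPushout σ.cospan.s d.y d.μ u.s :=
  IsPushout.of_left (h₁₁ := d.j) (v₁₁ := d.h) (h₂₁ := d.zy)
    (by rw [d.zy_s, d.hj]; exact d.sqU) d.y_s.symm d.sqY

theorem t_x {c : Vertex} (a : el σ.init c) :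
    u.t.app _ (d.x.app _ a) = d.μ.app _ (σ.cospan.t.app (op c.ob) a) := by
  rw [← NatTrans.comp_app_apply, d.x_t, NatTrans.comp_app_apply]

theorem s_y {c : Vertex} (a : el σ.final c) :
    u.s.app _ (d.y.app _ a) = d.μ.app _ (σ.cospan.s.app (op c.ob) a) := by
  rw [← NatTrans.comp_app_apply, d.y_s, NatTrans.comp_app_apply]

theorem t_zx {c : Vertex} (a : el d.Z c) : u.t.app _ (d.zx.app (op c.ob) a) = d.zu.app _ a := by
  rw [← NatTrans.comp_app_apply, d.zx_t]

theorem s_zy {c : Vertex} (a : el d.Z c) : u.s.app _ (d.zy.app (op c.ob) a) = d.zu.app _ a := by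
  rw [← NatTrans.comp_app_apply, d.zy_s]

theorem zu_injective {c : Vertex} (hc : 0 < c.dim) : Function.Injective (d.zu.app (op c.ob)) :=
  pushout_inr_injective d.sqU fun a => (isEmpty_interface hc).elim a

/-- The context `Z` has dimension at most one, so it contributes no basic action. -/
theorem exists_act {p n : ℕ} {b : Basic p n} (e : el u.mid (.act b)) :
    ∃ e₀ : el σ.cospan.mid (.act b), d.μ.app _ e₀ = e := by
  rcases el_eq_or_eq d.sqU e with h | ⟨z, -⟩
  · exact h
  · exact absurd (d.isPosition.dim_le _ ⟨z⟩) (by simp [Vertex.dim])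

end ActionData

/-! ### Colouring the agents of an action -/

/-- Colours of agents in an action: passive, initial or final. -/
inductive Colour : Type
  | idle : Colour
  | init (k : ℕ) : Colour
  | final (k : ℕ) : Colour

/-- The colour of the final agent of a basic action. -/
def Basic.code {p n : ℕ} : Basic p n → ℕ
  | .forkL _ => 0
  | .forkR _ => 1
  | .inp _ _ => 2
  | .out _ _ _ => 3
  | .tick _ => 4
  | .tau _ => 4
  | .nu _ => 4

/-- The colour of the initial agent of a basic action. -/
def Basic.tcode {p n : ℕ} : Basic p n → ℕ
  | .forkL _ => 0
  | .forkR _ => 0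
  | .inp _ _ => 2
  | .out _ _ _ => 3
  | .tick _ => 4
  | .tau _ => 4
  | .nu _ => 4

abbrev colourEl : Vertex → Type
  | .star => Unit
  | .ag _ => Colour
  | .act _ => Unit
  | .fork _ => Unit
  | .sync _ _ _ _ _ => Unit

/-- The fork equation is the only one that equates agents: it identifies the two targets, hence
`tcode` agrees on the two forks, while `code` may separate their sources. The other equations
concern channels, which all share one colour. -/
def colourAct : {a b : Vertex} → Edge a b → colourEl b → colourEl a
  | _, _, .port _ _ => fun _ => ()
  | _, _, .src b => fun _ => Colour.final b.code
  | _, _, .tgt b => fun _ => Colour.init b.tcode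
  | _, _, .left _ => fun _ => ()
  | _, _, .right _ => fun _ => ()
  | _, _, .rho _ _ _ _ _ => fun _ => ()
  | _, _, .eps _ _ _ _ _ => fun _ => ()

/-- The diagram of colours. -/
def colours : Pre where
  el := colourEl
  act := colourAct
  st _ _ _ := rfl
  fork _ _ := rfl
  subj _ _ _ _ _ _ := rfl
  obj _ _ _ _ _ _ := rfl

theorem colour_src (κ : P ⟶ colours.diagram) {p n : ℕ} (b : Basic p n) (e : el P (.act b)) :
    κ.app (op (Vertex.ag p).ob) ((Edge.src b).act P e) = (Colour.final b.code : colourEl (.ag p)) :=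
  Edge.act_app κ (.src b) e

theorem colour_tgt (κ : P ⟶ colours.diagram) {p n : ℕ} (b : Basic p n) (e : el P (.act b)) :
    κ.app (op (Vertex.ag n).ob) ((Edge.tgt b).act P e) = (Colour.init b.tcode : colourEl (.ag n)) :=
  Edge.act_app κ (.tgt b) e

/-- The seed is coloured by Yoneda and the context is coloured idle. Both agree on the interface
because it consists of channels, so they glue over the pushout. -/
theorem ActionData.exists_colouring {σ : Seed} {Y X : Diagram} {u : Cospan Y X}
    (d : ActionData σ u) : ∃ κ : u.mid ⟶ colours.diagram,
      ∀ (n : ℕ) (z : el d.Z (.ag n)), κ.app (op (Vertex.ag n).ob) (d.zu.app _ z) =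
        (Colour.idle : colourEl (.ag n)) := by
  have hm : Nonempty (σ.cospan.mid ⟶ colours.diagram) := by
    cases σ with
    | act b => exact ⟨nameOf (P := colours.diagram) (c := .act b) (() : colourEl (.act b))⟩
    | fork n => exact ⟨nameOf (P := colours.diagram) (c := .fork n) (() : colourEl (.fork n))⟩
    | sync n a m c e =>
      exact ⟨nameOf (P := colours.diagram) (c := .sync n a m c e)
        (() : colourEl (.sync n a m c e))⟩
  obtain ⟨m⟩ := hm
  let z : d.Z ⟶ colours.diagram := Diagram.homMk
    (fun c => match c with
      | .star => fun _ => (() : colourEl .star)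
      | .ag n => fun _ => (Colour.idle : colourEl (.ag n))
      | .act b => fun _ => (() : colourEl (.act b))
      | .fork n => fun _ => (() : colourEl (.fork n))
      | .sync n a m c e => fun _ => (() : colourEl (.sync n a m c e)))
    (by
      rintro a b (_ | _ | _ | _ | _ | _ | _) x
      · rfl
      · exact absurd (d.isPosition.dim_le _ ⟨x⟩) (by simp [Vertex.dim])
      · exact absurd (d.isPosition.dim_le _ ⟨x⟩) (by simp [Vertex.dim])
      all_goals rfl)
  have hw : (interfaceMap σ.init ≫ σ.cospan.t) ≫ m = d.h ≫ z :=
    hom_ext_interface fun _ => rfl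
  refine ⟨d.sqU.desc m z hw, fun n a => ?_⟩
  rw [← NatTrans.comp_app_apply, d.sqU.inr_desc]
  rfl

/-- An agent in the middle of a chain would have both an initial and a final colour. -/
theorem ActionData.no_chain {σ : Seed} {Y X : Diagram} {u : Cospan Y X} (d : ActionData σ u)
    {k q r : ℕ} (b : Basic k q) (b' : Basic q r) (x : el u.mid (.act b)) (x' : el u.mid (.act b')) :
    (Edge.tgt b).act u.mid x ≠ (Edge.src b').act u.mid x' := by
  obtain ⟨κ, -⟩ := d.exists_colouring
  intro h
  have := congrArg (fun z => κ.app (op (Vertex.ag q).ob) z) h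
  rw [colour_src, colour_tgt] at this
  exact Colour.noConfusion this

/-! ### Cells from short views into actions -/

theorem oneInj_ind {n : ℕ} (f : ind n ⟶ P) : OneInj f := by
  intro c hc x y _
  rcases hom_ag x with ⟨rfl, hx⟩ | ⟨rfl, -⟩
  · exact Subsingleton.elim (α := el (ind n) (.ag n)) x y
  · exact absurd hc (lt_irrefl 0)

/-- A morphism into `b` from an agent starts with a source or target arrow, and by `actHom` the rest
is an identity. -/
theorem el_rep_act {p n : ℕ} (b : Basic p n) {c : Vertex} (hc : 0 < c.dim)
    (x : el (rep (.act b)) c) :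
    (∃ h : c = .act b, x = h ▸ gen c) ∨
      (∃ h : c = .ag p, x = h ▸ (Edge.src b).hom) ∨ ∃ h : c = .ag n, x = h ▸ (Edge.tgt b).hom := by
  cases c with
  | star => exact absurd hc (lt_irrefl 0)
  | ag k =>
    rcases agHom x with ⟨h, -⟩ | ⟨n', b', g, rfl⟩ | ⟨n', b', g, rfl⟩
    · exact nomatch h
    · have hg := actHom b' g
      cases hg
      exact .inr (.inl ⟨rfl, Category.comp_id _⟩)
    · have hg := actHom b' g
      cases hg
      exact .inr (.inr ⟨rfl, Category.comp_id _⟩)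
  | act b' =>
    have hg := actHom b' x
    cases hg
    exact .inl ⟨rfl, rfl⟩
  | fork m => exact absurd (dim_hom x) (by simp [Vertex.dim])
  | sync => exact absurd (dim_hom x) (by simp [Vertex.dim])

theorem nameOf_app_src {p n : ℕ} (b : Basic p n) (e : el P (.act b)) :
    (nameOf (P := P) e).app (op (Vertex.ag p).ob) (Edge.src b).hom = (Edge.src b).act P e := by
  rw [← Edge.act_gen, Edge.act_app, nameOf_gen]

theorem nameOf_app_tgt {p n : ℕ} (b : Basic p n) (e : el P (.act b)) :
    (nameOf (P := P) e).app (op (Vertex.ag n).ob) (Edge.tgt b).hom = (Edge.tgt b).act P e := by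
  rw [← Edge.act_gen, Edge.act_app, nameOf_gen]

/-- The only possible collision is between the source and the target of `b` when the arities agree,
and their colours differ. -/
theorem ActionData.oneInj_act {σ : Seed} {Y X : Diagram} {u : Cospan Y X} (d : ActionData σ u)
    {p n : ℕ} {b : Basic p n} (e : el u.mid (.act b)) : OneInj (nameOf (P := u.mid) e) := by
  obtain ⟨κ, -⟩ := d.exists_colouring
  intro c hc x y hxy
  rcases el_rep_act b hc x with ⟨rfl, rfl⟩ | ⟨rfl, rfl⟩ | ⟨rfl, rfl⟩
  · rcases el_rep_act b hc y with ⟨-, rfl⟩ | ⟨h, -⟩ | ⟨h, -⟩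
    · rfl
    · exact nomatch h
    · exact nomatch h
  · rcases el_rep_act b hc y with ⟨h, -⟩ | ⟨-, rfl⟩ | ⟨h, rfl⟩
    · exact nomatch h
    · rfl
    · cases h
      have h := congrArg (fun z => κ.app (op (Vertex.ag p).ob) z) hxy
      refine Colour.noConfusion ((colour_tgt κ b e).symm.trans
        ((congrArg _ (nameOf_app_tgt b e).symm).trans (h.symm.trans
        ((congrArg _ (nameOf_app_src b e)).trans (colour_src κ b e)))))
  · rcases el_rep_act b hc y with ⟨h, -⟩ | ⟨h, rfl⟩ | ⟨-, rfl⟩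
    · exact nomatch h
    · cases h
      have h := congrArg (fun z => κ.app (op (Vertex.ag p).ob) z) hxy
      refine Colour.noConfusion ((colour_tgt κ b e).symm.trans
        ((congrArg _ (nameOf_app_tgt b e).symm).trans (h.trans
        ((congrArg _ (nameOf_app_src b e)).trans (colour_src κ b e)))))
    · rfl

/-- An agent of a position from an element of its diagram. -/
abbrev Position.agent (X : Position) {n : ℕ} (k : el X.diagram (.ag n)) : X.Agent :=
  let k : X.elems (.ag n) := k
  ⟨(n, k.1), k.2⟩

/-! ### Residues of agents without cells -/

/-- The component of a behaviour at an agent. -/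
abbrev Beh.el {X : Position} (B : Beh X) {n : ℕ} (k : el X.diagram (.ag n)) : IndBeh n :=
  B.at (X.agent k)

/-- The relation of a final agent to the agents of the initial position in an action: it is
passive, or the final agent of a basic action. -/
def AgentResidue {X Y : Position} (D : Beh X) (M : Cospan Y.diagram X.diagram) {p : ℕ}
    (B' : IndBeh p) (y : PiTraces.el Y.diagram (.ag p)) : Prop :=
  (∃ x : PiTraces.el X.diagram (.ag p), M.s.app _ y = M.t.app _ x ∧ Nonempty (B' ≅ D.el x)) ∨
    ∃ (n : ℕ) (b : Basic p n) (x : PiTraces.el X.diagram (.ag n)) (e : PiTraces.el M.mid (.act b)),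
      (Edge.src b).act M.mid e = M.s.app _ y ∧ (Edge.tgt b).act M.mid e = M.t.app _ x ∧
        (D.el x).Next b.view B'

/-- The three cases of `IsView.short`: an empty view forces `y` and `x` to have the same image in
`M`, a basic one names a basic action of `M` from `x` to `y`, and a chain would be sent to a chain
in `M`, contrary to `no_chain`. -/
theorem agentResidue_of_cell {σ : Seed} {X Y : Position} {M : Cospan Y.diagram X.diagram}
    (d : ActionData σ M) (D : Beh X) (hD : D.IsDefinite) {p n : ℕ} {B' : IndBeh p}
    {y : el Y.diagram (.ag p)} {x : el X.diagram (.ag n)} {c : Cospan (ind p) (ind n)}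
    (hc : IsView c) (α : Cell c M) (htop : α.top = nameOf (P := Y.diagram) y)
    (hbot : α.bot = nameOf (P := X.diagram) x)
    (h : (D.el x).Next ⟨p, c, hc⟩ B') : AgentResidue D M B' y := by
  have hs := α.w_s
  have ht := α.w_t
  rw [htop] at hs
  rw [hbot] at ht
  cases hc.short with
  | id hi =>
    refine .inl ⟨x, ?_, ?_⟩
    · obtain ⟨f, hf, hf'⟩ := hi
      have e := hf.symm.trans hf'
      rw [e, ht] at hs
      have := congrArg (fun g => g.app _ (gen (.ag p))) hs
      simp only [NatTrans.comp_app_apply] at this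
      rw [nameOf_gen, nameOf_gen] at this
      exact this.symm
    · exact (IndBeh.next_id (hD _)).1 (h.of_iso hi.symm (.id p))
  | basic b hi =>
    refine .inr ⟨n, b, x, ?_⟩
    obtain ⟨f, hf, hf'⟩ := id hi
    refine ⟨(f.hom ≫ α.mid).app _ (gen (.act b)), ?_, ?_, h.of_iso hi.symm (.basic b)⟩
    · rw [← Edge.act_app, Edge.act_gen, ← Edge.rep_gen, ← NatTrans.comp_app_apply]
      have e : (Edge.src b).rep ≫ f.hom ≫ α.mid = nameOf (P := Y.diagram) y ≫ M.s := by
        rw [← hs, ← hf, Category.assoc]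
      rw [e, NatTrans.comp_app_apply, nameOf_gen]
    · rw [← Edge.act_app, Edge.act_gen, ← Edge.rep_gen, ← NatTrans.comp_app_apply]
      have e : (Edge.tgt b).rep ≫ f.hom ≫ α.mid = nameOf (P := X.diagram) x ≫ M.t := by
        rw [← ht, ← hf', Category.assoc]
      rw [e, NatTrans.comp_app_apply, nameOf_gen]
  | chain b b' z z' e =>
    refine (d.no_chain b b' (α.mid.app _ z) (α.mid.app _ z') ?_).elim
    rw [← Edge.act_app, ← Edge.act_app, e]

/-- The cells are given by Yoneda from the named elements; only `1`-injectivity needs an argument,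
supplied by `oneInj_ind` and `oneInj_act`. -/
theorem exists_cell_of_agentResidue {σ : Seed} {X Y : Position} {M : Cospan Y.diagram X.diagram}
    (d : ActionData σ M) (D : Beh X) (hD : D.IsDefinite) {p : ℕ} {B' : IndBeh p}
    {y : el Y.diagram (.ag p)} (h : AgentResidue D M B' y) :
    ∃ (n : ℕ) (x : el X.diagram (.ag n)) (c : Cospan (ind p) (ind n)) (hc : IsView c)
      (α : Cell c M), α.top = nameOf (P := Y.diagram) y ∧ α.bot = nameOf (P := X.diagram) x ∧
      (D.el x).Next ⟨p, c, hc⟩ B' := by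
  rcases h with ⟨x, hyx, e⟩ | ⟨n, b, x, e, hs, ht, h⟩
  · refine ⟨p, x, Cospan.id _, .id p, ⟨nameOf (P := Y.diagram) y, nameOf (P := X.diagram) x ≫ M.t,
      nameOf (P := X.diagram) x, oneInj_ind _, oneInj_ind _, oneInj_ind _, ?_, ?_⟩, rfl, rfl,
      (IndBeh.next_id (hD _)).2 e⟩
    · refine rep_hom_ext ?_
      simp only [NatTrans.comp_app_apply]
      rw [nameOf_gen, hyx]
      exact congrArg _ (nameOf_gen (P := X.diagram) x)
    · exact Category.id_comp _
  · refine ⟨n, x, b.cospan, .basic b, ⟨nameOf (P := Y.diagram) y, nameOf (P := M.mid) e,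
      nameOf (P := X.diagram) x, oneInj_ind _, d.oneInj_act e, oneInj_ind _, ?_, ?_⟩, rfl, rfl, h⟩
    · refine rep_hom_ext ?_
      rw [NatTrans.comp_app_apply, NatTrans.comp_app_apply, nameOf_gen, Edge.rep_gen,
        nameOf_app_src, hs]
    · refine rep_hom_ext ?_
      rw [NatTrans.comp_app_apply, NatTrans.comp_app_apply, nameOf_gen, Edge.rep_gen,
        nameOf_app_tgt, ht]

/-- Eliminates views and cells from the edges of 𝕊: from here on an action is studied through its
agents, channels and basic actions. -/
theorem sResidue_iff {σ : Seed} {X Y : Position} {M : Cospan Y.diagram X.diagram}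
    (d : ActionData σ M) (D : Beh X) (hD : D.IsDefinite) (D' : Beh Y) :
    SResidue D D' M ↔
      ∀ (p : ℕ) (y : el Y.diagram (.ag p)), AgentResidue D M (D'.el y) y := by
  constructor
  · rintro h p y
    obtain ⟨⟨⟨n, x⟩, hx⟩, c, hc, α, s, htop, hbot, e⟩ := h (Y.agent y)
    exact agentResidue_of_cell d D hD (x := (⟨x, hx⟩ : X.elems (.ag n))) hc α htop hbot ⟨s, e⟩
  · rintro h ⟨⟨p, y⟩, hy⟩
    obtain ⟨n, x, c, hc, α, htop, hbot, s, e⟩ :=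
      exists_cell_of_agentResidue d D hD (h p (⟨y, hy⟩ : Y.elems (.ag p)))
    exact ⟨X.agent x, c, hc, α, s, htop, hbot, e⟩

/-! ### Channels of seeds -/

/-- An action is labelled by the tuples of channels of its final agents; an initial agent sees a
truncation of the tuple. A fork needs one tuple, as its branches share all channels, and a
synchronisation needs two that agree on the subject and on the object. Maps into this diagram detect
that channels are distinct. -/
abbrev chanEl (T : Type) : Vertex → Type
  | .star => T
  | .ag n => Fin n → T
  | .act (p := p) _ => Fin p → T
  | .fork n => Fin n → T
  | .sync n a m c d => {f : (Fin m → T) × (Fin (n + 1) → T) //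
      f.1 c = f.2 (Fin.castSucc a) ∧ f.1 d = f.2 (Fin.last n)}

def chanAct (T : Type) : {a b : Vertex} → Edge a b → chanEl T b → chanEl T a
  | _, _, .port _ i => fun f => f i
  | _, _, .src _ => fun f => f
  | _, _, .tgt b => fun f i => f (Fin.castLE b.le i)
  | _, _, .left _ => fun f => f
  | _, _, .right _ => fun f => f
  | _, _, .rho _ _ _ _ _ => fun f => f.1.2
  | _, _, .eps _ _ _ _ _ => fun f => f.1.1

/-- The cofree diagram on a set of channels. -/
def chanPre (T : Type) : Pre where
  el := chanEl T
  act := chanAct T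
  st _ _ _ := rfl
  fork _ _ := rfl
  subj _ _ _ _ _ f := f.2.1.symm
  obj _ _ _ _ _ f := f.2.2.symm

/-! ### Elements of seeds -/

theorem Edge.rep_app_gen {a b c : Vertex} (e : Edge a b) (e' : Edge b c) :
    (e.rep ≫ e'.rep).app (op a.ob) (gen a) =
      e.act (PiTraces.rep c) (e'.act (PiTraces.rep c) (gen c)) := by
  rw [NatTrans.comp_app_apply, Edge.rep_gen, ← Edge.act_gen, Edge.act_app, Edge.rep_gen,
    Edge.act_gen e']

theorem app_gen_congr {V : Vertex} {f g : rep V ⟶ P} (h : f = g) :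
    f.app _ (gen V) = g.app _ (gen V) := by rw [h]

/-- The first agent of `[n] | [n]`. -/
abbrev twinL (n : ℕ) : ind n ⟶ twin n := pushout.inl (ports n) (ports n)

/-- The second agent of `[n] | [n]`. -/
abbrev twinR (n : ℕ) : ind n ⟶ twin n := pushout.inr (ports n) (ports n)

abbrev linkL (m : ℕ) (c : Fin m) (n : ℕ) (a : Fin n) : ind m ⟶ link m c n a := pushout.inl _ _

abbrev linkR (m : ℕ) (c : Fin m) (n : ℕ) (a : Fin n) : ind n ⟶ link m c n a := pushout.inr _ _

abbrev link₂L (m : ℕ) (c d : Fin m) (n : ℕ) (a e : Fin n) : ind m ⟶ link₂ m c d n a e :=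
  pushout.inl _ _

abbrev link₂R (m : ℕ) (c d : Fin m) (n : ℕ) (a e : Fin n) : ind n ⟶ link₂ m c d n a e :=
  pushout.inr _ _

/-- This and the following computations express the agents at the ends of a seed as sources and
targets of its basic actions; everything about agents and channels of actions is read off from them.
-/
theorem forkCospan_s_inl (n : ℕ) :
    (forkCospan n).s.app _ ((twinL n).app _ (gen (.ag n))) =
      (Edge.src (.forkL n)).act (rep (.fork n)) ((Edge.left n).act (rep (.fork n)) (gen _)) := by
  rw [← NatTrans.comp_app_apply, ← Edge.rep_app_gen]
  exact app_gen_congr (pushout.inl_desc _ _ _)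

theorem forkCospan_s_inr (n : ℕ) :
    (forkCospan n).s.app _ ((twinR n).app _ (gen (.ag n))) =
      (Edge.src (.forkR n)).act (rep (.fork n)) ((Edge.right n).act (rep (.fork n)) (gen _)) := by
  rw [← NatTrans.comp_app_apply, ← Edge.rep_app_gen]
  exact app_gen_congr (pushout.inr_desc _ _ _)

theorem forkCospan_t_left (n : ℕ) :
    (forkCospan n).t.app _ (gen (.ag n)) =
      (Edge.tgt (.forkL n)).act (rep (.fork n)) ((Edge.left n).act (rep (.fork n)) (gen _)) :=
  Edge.rep_app_gen _ _

/-- The initial leg is defined through the left branch; the fork equation lets it be read through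
the right one. -/
theorem forkCospan_t_right (n : ℕ) :
    (forkCospan n).t.app _ (gen (.ag n)) =
      (Edge.tgt (.forkR n)).act (rep (.fork n)) ((Edge.right n).act (rep (.fork n)) (gen _)) := by
  rw [← Edge.rep_app_gen]
  exact app_gen_congr (Edge.rep_fork n)

section Sync

variable (n : ℕ) (a : Fin n) (m : ℕ) (c d : Fin m)

theorem syncCospan_s_inl :
    (syncCospan n a m c d).s.app _
        ((link₂L m c d (n + 1) (Fin.castSucc a) (Fin.last n)).app _ (gen (.ag m))) =
      (Edge.src (.out m c d)).act (rep (.sync n a m c d))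
        ((Edge.eps n a m c d).act (rep (.sync n a m c d)) (gen _)) := by
  rw [← NatTrans.comp_app_apply, ← Edge.rep_app_gen]
  exact app_gen_congr (pushout.inl_desc _ _ _)

theorem syncCospan_s_inr :
    (syncCospan n a m c d).s.app _
        ((link₂R m c d (n + 1) (Fin.castSucc a) (Fin.last n)).app _ (gen (.ag (n + 1)))) =
      (Edge.src (.inp n a)).act (rep (.sync n a m c d))
        ((Edge.rho n a m c d).act (rep (.sync n a m c d)) (gen _)) := by
  rw [← NatTrans.comp_app_apply, ← Edge.rep_app_gen]
  exact app_gen_congr (pushout.inr_desc _ _ _)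

theorem syncCospan_t_inl :
    (syncCospan n a m c d).t.app _ ((linkL m c n a).app _ (gen (.ag m))) =
      (Edge.tgt (.out m c d)).act (rep (.sync n a m c d))
        ((Edge.eps n a m c d).act (rep (.sync n a m c d)) (gen _)) := by
  rw [← NatTrans.comp_app_apply, ← Edge.rep_app_gen]
  exact app_gen_congr (pushout.inl_desc _ _ _)

theorem syncCospan_t_inr :
    (syncCospan n a m c d).t.app _ ((linkR m c n a).app _ (gen (.ag n))) =
      (Edge.tgt (.inp n a)).act (rep (.sync n a m c d))
        ((Edge.rho n a m c d).act (rep (.sync n a m c d)) (gen _)) := by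
  rw [← NatTrans.comp_app_apply, ← Edge.rep_app_gen]
  exact app_gen_congr (pushout.inr_desc _ _ _)

end Sync

theorem el_act_fork {n p q : ℕ} {b : Basic p q} (e : el (rep (.fork n)) (.act b)) :
    (∃ h : Vertex.act (.forkL n) = .act b, e = h ▸ (Edge.left n).act (rep (.fork n)) (gen _)) ∨
      ∃ h : Vertex.act (.forkR n) = .act b, e = h ▸ (Edge.right n).act (rep (.fork n)) (gen _) := by
  have h := actHom b e
  cases h with
  | left => exact .inl ⟨rfl, (Edge.act_gen _).symm⟩
  | right => exact .inr ⟨rfl, (Edge.act_gen _).symm⟩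

theorem el_act_sync {n : ℕ} {a : Fin n} {m : ℕ} {c d : Fin m} {p q : ℕ} {b : Basic p q}
    (e : el (rep (.sync n a m c d)) (.act b)) :
    (∃ h : Vertex.act (.out m c d) = .act b,
        e = h ▸ (Edge.eps n a m c d).act (rep (.sync n a m c d)) (gen _)) ∨
      ∃ h : Vertex.act (.inp n a) = .act b,
        e = h ▸ (Edge.rho n a m c d).act (rep (.sync n a m c d)) (gen _) := by
  have h := actHom b e
  cases h with
  | eps => exact .inl ⟨rfl, (Edge.act_gen _).symm⟩
  | rho => exact .inr ⟨rfl, (Edge.act_gen _).symm⟩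

theorem el_act_act {p' q' p q : ℕ} {b' : Basic p' q'} {b : Basic p q}
    (e : el (rep (.act b')) (.act b)) :
    ∃ h : Vertex.act b' = .act b, e = h ▸ gen (.act b') := by
  have h := actHom b e
  cases h with
  | id => exact ⟨rfl, rfl⟩

/-- The final agent of a basic action in a seed. -/
theorem Seed.exists_s_eq (σ : Seed) {p n : ℕ} {b : Basic p n} (e : el σ.cospan.mid (.act b)) :
    ∃ y : el σ.final (.ag p), σ.cospan.s.app _ y = (Edge.src b).act _ e := by
  cases σ with
  | act b' =>
    obtain ⟨h, rfl⟩ := el_act_act e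
    cases h
    exact ⟨gen _, (Edge.rep_gen _).trans (Edge.act_gen _).symm⟩
  | fork n =>
    rcases el_act_fork e with ⟨h, rfl⟩ | ⟨h, rfl⟩ <;> cases h
    · exact ⟨_, forkCospan_s_inl _⟩
    · exact ⟨_, forkCospan_s_inr _⟩
  | sync n a m c d =>
    rcases el_act_sync e with ⟨h, rfl⟩ | ⟨h, rfl⟩ <;> cases h
    · exact ⟨_, syncCospan_s_inl _ _ _ _ _⟩
    · exact ⟨_, syncCospan_s_inr _ _ _ _ _⟩

/-- The initial agent of a basic action in a seed. -/
theorem Seed.exists_t_eq (σ : Seed) {p n : ℕ} {b : Basic p n} (e : el σ.cospan.mid (.act b)) :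
    ∃ x : el σ.init (.ag n), σ.cospan.t.app _ x = (Edge.tgt b).act _ e := by
  cases σ with
  | act b' =>
    obtain ⟨h, rfl⟩ := el_act_act e
    cases h
    exact ⟨gen _, (Edge.rep_gen _).trans (Edge.act_gen _).symm⟩
  | fork n =>
    rcases el_act_fork e with ⟨h, rfl⟩ | ⟨h, rfl⟩ <;> cases h
    · exact ⟨_, forkCospan_t_left _⟩
    · exact ⟨_, forkCospan_t_right _⟩
  | sync n a m c d =>
    rcases el_act_sync e with ⟨h, rfl⟩ | ⟨h, rfl⟩ <;> cases h
    · exact ⟨_, syncCospan_t_inl _ _ _ _ _⟩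
    · exact ⟨_, syncCospan_t_inr _ _ _ _ _⟩

theorem Edge.rep_nameOf {a b : Vertex} (e : Edge a b) (x : el P b) :
    e.rep ≫ nameOf (P := P) x = nameOf (P := P) (e.act P x) := by
  refine rep_hom_ext ?_
  rw [NatTrans.comp_app_apply, Edge.rep_gen, ← Edge.act_gen, Edge.act_app, nameOf_gen, nameOf_gen]

theorem nameOf_injective {c : Vertex} {x y : el P c}
    (h : nameOf (P := P) x = nameOf (P := P) y) : x = y := yonedaEquiv.symm.injective h

theorem Edge.act_st {p n : ℕ} (b : Basic p n) (i : Fin n) (e : el P (.act b)) :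
    (Edge.port p (Fin.castLE b.le i)).act P ((Edge.src b).act P e) =
      (Edge.port n i).act P ((Edge.tgt b).act P e) := by
  have h := congrArg (· ≫ nameOf (P := P) e) (Edge.rep_st b i)
  simp only [Category.assoc] at h
  rw [Edge.rep_nameOf, Edge.rep_nameOf, Edge.rep_nameOf, Edge.rep_nameOf] at h
  exact nameOf_injective h

theorem Edge.act_object (n : ℕ) (a : Fin n) (m : ℕ) (c d : Fin m) (e : el P (.sync n a m c d)) :
    (Edge.port (n + 1) (Fin.last n)).act P
        ((Edge.src (.inp n a)).act P ((Edge.rho n a m c d).act P e)) =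
      (Edge.port m d).act P ((Edge.src (.out m c d)).act P ((Edge.eps n a m c d).act P e)) := by
  have h := congrArg (· ≫ nameOf (P := P) e) (Edge.rep_object n a m c d)
  simp only [Category.assoc] at h
  rw [Edge.rep_nameOf, Edge.rep_nameOf, Edge.rep_nameOf, Edge.rep_nameOf, Edge.rep_nameOf,
    Edge.rep_nameOf] at h
  exact nameOf_injective h

/-- Every channel of a seed is a channel of the final agent of a basic action. -/
theorem Seed.exists_port_src (σ : Seed) (x : el σ.cospan.mid .star) :
    ∃ (p n : ℕ) (b : Basic p n) (e : el σ.cospan.mid (.act b)) (i : Fin p),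
      x = (Edge.port p i).act _ ((Edge.src b).act _ e) := by
  have key : ∀ {V : Vertex} (_ : 1 < V.dim) (x : el (rep V) .star),
      ∃ (p n : ℕ) (b : Basic p n) (e : el (rep V) (.act b)) (i : Fin p),
        x = (Edge.port p i).act _ ((Edge.src b).act _ e) := by
    intro V hV x
    rcases starHom x with ⟨rfl, -⟩ | ⟨k, i, g, rfl⟩
    · exact absurd hV (by simp [Vertex.dim])
    · rcases agHom g with ⟨rfl, -⟩ | ⟨n, b, g, rfl⟩ | ⟨p, b, g, rfl⟩
      · exact absurd hV (by simp [Vertex.dim])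
      · exact ⟨k, n, b, g, i, rfl⟩
      · exact ⟨p, k, b, g, Fin.castLE b.le i, (Edge.act_st (P := rep V) b i g).symm⟩
  cases σ with
  | act b => exact key (by simp [Vertex.dim]) x
  | fork n => exact key (by simp [Vertex.dim]) x
  | sync n a m c d => exact key (by simp [Vertex.dim]) x

/-- Each channel is a port of the final agent of some basic action, and that agent belongs to the
final position. -/
theorem Seed.s_star_surjective (σ : Seed) :
    Function.Surjective (σ.cospan.s.app (op Vertex.star.ob)) := by
  intro x
  obtain ⟨p, n, b, e, i, rfl⟩ := σ.exists_port_src x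
  obtain ⟨y, hy⟩ := σ.exists_s_eq e
  exact ⟨(Edge.port p i).act _ y, by rw [Edge.act_app, hy]⟩

theorem el_ind_star {n : ℕ} (x : el (ind n) .star) :
    ∃ i : Fin n, x = (Edge.port n i).act (ind n) (gen (.ag n)) := by
  obtain ⟨i, rfl⟩ := hom_port x
  exact ⟨i, (Edge.act_gen _).symm⟩

theorem ports_condition {n : ℕ} {f g : ind n ⟶ P} (h : ports n ≫ f = ports n ≫ g) (i : Fin n) :
    (Edge.port n i).act P (f.app _ (gen (.ag n))) =
      (Edge.port n i).act P (g.app _ (gen (.ag n))) := by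
  have h := congrArg (fun k => (Sigma.ι (fun _ : Fin n => rep .star) i ≫ k).app _ (gen .star)) h
  simp only [colimit.ι_desc_assoc] at h
  replace h : ((Edge.port n i).rep ≫ f).app _ (gen .star) =
    ((Edge.port n i).rep ≫ g).app _ (gen .star) := h
  rwa [NatTrans.comp_app_apply, NatTrans.comp_app_apply, Edge.rep_gen, ← Edge.act_gen, Edge.act_app,
    Edge.act_app] at h

theorem port_condition {k m : ℕ} {i : Fin k} {j : Fin m} {f : ind k ⟶ P} {g : ind m ⟶ P}
    (h : (Edge.port k i).rep ≫ f = (Edge.port m j).rep ≫ g) :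
    (Edge.port k i).act P (f.app _ (gen (.ag k))) =
      (Edge.port m j).act P (g.app _ (gen (.ag m))) := by
  have h := congrArg (fun k => k.app _ (gen .star)) h
  simp only [NatTrans.comp_app_apply] at h
  rwa [Edge.rep_gen, Edge.rep_gen, ← Edge.act_gen, ← Edge.act_gen, Edge.act_app, Edge.act_app] at h

/-- The map from a representable diagram to a cofree diagram. -/
abbrev toChan {T : Type} {V : Vertex} (f : chanEl T V) : rep V ⟶ (chanPre T).diagram :=
  nameOf (P := (chanPre T).diagram) f

/-- The value of an element of a cofree diagram on the elements of a representable one. -/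
def chanAt {T : Type} {V : Vertex} (f : chanEl T V) {c : Vertex} (x : el (rep V) c) : chanEl T c :=
  (toChan f).app (op c.ob) x

theorem chanAt_gen {T : Type} {V : Vertex} (f : chanEl T V) : chanAt f (gen V) = f :=
  nameOf_gen (P := (chanPre T).diagram) f

theorem chanAt_act {T : Type} {V : Vertex} (f : chanEl T V) {c c' : Vertex} (e : Edge c c')
    (x : el (rep V) c') : chanAt f (e.act (rep V) x) = chanAct T e (chanAt f x) :=
  Edge.act_app (toChan f) e x

/-- A labelling of the seed that becomes injective on the channels of `A` separates them. -/
theorem injective_of_chanAt {A : Diagram} {T : Type} {V : Vertex} (f : chanEl T V) (g : A ⟶ rep V)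
    (φ : el A .star → T) (hφ : Function.Injective φ)
    (h : ∀ x : el A .star, chanAt f (g.app _ x) = φ x) :
    Function.Injective (g.app (op Vertex.star.ob)) := fun x y e =>
  hφ ((h x).symm.trans ((congrArg (fun z => chanAt f z) e).trans (h y)))

theorem chanAt_port {A : Diagram} {T : Type} {V : Vertex} (f : chanEl T V) (g : A ⟶ rep V) {n : ℕ}
    (i : Fin n) {a : el A (.ag n)} {e : el (rep V) (.ag n)} (h : g.app _ a = e) :
    chanAt f (g.app _ ((Edge.port n i).act A a)) = (chanAt f e : chanEl T (.ag n)) i := by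
  rw [Edge.act_app, h, chanAt_act]
  rfl

theorem exists_injective_ind (n : ℕ) : ∃ φ : el (ind n) .star → Fin n, Function.Injective φ ∧
    ∀ i, φ ((Edge.port n i).act (ind n) (gen (.ag n))) = i := by
  have h (i : Fin n) : chanAt (T := Fin n) (V := .ag n) (fun i => i)
      ((Edge.port n i).act (ind n) (gen (.ag n))) = i := by
    rw [chanAt_act, chanAt_gen]
    rfl
  refine ⟨fun x => chanAt (T := Fin n) (V := .ag n) (fun i => i) x, fun x y e => ?_, h⟩
  obtain ⟨i, rfl⟩ := el_ind_star x
  obtain ⟨j, rfl⟩ := el_ind_star y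
  rw [(h i).symm.trans (e.trans (h j))]

theorem Basic.tgt_star {p n : ℕ} (b : Basic p n) (i : Fin n) :
    chanAt (T := Fin p) (V := .act b) (fun i => i)
      ((Edge.tgt b).rep.app _ ((Edge.port n i).act (ind n) (gen (.ag n)))) =
        Fin.castLE b.le i := by
  rw [Edge.act_app, Edge.rep_gen, ← Edge.act_gen, chanAt_act, chanAt_act, chanAt_gen]
  rfl

/-- For a basic seed or a fork the labels are port indices. For a synchronisation they are the
channels of the initial position itself, so that the labelling restricts to the identity. -/
theorem Seed.t_star_injective (σ : Seed) :
    Function.Injective (σ.cospan.t.app (op Vertex.star.ob)) := by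
  cases σ with
  | @act p n b =>
    obtain ⟨φ, hφ, h⟩ := exists_injective_ind n
    refine injective_of_chanAt (T := Fin p) (V := .act b) (fun i => i) (Edge.tgt b).rep
      (fun x => Fin.castLE b.le (φ x)) ((Fin.castLE_injective _).comp hφ) fun x => ?_
    obtain ⟨i, rfl⟩ := el_ind_star x
    rw [h, b.tgt_star]
  | fork n =>
    obtain ⟨φ, hφ, h⟩ := exists_injective_ind n
    refine injective_of_chanAt (T := Fin n) (V := .fork n) (fun i => i) (forkCospan n).t φ hφ
      fun x => ?_
    obtain ⟨i, rfl⟩ := el_ind_star x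
    refine (chanAt_port _ _ i (forkCospan_t_left n)).trans ?_
    rw [h, chanAt_act, chanAt_act, chanAt_gen]
    rfl
  | sync n a m c d =>
    let f (i : Fin m) : el (link m c n a) .star :=
      (Edge.port m i).act _ ((linkL m c n a).app _ (gen (.ag m)))
    let g (i : Fin n) : el (link m c n a) .star :=
      (Edge.port n i).act _ ((linkR m c n a).app _ (gen (.ag n)))
    have hfg : f c = g a := port_condition pushout.condition
    -- The last port of the receiver must carry the label `f d` of the channel sent; the subject
    -- condition is the gluing `hfg`.
    let F : chanEl (el (link m c n a) .star) (.sync n a m c d) :=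
      ⟨(f, Fin.snoc (α := fun _ => el (link m c n a) .star) g (f d)),
        hfg.trans (Fin.snoc_castSucc (α := fun _ => el (link m c n a) .star) _ _ _).symm,
        (Fin.snoc_last (α := fun _ => el (link m c n a) .star) _ _).symm⟩
    refine injective_of_chanAt F (syncCospan n a m c d).t (fun x => x) (fun _ _ h => h) fun x => ?_
    rcases el_eq_or_eq (IsPushout.of_hasPushout _ _) x with ⟨x, rfl⟩ | ⟨x, rfl⟩
    · obtain ⟨i, rfl⟩ := el_ind_star x
      rw [Edge.act_app]
      refine (chanAt_port _ _ i (syncCospan_t_inl n a m c d)).trans ?_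
      rw [chanAt_act, chanAt_act, chanAt_gen]
      rfl
    · obtain ⟨i, rfl⟩ := el_ind_star x
      rw [Edge.act_app]
      refine (chanAt_port _ _ i (syncCospan_t_inr n a m c d)).trans ?_
      rw [chanAt_act, chanAt_act, chanAt_gen]
      exact Fin.snoc_castSucc (α := fun _ => el (link m c n a) .star) _ _ _

/-- For forks and synchronisations the labels are the channels of the final position. A labelling
requires exactly the identifications made by the pushout that defines this position. -/
theorem Seed.s_star_injective (σ : Seed) :
    Function.Injective (σ.cospan.s.app (op Vertex.star.ob)) := by
  cases σ with
  | @act p n b =>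
    obtain ⟨φ, hφ, h⟩ := exists_injective_ind p
    refine injective_of_chanAt (T := Fin p) (V := .act b) (fun i => i) (Edge.src b).rep φ hφ
      fun x => ?_
    obtain ⟨i, rfl⟩ := el_ind_star x
    rw [h, Edge.act_app, Edge.rep_gen, ← Edge.act_gen, chanAt_act, chanAt_act, chanAt_gen]
    rfl
  | fork n =>
    let f (i : Fin n) : el (twin n) .star :=
      (Edge.port n i).act _ ((twinL n).app _ (gen (.ag n)))
    have hf (i : Fin n) : (Edge.port n i).act _ ((twinR n).app _ (gen (.ag n))) = f i :=
      (ports_condition pushout.condition i).symm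
    refine injective_of_chanAt (V := .fork n) f (forkCospan n).s (fun x => x) (fun _ _ h => h)
      fun x => ?_
    rcases el_eq_or_eq (IsPushout.of_hasPushout _ _) x with ⟨x, rfl⟩ | ⟨x, rfl⟩
    · obtain ⟨i, rfl⟩ := el_ind_star x
      rw [Edge.act_app]
      refine (chanAt_port _ _ i (forkCospan_s_inl n)).trans ?_
      rw [chanAt_act, chanAt_act, chanAt_gen]
      rfl
    · obtain ⟨i, rfl⟩ := el_ind_star x
      rw [Edge.act_app]
      refine (chanAt_port _ _ i (forkCospan_s_inr n)).trans (Eq.trans ?_ (hf i).symm)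
      rw [chanAt_act, chanAt_act, chanAt_gen]
      rfl
  | sync n a m c d =>
    let L := link₂ m c d (n + 1) (Fin.castSucc a) (Fin.last n)
    let f (i : Fin m) : el L .star :=
      (Edge.port m i).act L ((link₂L m c d _ (Fin.castSucc a) (Fin.last n)).app _ (gen (.ag m)))
    let g (i : Fin (n + 1)) : el L .star := (Edge.port (n + 1) i).act L
      ((link₂R m c d _ (Fin.castSucc a) (Fin.last n)).app _ (gen (.ag (n + 1))))
    have h₀ := pushout.condition (f := coprod.desc (Edge.port m c).rep (Edge.port m d).rep)
      (g := coprod.desc (Edge.port (n + 1) (Fin.castSucc a)).rep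
        (Edge.port (n + 1) (Fin.last n)).rep)
    have h₁ : f c = g (Fin.castSucc a) := port_condition (by
      have := congrArg (coprod.inl ≫ ·) h₀
      simp only [coprod.inl_desc_assoc] at this
      exact this)
    have h₂ : f d = g (Fin.last n) := port_condition (by
      have := congrArg (coprod.inr ≫ ·) h₀
      simp only [coprod.inr_desc_assoc] at this
      exact this)
    let F : chanEl (el L .star) (.sync n a m c d) := ⟨(f, g), h₁, h₂⟩
    refine injective_of_chanAt F (syncCospan n a m c d).s (fun x => x) (fun _ _ h => h) fun x => ?_
    rcases el_eq_or_eq (IsPushout.of_hasPushout _ _) x with ⟨x, rfl⟩ | ⟨x, rfl⟩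
    · obtain ⟨i, rfl⟩ := el_ind_star x
      rw [Edge.act_app]
      refine (chanAt_port _ _ i (syncCospan_s_inl n a m c d)).trans ?_
      rw [chanAt_act, chanAt_act, chanAt_gen]
      rfl
    · obtain ⟨i, rfl⟩ := el_ind_star x
      rw [Edge.act_app]
      refine (chanAt_port _ _ i (syncCospan_s_inr n a m c d)).trans ?_
      rw [chanAt_act, chanAt_act, chanAt_gen]
      rfl

theorem Seed.s_star_bijective (σ : Seed) :
    Function.Bijective (σ.cospan.s.app (op Vertex.star.ob)) :=
  ⟨σ.s_star_injective, σ.s_star_surjective⟩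

/-! ### Agents of actions -/

theorem el_twin {n k : ℕ} (f : el (twin n) (.ag k)) :
    ∃ h : Vertex.ag n = .ag k, f = h ▸ (twinL n).app _ (gen (.ag n)) ∨
      f = h ▸ (twinR n).app _ (gen (.ag n)) := by
  rcases el_eq_or_eq (IsPushout.of_hasPushout _ _) f with ⟨f, rfl⟩ | ⟨f, rfl⟩ <;>
    obtain ⟨rfl, rfl⟩ := el_ind f
  · exact ⟨rfl, .inl rfl⟩
  · exact ⟨rfl, .inr rfl⟩

theorem el_link {m : ℕ} {c : Fin m} {n : ℕ} {a : Fin n} {k : ℕ} (f : el (link m c n a) (.ag k)) :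
    (∃ h : Vertex.ag m = .ag k, f = h ▸ (linkL m c n a).app _ (gen (.ag m))) ∨
      ∃ h : Vertex.ag n = .ag k, f = h ▸ (linkR m c n a).app _ (gen (.ag n)) := by
  rcases el_eq_or_eq (IsPushout.of_hasPushout _ _) f with ⟨f, rfl⟩ | ⟨f, rfl⟩ <;>
    obtain ⟨rfl, rfl⟩ := el_ind f
  · exact .inl ⟨rfl, rfl⟩
  · exact .inr ⟨rfl, rfl⟩

theorem el_link₂ {m : ℕ} {c d : Fin m} {n : ℕ} {a e : Fin n} {k : ℕ}
    (f : el (link₂ m c d n a e) (.ag k)) :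
    (∃ h : Vertex.ag m = .ag k, f = h ▸ (link₂L m c d n a e).app _ (gen (.ag m))) ∨
      ∃ h : Vertex.ag n = .ag k, f = h ▸ (link₂R m c d n a e).app _ (gen (.ag n)) := by
  rcases el_eq_or_eq (IsPushout.of_hasPushout _ _) f with ⟨f, rfl⟩ | ⟨f, rfl⟩ <;>
    obtain ⟨rfl, rfl⟩ := el_ind f
  · exact .inl ⟨rfl, rfl⟩
  · exact .inr ⟨rfl, rfl⟩

/-- Every final agent of a seed is the final agent of a basic action. -/
theorem Seed.exists_src_eq (σ : Seed) {p : ℕ} (f : el σ.final (.ag p)) :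
    ∃ (n : ℕ) (b : Basic p n) (e : el σ.cospan.mid (.act b)),
      (Edge.src b).act _ e = σ.cospan.s.app _ f := by
  cases σ with
  | act b =>
    obtain ⟨rfl, rfl⟩ := el_ind f
    exact ⟨_, b, gen (.act b), (Edge.act_gen _).trans (Edge.rep_gen _).symm⟩
  | fork n =>
    obtain ⟨h, rfl | rfl⟩ := el_twin f <;> cases h
    · exact ⟨_, _, _, (forkCospan_s_inl _).symm⟩
    · exact ⟨_, _, _, (forkCospan_s_inr _).symm⟩
  | sync n a m c d =>
    obtain ⟨h, rfl⟩ | ⟨h, rfl⟩ := el_link₂ f <;> cases h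
    · exact ⟨_, _, _, (syncCospan_s_inl _ _ _ _ _).symm⟩
    · exact ⟨_, _, _, (syncCospan_s_inr _ _ _ _ _).symm⟩

/-- Every initial agent of a seed is the initial agent of a basic action. -/
theorem Seed.exists_tgt_eq (σ : Seed) {n : ℕ} (x : el σ.init (.ag n)) :
    ∃ (p : ℕ) (b : Basic p n) (e : el σ.cospan.mid (.act b)),
      (Edge.tgt b).act _ e = σ.cospan.t.app _ x := by
  cases σ with
  | act b =>
    obtain ⟨rfl, rfl⟩ := el_ind x
    exact ⟨_, b, gen (.act b), (Edge.act_gen _).trans (Edge.rep_gen _).symm⟩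
  | fork n =>
    obtain ⟨rfl, rfl⟩ := el_ind x
    exact ⟨_, _, _, (forkCospan_t_left _).symm⟩
  | sync n a m c d =>
    obtain ⟨h, rfl⟩ | ⟨h, rfl⟩ := el_link x <;> cases h
    · exact ⟨_, _, _, (syncCospan_t_inl _ _ _ _ _).symm⟩
    · exact ⟨_, _, _, (syncCospan_t_inr _ _ _ _ _).symm⟩

theorem ag_dim_pos (n : ℕ) : 0 < (Vertex.ag n).dim := Nat.zero_lt_one

theorem colour_congr (κ : P ⟶ colours.diagram) {n : ℕ} {x y : el P (.ag n)} (h : x = y) :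
    (κ.app _ x : colourEl (.ag n)) = κ.app _ y := by rw [h]

/-- Sender and receiver may have equal arities, but they are the initial agents of an output and of
an input, which have different colours. -/
theorem Seed.t_ag_injective (σ : Seed) (k : ℕ) :
    Function.Injective (σ.cospan.t.app (op (Vertex.ag k).ob)) := by
  cases σ with
  | act b => exact fun _ _ _ => Subsingleton.elim (α := el (ind _) (.ag k)) _ _
  | fork n => exact fun _ _ _ => Subsingleton.elim (α := el (ind _) (.ag k)) _ _
  | sync n a m c d =>
    let κ : rep (.sync n a m c d) ⟶ colours.diagram :=
      nameOf (P := colours.diagram) (c := .sync n a m c d) (() : colourEl (.sync n a m c d))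
    have hne (h : Vertex.ag n = .ag m) :
        (syncCospan n a m c d).t.app _ ((linkL m c n a).app _ (gen (.ag m))) ≠
          (syncCospan n a m c d).t.app _
            (h ▸ (linkR m c n a).app _ (gen (.ag n)) : el (link m c n a) (.ag m)) := by
      cases h
      intro h
      have h := (syncCospan_t_inl _ _ _ _ _).symm.trans (h.trans (syncCospan_t_inr _ _ _ _ _))
      have h := (colour_tgt κ _ _).symm.trans ((colour_congr κ h).trans (colour_tgt κ _ _))
      exact absurd (Colour.init.inj h) (by simp [Basic.tcode])
    intro x y h
    obtain ⟨h₁, rfl⟩ | ⟨h₁, rfl⟩ := el_link x <;> obtain ⟨h₂, rfl⟩ | ⟨h₂, rfl⟩ := el_link y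
    · rfl
    · cases h₁
      exact (hne h₂ h).elim
    · cases h₂
      exact (hne h₁ h.symm).elim
    · rfl

namespace ActionData

section

variable {σ : Seed} {Y X : Diagram} {u : Cospan Y X} (d : ActionData σ u)

theorem μ_injective {c : Vertex} (hc : 0 < c.dim) : Function.Injective (d.μ.app (op c.ob)) :=
  pushout_inr_injective d.sqU.flip fun a => (isEmpty_interface hc).elim a

theorem agents_X {k : ℕ} (x : el X (.ag k)) :
    (∃ a : el σ.init (.ag k), d.x.app _ a = x) ∨ ∃ z : el d.Z (.ag k), d.zx.app _ z = x :=
  el_eq_or_eq d.sqX x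

theorem agents_Y {k : ℕ} (y : el Y (.ag k)) :
    (∃ f : el σ.final (.ag k), d.y.app _ f = y) ∨ ∃ z : el d.Z (.ag k), d.zy.app _ z = y :=
  el_eq_or_eq d.sqY y

/-- Context and seed have disjoint agents in the action and the context embeds, so a passive final
agent meets the initial position only in its own copy there. -/
theorem s_zy_eq_t_iff {k : ℕ} (z : el d.Z (.ag k)) (x : el X (.ag k)) :
    u.s.app _ (d.zy.app _ z) = u.t.app _ x ↔ x = d.zx.app _ z := by
  rw [d.s_zy]
  constructor
  · intro h
    obtain ⟨a, rfl⟩ | ⟨z', rfl⟩ := d.agents_X x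
    · rw [d.t_x] at h
      exact (pushout_ne d.sqU (isEmpty_interface (ag_dim_pos _)) _ _ h.symm).elim
    · rw [d.t_zx] at h
      rw [d.zu_injective (ag_dim_pos _) h]
  · rintro rfl
    rw [d.t_zx]

theorem s_zy_ne_src {k n : ℕ} (z : el d.Z (.ag k)) {b : Basic k n} (e : el u.mid (.act b)) :
    (Edge.src b).act _ e ≠ u.s.app _ (d.zy.app _ z) := by
  obtain ⟨κ, hκ⟩ := d.exists_colouring
  intro h
  rw [d.s_zy] at h
  have h := (colour_src κ _ _).symm.trans ((colour_congr κ h).trans (hκ _ _))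
  exact Colour.noConfusion h

/-- Final agents of the seed have a final colour; agents of the initial position are coloured
initial or idle. -/
theorem s_y_ne_t {k : ℕ} (f : el σ.final (.ag k)) (x : el X (.ag k)) :
    u.s.app _ (d.y.app _ f) ≠ u.t.app _ x := by
  obtain ⟨κ, hκ⟩ := d.exists_colouring
  intro h
  obtain ⟨n, b, e, he⟩ := σ.exists_src_eq f
  rw [d.s_y, ← he, Edge.act_app] at h
  obtain ⟨a, rfl⟩ | ⟨z', rfl⟩ := d.agents_X x
  · obtain ⟨n, b, e, he⟩ := σ.exists_tgt_eq a
    rw [d.t_x, ← he, Edge.act_app] at h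
    have h := (colour_src κ _ _).symm.trans ((colour_congr κ h).trans (colour_tgt κ _ _))
    exact Colour.noConfusion h
  · rw [d.t_zx] at h
    have h := (colour_src κ _ _).symm.trans ((colour_congr κ h).trans (hκ _ _))
    exact Colour.noConfusion h

theorem t_eq_tgt_iff {p n : ℕ} {b : Basic p n} (e : el σ.cospan.mid (.act b)) (x : el X (.ag n)) :
    (Edge.tgt b).act _ (d.μ.app _ e) = u.t.app _ x ↔
      ∃ a, x = d.x.app _ a ∧ (Edge.tgt b).act _ e = σ.cospan.t.app _ a := by
  rw [← Edge.act_app]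
  constructor
  · intro h
    obtain ⟨a, rfl⟩ | ⟨z', rfl⟩ := d.agents_X x
    · rw [d.t_x] at h
      exact ⟨a, rfl, d.μ_injective (ag_dim_pos _) h⟩
    · rw [d.t_zx] at h
      exact (pushout_ne d.sqU (isEmpty_interface (ag_dim_pos _)) _ _ h).elim
  · rintro ⟨a, rfl, h⟩
    rw [d.t_x, h]

theorem s_eq_src_iff {p n : ℕ} {b : Basic p n} (e : el σ.cospan.mid (.act b))
    (f : el σ.final (.ag p)) :
    (Edge.src b).act _ (d.μ.app _ e) = u.s.app _ (d.y.app _ f) ↔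
      (Edge.src b).act _ e = σ.cospan.s.app _ f := by
  rw [← Edge.act_app, d.s_y]
  exact (d.μ_injective (ag_dim_pos _)).eq_iff

end

section

variable {σ : Seed} {X Y : Position} {M : Cospan Y.diagram X.diagram} (d : ActionData σ M)
  (D : Beh X)

theorem agentResidue_passive {p : ℕ} (z : el d.Z (.ag p)) (B' : IndBeh p) :
    AgentResidue D M B' (d.zy.app _ z) ↔ Nonempty (B' ≅ D.el (d.zx.app _ z)) := by
  constructor
  · rintro (⟨x, h, e⟩ | ⟨n, b, x, e, h, -⟩)
    · rw [d.s_zy_eq_t_iff] at h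
      exact h ▸ e
    · exact (d.s_zy_ne_src z e h).elim
  · exact fun e => .inl ⟨_, (d.s_zy_eq_t_iff _ _).2 rfl, e⟩

/-- The passive alternative is excluded by `s_y_ne_t`, and every basic action of `M` comes from the
seed, so the condition can be evaluated inside the seed. -/
theorem agentResidue_active {p : ℕ} (f : el σ.final (.ag p)) (B' : IndBeh p) :
    AgentResidue D M B' (d.y.app _ f) ↔ ∃ (n : ℕ) (b : Basic p n) (a : el σ.init (.ag n))
      (e : el σ.cospan.mid (.act b)), (Edge.src b).act _ e = σ.cospan.s.app _ f ∧
        (Edge.tgt b).act _ e = σ.cospan.t.app _ a ∧ (D.el (d.x.app _ a)).Next b.view B' := by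
  constructor
  · rintro (⟨x, h, -⟩ | ⟨n, b, x, e, hs, ht, h⟩)
    · exact (d.s_y_ne_t f x h).elim
    · obtain ⟨e, rfl⟩ := d.exists_act e
      obtain ⟨a, rfl, ha⟩ := (d.t_eq_tgt_iff _ _).1 ht
      exact ⟨n, b, a, e, (d.s_eq_src_iff _ _).1 hs, ha, h⟩
  · rintro ⟨n, b, a, e, hs, ht, h⟩
    exact .inr ⟨n, b, _, _, (d.s_eq_src_iff _ _).2 hs, (d.t_eq_tgt_iff _ _).2 ⟨a, rfl, ht⟩, h⟩

end

end ActionData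

/-! ### Residues of the active agents, seed by seed -/

section Residues

variable {X Y : Position} {M : Cospan Y.diagram X.diagram} (D : Beh X)

theorem agentResidue_act {p n : ℕ} {b : Basic p n} (d : ActionData (.act b) M) (B' : IndBeh p) :
    AgentResidue D M B' (d.y.app _ (gen (.ag p))) ↔
      (D.el (d.x.app _ (gen (.ag n)))).Next b.view B' := by
  rw [d.agentResidue_active]
  constructor
  · rintro ⟨k, b, a, e, hs, ht, h⟩
    obtain ⟨hb, rfl⟩ := el_act_act e
    cases hb
    have ha : a = gen (.ag n) := Subsingleton.elim (α := el (ind n) (.ag n)) _ _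
    rwa [ha] at h
  · exact fun h => ⟨n, b, gen (.ag n), gen (.act b), (Edge.act_gen _).trans (Edge.rep_gen _).symm,
      (Edge.act_gen _).trans (Edge.rep_gen _).symm, h⟩

/-- The fork contains two basic actions on the same initial agent; the colours of their final agents
rule out the right one. -/
theorem agentResidue_forkL {n : ℕ} (d : ActionData (.fork n) M) (B' : IndBeh n) :
    AgentResidue D M B' (d.y.app _ ((twinL n).app _ (gen (.ag n)))) ↔
      (D.el (d.x.app _ (gen (.ag n)))).Next (Basic.forkL n).view B' := by
  rw [d.agentResidue_active]
  constructor
  · rintro ⟨k, b, a, e, hs, ht, h⟩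
    let κ : rep (.fork n) ⟶ colours.diagram :=
      nameOf (P := colours.diagram) (c := .fork n) (() : colourEl (.fork n))
    rcases el_act_fork e with ⟨hb, rfl⟩ | ⟨hb, rfl⟩ <;> cases hb
    · have ha : a = gen (.ag n) := Subsingleton.elim (α := el (ind n) (.ag n)) _ _
      rwa [ha] at h
    · have h := hs.trans (forkCospan_s_inl n)
      have h := (colour_src κ _ _).symm.trans ((colour_congr κ h).trans (colour_src κ _ _))
      exact absurd (Colour.final.inj h) (by simp [Basic.code])
  · exact fun h => ⟨n, _, gen (.ag n), _, (forkCospan_s_inl n).symm, (forkCospan_t_left n).symm, h⟩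

theorem agentResidue_forkR {n : ℕ} (d : ActionData (.fork n) M) (B' : IndBeh n) :
    AgentResidue D M B' (d.y.app _ ((twinR n).app _ (gen (.ag n)))) ↔
      (D.el (d.x.app _ (gen (.ag n)))).Next (Basic.forkR n).view B' := by
  rw [d.agentResidue_active]
  constructor
  · rintro ⟨k, b, a, e, hs, ht, h⟩
    let κ : rep (.fork n) ⟶ colours.diagram :=
      nameOf (P := colours.diagram) (c := .fork n) (() : colourEl (.fork n))
    rcases el_act_fork e with ⟨hb, rfl⟩ | ⟨hb, rfl⟩ <;> cases hb
    · have h := hs.trans (forkCospan_s_inr n)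
      have h := (colour_src κ _ _).symm.trans ((colour_congr κ h).trans (colour_src κ _ _))
      exact absurd (Colour.final.inj h) (by simp [Basic.code])
    · have ha : a = gen (.ag n) := Subsingleton.elim (α := el (ind n) (.ag n)) _ _
      rwa [ha] at h
  · exact fun h => ⟨n, _, gen (.ag n), _, (forkCospan_s_inr n).symm, (forkCospan_t_right n).symm, h⟩

/-- Colours of final agents select the output among the two basic actions, and injectivity of the
initial leg on agents then determines the initial agent. -/
theorem agentResidue_syncL {n : ℕ} {a : Fin n} {m : ℕ} {c e : Fin m}
    (d : ActionData (.sync n a m c e) M) (B' : IndBeh m) :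
    AgentResidue D M B' (d.y.app _ ((link₂L m c e _ (Fin.castSucc a) (Fin.last n)).app _
        (gen (.ag m)))) ↔
      (D.el (d.x.app _ ((linkL m c n a).app _ (gen (.ag m))))).Next (Basic.out m c e).view B' := by
  rw [d.agentResidue_active]
  constructor
  · rintro ⟨k, b, x, i, hs, ht, h⟩
    let κ : rep (.sync n a m c e) ⟶ colours.diagram :=
      nameOf (P := colours.diagram) (c := .sync n a m c e) (() : colourEl (.sync n a m c e))
    have hs := hs.trans (syncCospan_s_inl n a m c e)
    rcases el_act_sync i with ⟨hb, rfl⟩ | ⟨hb, rfl⟩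
    · cases hb
      have hx := Seed.t_ag_injective (.sync n a m c e) _
        (ht.symm.trans (syncCospan_t_inl n a m c e).symm)
      rwa [hx] at h
    · cases hb
      have h := (colour_src κ _ _).symm.trans ((colour_congr κ hs).trans (colour_src κ _ _))
      exact absurd (Colour.final.inj h) (by simp [Basic.code])
  · exact fun h => ⟨m, _, _, _, (syncCospan_s_inl n a m c e).symm,
      (syncCospan_t_inl n a m c e).symm, h⟩

theorem agentResidue_syncR {n : ℕ} {a : Fin n} {m : ℕ} {c e : Fin m}
    (d : ActionData (.sync n a m c e) M) (B' : IndBeh (n + 1)) :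
    AgentResidue D M B' (d.y.app _ ((link₂R m c e _ (Fin.castSucc a) (Fin.last n)).app _
        (gen (.ag (n + 1))))) ↔
      (D.el (d.x.app _ ((linkR m c n a).app _ (gen (.ag n))))).Next (Basic.inp n a).view B' := by
  rw [d.agentResidue_active]
  constructor
  · rintro ⟨k, b, x, i, hs, ht, h⟩
    let κ : rep (.sync n a m c e) ⟶ colours.diagram :=
      nameOf (P := colours.diagram) (c := .sync n a m c e) (() : colourEl (.sync n a m c e))
    have hs := hs.trans (syncCospan_s_inr n a m c e)
    rcases el_act_sync i with ⟨hb, rfl⟩ | ⟨hb, rfl⟩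
    · cases hb
      have h := (colour_src κ _ _).symm.trans ((colour_congr κ hs).trans (colour_src κ _ _))
      exact absurd (Colour.final.inj h) (by simp [Basic.code])
    · cases hb
      have hx := Seed.t_ag_injective (.sync n a m c e) _
        (ht.symm.trans (syncCospan_t_inr n a m c e).symm)
      rwa [hx] at h
  · exact fun h => ⟨n, _, _, _, (syncCospan_s_inr n a m c e).symm,
      (syncCospan_t_inr n a m c e).symm, h⟩

end Residues

/-! ### Channels of actions -/

/-- The first `n` ports of a final agent are inherited from the initial one. Only a port of index
`n`, in an input or a channel creation, can be new. -/
theorem Seed.exists_t_port {σ : Seed} {p n : ℕ} {b : Basic p n} (e : el σ.cospan.mid (.act b))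
    (i : Fin p) (hi : i.1 < n) :
    ∃ x : el σ.init .star, σ.cospan.t.app _ x = (Edge.port p i).act _ ((Edge.src b).act _ e) := by
  obtain ⟨x, hx⟩ := σ.exists_t_eq e
  refine ⟨(Edge.port n ⟨i.1, hi⟩).act _ x, ?_⟩
  rw [Edge.act_app, hx, ← Edge.act_st]
  rfl

theorem Seed.t_star_surjective_of_eq {σ : Seed}
    (h : ∀ {p n : ℕ} (b : Basic p n), el σ.cospan.mid (.act b) → p = n) :
    Function.Surjective (σ.cospan.t.app (op Vertex.star.ob)) := by
  intro v
  obtain ⟨p, n, b, e, i, rfl⟩ := σ.exists_port_src v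
  exact Seed.exists_t_port e i (h b e ▸ i.2)

theorem Seed.t_star_surjective_fork (n : ℕ) :
    Function.Surjective ((Seed.fork n).cospan.t.app (op Vertex.star.ob)) :=
  Seed.t_star_surjective_of_eq fun b e => by
    rcases el_act_fork e with ⟨hb, -⟩ | ⟨hb, -⟩ <;> cases hb <;> rfl

theorem Seed.t_star_surjective_act {n : ℕ} (b : Basic n n) :
    Function.Surjective ((Seed.act b).cospan.t.app (op Vertex.star.ob)) :=
  Seed.t_star_surjective_of_eq fun b' e => by
    obtain ⟨hb, -⟩ := el_act_act e
    cases hb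
    rfl

/-- The extra port of the receiver is the channel `d` of the sender, by the object equation, hence
is already present initially. -/
theorem Seed.t_star_surjective_sync (n : ℕ) (a : Fin n) (m : ℕ) (c d : Fin m) :
    Function.Surjective ((Seed.sync n a m c d).cospan.t.app (op Vertex.star.ob)) := by
  intro v
  obtain ⟨p, k, b, e, i, rfl⟩ := Seed.exists_port_src _ v
  rcases el_act_sync e with ⟨hb, he⟩ | ⟨hb, he⟩ <;> cases hb
  · exact Seed.exists_t_port e i i.2
  · induction i using Fin.lastCases with
    | cast i => exact Seed.exists_t_port e _ i.2
    | last =>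
      obtain ⟨x, hx⟩ := Seed.exists_t_port (σ := .sync n a m c d) (b := .out m c d)
        ((Edge.eps n a m c d).act (rep (.sync n a m c d)) (gen _)) d d.2
      exact ⟨x, hx.trans ((Edge.act_object n a m c d _).symm.trans (by rw [he]; rfl))⟩

namespace ActionData

variable {σ : Seed} {Y X : Diagram} {u : Cospan Y X}

theorem s_star_bijective (d : ActionData σ u) : Function.Bijective (u.s.app (op Vertex.star.ob)) :=
  pushout_inr_bijective d.sqS σ.s_star_bijective

theorem t_star_injective (d : ActionData σ u) : Function.Injective (u.t.app (op Vertex.star.ob)) :=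
  pushout_inr_injective d.sqT σ.t_star_injective

theorem t_star_bijective (d : ActionData σ u)
    (h : Function.Surjective (σ.cospan.t.app (op Vertex.star.ob))) :
    Function.Bijective (u.t.app (op Vertex.star.ob)) :=
  pushout_inr_bijective d.sqT ⟨σ.t_star_injective, h⟩

/-- The port of a final agent of a basic action on a channel of the initial agent. -/
theorem s_port {p n : ℕ} {b : Basic p n} {e : el u.mid (.act b)} {x : el X (.ag n)}
    {y : el Y (.ag p)} (hy : u.s.app _ y = (Edge.src b).act _ e)
    (hx : u.t.app _ x = (Edge.tgt b).act _ e) (i : Fin n) :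
    u.s.app _ ((Edge.port p (Fin.castLE b.le i)).act _ y) =
      u.t.app _ ((Edge.port n i).act _ x) := by
  rw [Edge.act_app, Edge.act_app, hy, hx, Edge.act_st]

theorem s_port_zy (d : ActionData σ u) {k : ℕ} (z : el d.Z (.ag k)) (i : Fin k) :
    u.s.app _ ((Edge.port k i).act _ (d.zy.app _ z)) =
      u.t.app _ ((Edge.port k i).act _ (d.zx.app _ z)) := by
  rw [Edge.act_app, Edge.act_app, d.s_zy, d.t_zx]

end ActionData

/-- The channel created by an action of shape `ν`. -/
def ActionData.newChan {n : ℕ} {Y X : Diagram} {u : Cospan Y X} (d : ActionData (.act (.nu n)) u) :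
    el u.mid .star :=
  (Edge.port (n + 1) (Fin.last n)).act u.mid
    ((Edge.src (.nu n)).act u.mid (d.μ.app _ (gen (.act (.nu n)))))

/-! ### The channel added by ν -/

section Nu

variable {n : ℕ} {Y X : Diagram} {u : Cospan Y X} (d : ActionData (.act (.nu n)) u)

theorem ActionData.t_or_newChan (c : el u.mid .star) :
    (∃ x : el X .star, u.t.app _ x = c) ∨ c = d.newChan := by
  rcases el_eq_or_eq d.sqT c with ⟨v, rfl⟩ | h
  · obtain ⟨p, k, b, e, i, rfl⟩ := Seed.exists_port_src _ v
    obtain ⟨hb, he⟩ := el_act_act e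
    cases hb
    induction i using Fin.lastCases with
    | cast i =>
      obtain ⟨x, hx⟩ := Seed.exists_t_port e (Fin.castSucc i) i.2
      exact .inl ⟨_, (d.t_x x).trans (congrArg _ hx)⟩
    | last =>
      right
      rw [Edge.act_app, Edge.act_app, he]
      rfl
  · exact .inl h

/-- The square of `sqT` is a pullback on channels, so a coincidence would already occur in the seed,
where the initial ports have labels below `n` and the new one has label `n`. -/
theorem ActionData.t_ne_newChan (x : el X .star) : u.t.app _ x ≠ d.newChan := by
  intro h
  have hp := Types.isPullback_of_isPushout (isPushout_at d.sqT .star) (Seed.t_star_injective _)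
  have h' : d.μ.app _ ((Edge.port (n + 1) (Fin.last n)).act (rep (.act (.nu n)))
      ((Edge.src (.nu n)).act (rep (.act (.nu n))) (gen (.act (.nu n))))) = u.t.app _ x :=
    ((Edge.act_app d.μ _ _).trans (congrArg _ (Edge.act_app d.μ _ _))).trans h.symm
  obtain ⟨w, hw, -⟩ := Types.exists_of_isPullback hp _ _ h'
  obtain ⟨i, rfl⟩ := el_ind_star w
  have h₁ := Basic.tgt_star (.nu n) i
  have hw' := congrArg (fun z => chanAt (T := Fin (n + 1)) (V := .act (.nu n)) (fun i => i) z) hw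
  have h₂ := h₁.symm.trans hw'
  rw [chanAt_act, chanAt_act, chanAt_gen] at h₂
  exact absurd (congrArg Fin.val h₂) i.2.ne

end Nu

/-- Transport of names of channels along an action that creates no channel. -/
theorem ActionData.exists_names {σ : Seed} {X Y : Position} {M : Cospan Y.diagram X.diagram}
    (d : ActionData σ M) (h : Function.Surjective (σ.cospan.t.app (op Vertex.star.ob)))
    {γ : Type} (e : el X.diagram .star ≃ γ) :
    ∃ e' : el Y.diagram .star ≃ γ, ∀ c c', M.s.app _ c = M.t.app _ c' → e' c = e c' := by
  refine ⟨((Equiv.ofBijective _ d.s_star_bijective).trans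
    (Equiv.ofBijective _ (d.t_star_bijective h)).symm).trans e, fun c c' hc => ?_⟩
  have h' : (Equiv.ofBijective _ (d.t_star_bijective h)).symm (M.s.app _ c) = c' :=
    (Equiv.symm_apply_eq _).2 hc
  exact congrArg e h'

/-- Transport of names of channels along an action that creates a channel. -/
theorem ActionData.exists_names_nu {n : ℕ} {X Y : Position} {M : Cospan Y.diagram X.diagram}
    (d : ActionData (.act (.nu n)) M) {γ : Finset ℕ} (e : el X.diagram .star ≃ {c // c ∈ γ})
    {a : ℕ} (ha : a ∉ γ) :
    ∃ e' : el Y.diagram .star ≃ {c // c ∈ insert a γ},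
      (∀ c c', M.s.app _ c = M.t.app _ c' → (e' c).1 = (e c').1) ∧
      ∀ c, M.s.app _ c = d.newChan → (e' c).1 = a := by
  classical
  -- The names from `γ` denote the initial channels through `e`, and the fresh name `a` denotes the
  -- created one. The required naming is the final leg followed by the inverse of this bijection.
  let g : {c // c ∈ insert a γ} → el M.mid .star := fun c =>
    if h : c.1 ∈ γ then M.t.app _ (e.symm ⟨c.1, h⟩) else d.newChan
  have hg (c : el X.diagram .star) : g ⟨(e c).1, Finset.mem_insert_of_mem (e c).2⟩ =
      M.t.app _ c := by
    simp only [g, (e c).2, dif_pos]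
    rw [Equiv.symm_apply_apply]
  have hga : g ⟨a, Finset.mem_insert_self a γ⟩ = d.newChan := dif_neg ha
  have hgb : Function.Bijective g := by
    constructor
    · rintro ⟨c, hc⟩ ⟨c', hc'⟩ h
      by_cases h₁ : c ∈ γ <;> by_cases h₂ : c' ∈ γ
      · simp only [g, h₁, h₂, dif_pos] at h
        have h := congrArg Subtype.val (e.symm.injective (d.t_star_injective h))
        exact Subtype.ext h
      · simp only [g, h₁, h₂, dif_pos, dif_neg, not_false_eq_true] at h
        exact (d.t_ne_newChan _ h).elim
      · simp only [g, h₁, h₂, dif_pos, dif_neg, not_false_eq_true] at h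
        exact (d.t_ne_newChan _ h.symm).elim
      · exact Subtype.ext (((Finset.mem_insert.1 hc).resolve_right h₁).trans
          ((Finset.mem_insert.1 hc').resolve_right h₂).symm)
    · intro c
      rcases d.t_or_newChan c with ⟨x, rfl⟩ | rfl
      · exact ⟨_, hg x⟩
      · exact ⟨_, hga⟩
  refine ⟨(Equiv.ofBijective _ d.s_star_bijective).trans (Equiv.ofBijective g hgb).symm,
    fun c c' h => ?_, fun c h => ?_⟩
  · have h' : (Equiv.ofBijective g hgb).symm (M.s.app _ c) = _ :=
      (Equiv.symm_apply_eq _).2 (h.trans (hg c').symm)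
    exact congrArg Subtype.val h'
  · have h' : (Equiv.ofBijective g hgb).symm (M.s.app _ c) = _ :=
      (Equiv.symm_apply_eq _).2 (h.trans hga.symm)
    exact congrArg Subtype.val h'

/-! ### Multisets of agents -/

/-- Agents of a diagram. -/
abbrev Ag (P : Diagram) : Type := Σ n : ℕ, el P (.ag n)

/-- The action of a map of diagrams on agents. -/
abbrev Ag.map (f : P ⟶ Q) (a : Ag P) : Ag Q := ⟨a.1, f.app _ a.2⟩

/-- The multiset of values of a function on a finite type. -/
def values {A β : Type*} (f : A → β) : Multiset β :=
  -- The value 0 on infinite types is a default: all sets of agents considered are finite.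
  open Classical in if h : Finite A then (@Finset.univ A (@Fintype.ofFinite A h)).val.map f else 0

theorem values_eq {A β : Type*} [i : Fintype A] (f : A → β) :
    values f = Finset.univ.val.map f := by
  rw [values, dif_pos (Finite.of_fintype A)]
  congr!

theorem values_sum {A B C β : Type*} [Finite A] [Finite B] {u : A → C} {v : B → C}
    (h : Function.Bijective (Sum.elim u v)) (f : C → β) :
    values f = values (f ∘ u) + values (f ∘ v) := by
  have := Fintype.ofFinite A
  have := Fintype.ofFinite B
  have := Fintype.ofBijective _ h
  rw [values_eq, values_eq, values_eq, ← Finset.map_univ_equiv (Equiv.ofBijective _ h),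
    Finset.map_val, Multiset.map_map, ← Finset.univ_disjSum_univ]
  change Multiset.map _ (Multiset.map Sum.inl _ + Multiset.map Sum.inr _) = _
  rw [Multiset.map_add, Multiset.map_map, Multiset.map_map]
  rfl

theorem values_unique {A β : Type*} (f : A → β) (a : A) (h : ∀ b, b = a) : values f = {f a} := by
  have : Unique A := ⟨⟨a⟩, h⟩
  rw [values_eq, Finset.univ_unique, h default]
  rfl

theorem IsPosition.finite_ag (h : IsPosition P) : Finite (Ag P) := by
  have := h.finite
  refine Finite.of_injective (fun a : Ag P => (⟨.ag a.1, a.2⟩ : Σ c : Vertex, el P c)) ?_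
  rintro ⟨n, a⟩ ⟨m, b⟩ h
  cases h
  rfl

/-- With no agents in `A`, the pushout is a disjoint union in this dimension. This applies to
interfaces and to the spans that define the positions of seeds, and `values_sum` turns it into a sum
of multisets. -/
theorem ag_bijective {A B C D : Diagram} {f : A ⟶ B} {g : A ⟶ C} {h : B ⟶ D} {k : C ⟶ D}
    (sq : IsPushout f g h k) (he : ∀ n, IsEmpty (el A (.ag n))) :
    Function.Bijective (Sum.elim (Ag.map h) (Ag.map k)) := by
  refine ⟨?_, ?_⟩
  · rintro (⟨n, x⟩ | ⟨n, x⟩) (⟨m, y⟩ | ⟨m, y⟩) e <;>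
      obtain ⟨rfl, e⟩ := Sigma.mk.inj_iff.1 e <;> replace e := eq_of_heq e
    · exact congrArg (fun x : el B (.ag n) => (Sum.inl ⟨n, x⟩ : Ag B ⊕ Ag C))
        (pushout_inr_injective sq.flip (fun a => (he n).elim a) e)
    · exact (pushout_ne sq (he n) _ _ e).elim
    · exact (pushout_ne sq (he n) _ _ e.symm).elim
    · exact congrArg (fun x : el C (.ag n) => (Sum.inr ⟨n, x⟩ : Ag B ⊕ Ag C))
        (pushout_inr_injective sq (fun a => (he n).elim a) e)
  · rintro ⟨n, x⟩
    rcases el_eq_or_eq sq x with ⟨y, rfl⟩ | ⟨y, rfl⟩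
    · exact ⟨.inl ⟨n, y⟩, rfl⟩
    · exact ⟨.inr ⟨n, y⟩, rfl⟩

theorem ag_ind {n : ℕ} (a : Ag (ind n)) : a = ⟨n, gen (.ag n)⟩ := by
  obtain ⟨k, a⟩ := a
  obtain ⟨rfl, rfl⟩ := el_ind a
  rfl

theorem isEmpty_rep_star (n : ℕ) : IsEmpty (el (rep .star) (.ag n)) :=
  ⟨fun f => nomatch (hom_star f).1⟩

theorem isEmpty_ports (k n : ℕ) : IsEmpty (el (∐ fun _ : Fin k => rep .star) (.ag n)) := by
  refine ⟨fun z => ?_⟩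
  have hc := isColimitOfPreserves ((evaluation Baseᵒᵖ Type).obj (op (Vertex.ag n).ob))
    (colimit.isColimit (Discrete.functor fun _ : Fin k => rep Vertex.star))
  obtain ⟨⟨x⟩, g, hg⟩ := Types.jointly_surjective _ hc z
  exact (isEmpty_rep_star n).elim g

theorem isEmpty_coprod (n : ℕ) : IsEmpty (el (rep .star ⨿ rep .star) (.ag n)) := by
  refine ⟨fun z => ?_⟩
  have hc := isColimitOfPreserves ((evaluation Baseᵒᵖ Type).obj (op (Vertex.ag n).ob))
    (colimit.isColimit (pair (rep Vertex.star) (rep Vertex.star)))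
  obtain ⟨⟨_ | _⟩, g, hg⟩ := Types.jointly_surjective _ hc z <;> exact (isEmpty_rep_star n).elim g

theorem ag_twin (n : ℕ) :
    Function.Bijective (Sum.elim (Ag.map (twinL n)) (Ag.map (twinR n))) :=
  ag_bijective (IsPushout.of_hasPushout _ _) (isEmpty_ports n)

theorem ag_link (m : ℕ) (c : Fin m) (n : ℕ) (a : Fin n) :
    Function.Bijective (Sum.elim (Ag.map (linkL m c n a)) (Ag.map (linkR m c n a))) :=
  ag_bijective (IsPushout.of_hasPushout _ _) isEmpty_rep_star

theorem ag_link₂ (m : ℕ) (c d : Fin m) (n : ℕ) (a e : Fin n) :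
    Function.Bijective (Sum.elim (Ag.map (link₂L m c d n a e)) (Ag.map (link₂R m c d n a e))) :=
  ag_bijective (IsPushout.of_hasPushout _ _) isEmpty_coprod

theorem values_ind {β : Type*} {n : ℕ} (f : Ag (ind n) → β) : values f = {f ⟨n, gen (.ag n)⟩} :=
  values_unique f _ ag_ind

theorem values_pair {β : Type*} {n m : ℕ} {f : ind n ⟶ P} {g : ind m ⟶ P}
    (h : Function.Bijective (Sum.elim (Ag.map f) (Ag.map g))) (φ : Ag P → β) :
    values φ = {φ ⟨n, f.app _ (gen (.ag n))⟩, φ ⟨m, g.app _ (gen (.ag m))⟩} := by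
  have := (isPosition_ind n).finite_ag
  have := (isPosition_ind m).finite_ag
  rw [values_sum h, values_ind, values_ind]
  rfl

/-- Families on agents are determined by their components on a decomposition. -/
theorem exists_glue {A B C : Type*} {u : A → C} {v : B → C} {β : C → Type*}
    (h : Function.Bijective (Sum.elim u v)) (F : ∀ a, β (u a)) (G : ∀ b, β (v b)) :
    ∃ H : ∀ c, β c, (∀ a, H (u a) = F a) ∧ ∀ b, H (v b) = G b := by
  -- Quantifying over all preimages of `c` absorbs the transports; bijectivity leaves only one
  -- preimage to treat.
  have key (c : C) : ∃ x : β c, (∀ (a : A) (e : u a = c), x = e ▸ F a) ∧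
      ∀ (b : B) (e : v b = c), x = e ▸ G b := by
    obtain ⟨a | b, rfl⟩ := h.2 c
    · refine ⟨F a, fun a' e => ?_, fun b e => ?_⟩
      · obtain rfl : a' = a := Sum.inl_injective (h.1 e)
        rfl
      · exact nomatch (h.1 e : Sum.inr b = Sum.inl a)
    · refine ⟨G b, fun a e => ?_, fun b' e => ?_⟩
      · exact nomatch (h.1 e : Sum.inl a = Sum.inr b)
      · obtain rfl : b' = b := Sum.inr_injective (h.1 e)
        rfl
  choose H hH using key
  exact ⟨H, fun a => (hH _).1 a rfl, fun b => (hH _).2 b rfl⟩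

theorem exists_glue_ind {n : ℕ} {β : Ag (ind n) → Type*} (x : β ⟨n, gen (.ag n)⟩) :
    ∃ F : ∀ a, β a, F ⟨n, gen (.ag n)⟩ = x := by
  have key (a : Ag (ind n)) : ∃ y : β a, ∀ e : ⟨n, gen (.ag n)⟩ = a, y = e ▸ x := by
    obtain rfl := ag_ind a
    exact ⟨x, fun _ => rfl⟩
  choose F hF using key
  exact ⟨F, hF _ rfl⟩

/-! ### Ports of the final agents of actions -/

namespace ActionData

variable {σ : Seed} {Y X : Diagram} {u : Cospan Y X} (d : ActionData σ u)

theorem s_eq_src {p n : ℕ} {b : Basic p n} {e : el σ.cospan.mid (.act b)} {f : el σ.final (.ag p)}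
    (hs : (Edge.src b).act _ e = σ.cospan.s.app _ f) :
    u.s.app _ (d.y.app _ f) = (Edge.src b).act _ (d.μ.app _ e) := by
  rw [d.s_y, ← hs, Edge.act_app]

theorem t_eq_tgt {p n : ℕ} {b : Basic p n} {e : el σ.cospan.mid (.act b)} {a : el σ.init (.ag n)}
    (ht : (Edge.tgt b).act _ e = σ.cospan.t.app _ a) :
    u.t.app _ (d.x.app _ a) = (Edge.tgt b).act _ (d.μ.app _ e) := by
  rw [d.t_x, ← ht, Edge.act_app]

theorem port_final {p n : ℕ} {b : Basic p n} {e : el σ.cospan.mid (.act b)}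
    {f : el σ.final (.ag p)} {a : el σ.init (.ag n)}
    (hs : (Edge.src b).act _ e = σ.cospan.s.app _ f)
    (ht : (Edge.tgt b).act _ e = σ.cospan.t.app _ a) (i : Fin n) :
    u.s.app _ ((Edge.port p (Fin.castLE b.le i)).act _ (d.y.app _ f)) =
      u.t.app _ ((Edge.port n i).act _ (d.x.app _ a)) :=
  s_port (d.s_eq_src hs) (d.t_eq_tgt ht) i

end ActionData

section Ports

variable {Y X : Diagram} {u : Cospan Y X}

theorem port_act {p n : ℕ} {b : Basic p n} (d : ActionData (.act b) u) (i : Fin n) :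
    u.s.app _ ((Edge.port p (Fin.castLE b.le i)).act _ (d.y.app _ (gen (.ag p)))) =
      u.t.app _ ((Edge.port n i).act _ (d.x.app _ (gen (.ag n)))) :=
  d.port_final (e := gen (.act b)) ((Edge.act_gen _).trans (Edge.rep_gen _).symm)
    ((Edge.act_gen _).trans (Edge.rep_gen _).symm) i

theorem port_newChan {n : ℕ} (d : ActionData (.act (.nu n)) u) :
    u.s.app _ ((Edge.port (n + 1) (Fin.last n)).act _ (d.y.app _ (gen (.ag (n + 1))))) =
      d.newChan := by
  rw [Edge.act_app, d.s_eq_src (e := gen (.act (.nu n)))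
    ((Edge.act_gen _).trans (Edge.rep_gen _).symm)]
  rfl

theorem port_forkL {n : ℕ} (d : ActionData (.fork n) u) (i : Fin n) :
    u.s.app _ ((Edge.port n i).act _ (d.y.app _ ((twinL n).app _ (gen (.ag n))))) =
      u.t.app _ ((Edge.port n i).act _ (d.x.app _ (gen (.ag n)))) :=
  d.port_final (forkCospan_s_inl n).symm (forkCospan_t_left n).symm i

theorem port_forkR {n : ℕ} (d : ActionData (.fork n) u) (i : Fin n) :
    u.s.app _ ((Edge.port n i).act _ (d.y.app _ ((twinR n).app _ (gen (.ag n))))) =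
      u.t.app _ ((Edge.port n i).act _ (d.x.app _ (gen (.ag n)))) :=
  d.port_final (forkCospan_s_inr n).symm (forkCospan_t_right n).symm i

variable {n : ℕ} {a : Fin n} {m : ℕ} {c e : Fin m} (d : ActionData (.sync n a m c e) u)

theorem port_syncL (i : Fin m) :
    u.s.app _ ((Edge.port m i).act _ (d.y.app _
        ((link₂L m c e _ (Fin.castSucc a) (Fin.last n)).app _ (gen (.ag m))))) =
      u.t.app _ ((Edge.port m i).act _ (d.x.app _ ((linkL m c n a).app _ (gen (.ag m))))) :=
  d.port_final (syncCospan_s_inl n a m c e).symm (syncCospan_t_inl n a m c e).symm i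

theorem port_syncR (i : Fin n) :
    u.s.app _ ((Edge.port (n + 1) (Fin.castSucc i)).act _ (d.y.app _
        ((link₂R m c e _ (Fin.castSucc a) (Fin.last n)).app _ (gen (.ag (n + 1)))))) =
      u.t.app _ ((Edge.port n i).act _ (d.x.app _ ((linkR m c n a).app _ (gen (.ag n))))) :=
  d.port_final (syncCospan_s_inr n a m c e).symm (syncCospan_t_inr n a m c e).symm i

/-- This is the object equation of the synchronisation, transported along `d.μ`: the receiver's new
channel is the one sent. -/
theorem port_syncR_last :
    u.s.app _ ((Edge.port (n + 1) (Fin.last n)).act _ (d.y.app _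
        ((link₂R m c e _ (Fin.castSucc a) (Fin.last n)).app _ (gen (.ag (n + 1)))))) =
      u.t.app _ ((Edge.port m e).act _ (d.x.app _ ((linkL m c n a).app _ (gen (.ag m))))) := by
  refine Eq.trans ?_ (port_syncL d e)
  rw [Edge.act_app, Edge.act_app, d.s_eq_src (syncCospan_s_inr n a m c e).symm,
    d.s_eq_src (syncCospan_s_inl n a m c e).symm]
  have h₁ := Edge.act_app d.μ (Edge.rho n a m c e) (gen (.sync n a m c e))
  have h₂ := Edge.act_app d.μ (Edge.eps n a m c e) (gen (.sync n a m c e))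
  exact (congrArg (fun z => (Edge.port (n + 1) (Fin.last n)).act u.mid
    ((Edge.src (.inp n a)).act u.mid z)) h₁).trans ((Edge.act_object n a m c e _).trans
    (congrArg (fun z => (Edge.port m e).act u.mid ((Edge.src (.out m c e)).act u.mid z)) h₂.symm))

end Ports

/-! ### Items of a vertex -/

/-- The item of an agent. -/
def SVertex.item (x : SVertex) (a : Ag x.pos.diagram) : Item x.pos.chan :=
  ⟨a.1, ⟨x.beh.el a.2, x.definite _⟩, fun i => (Edge.port a.1 i).act x.pos.diagram a.2⟩

/-- The agents of a position are those of its diagram. -/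
def Position.agEquiv (X : Position) : X.Agent ≃ Ag X.diagram where
  toFun a := ⟨a.1.1, (⟨a.1.2, a.2⟩ : X.elems (.ag a.1.1))⟩
  invFun a := X.agent a.2
  left_inv _ := rfl
  right_inv _ := rfl

instance (X : Position) : Finite (Ag X.diagram) := Finite.of_equiv _ X.agEquiv

/-- Reindexes agents by elements of the diagram, where decompositions along pushouts are available.
-/
theorem mixed_items (x : SVertex) : (mixed x).items = values x.item := by
  have := Fintype.ofFinite (Ag x.pos.diagram)
  rw [values_eq, ← Finset.map_univ_equiv x.pos.agEquiv, Finset.map_val, Multiset.map_map,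
    Finset.univ_eq_attach]
  rfl

/-- Items that agree up to isomorphism of behaviours and renaming of channels. -/
def ItemRel {γ γ' : Finset ℕ} (e : {c // c ∈ γ} → {c // c ∈ γ'}) (I : Item γ) (J : Item γ') :
    Prop :=
  ∃ D : DefBeh I.arity, Nonempty (I.beh.1 ≅ D.1) ∧ J = ⟨I.arity, D, fun i => e (I.sub i)⟩

theorem itemRel_id {γ : Finset ℕ} (I : Item γ) : ItemRel id I I := ⟨I.beh, ⟨Iso.refl _⟩, rfl⟩

theorem itemRel_item {y : SVertex} {γ : Finset ℕ} {e : {c // c ∈ y.pos.chan} → {c // c ∈ γ}}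
    {p : ℕ} {f : el y.pos.diagram (.ag p)} {D : DefBeh p} (i : Nonempty (y.beh.el f ≅ D.1))
    {ρ : Fin p → {c // c ∈ γ}}
    (h : ∀ i, e ((Edge.port p i).act y.pos.diagram f) = ρ i) :
    ItemRel e (y.item ⟨p, f⟩) ⟨p, D, ρ⟩ := by
  obtain rfl : _ = ρ := funext h
  exact ⟨D, i, rfl⟩

/-- A vertex of `𝕊` and a mixed behaviour agree up to isomorphism and renaming of channels. -/
def Matches (x : SVertex) (N : Mixed) : Prop :=
  ∃ e : {c // c ∈ x.pos.chan} ≃ {c // c ∈ N.chan},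
    Multiset.Rel (ItemRel e) (values x.item) N.items

theorem matches_mixed (x : SVertex) : Matches x (mixed x) := by
  refine ⟨Equiv.refl _, ?_⟩
  rw [mixed_items]
  exact Multiset.rel_refl_of_refl_on fun I _ => itemRel_id I

theorem rel_singleton_left {α β : Type*} {r : α → β → Prop} {a : α} {S : Multiset β} :
    Multiset.Rel r {a} S ↔ ∃ b, r a b ∧ S = {b} := by
  rw [← Multiset.cons_zero, Multiset.rel_cons_left]
  simp only [Multiset.rel_zero_left]
  constructor
  · rintro ⟨b, s, h, rfl, rfl⟩
    exact ⟨b, h, rfl⟩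
  · rintro ⟨b, h, rfl⟩
    exact ⟨b, 0, h, rfl, rfl⟩

theorem rel_pair_left {α β : Type*} {r : α → β → Prop} {a a' : α} {S : Multiset β} :
    Multiset.Rel r {a, a'} S ↔ ∃ b b', r a b ∧ r a' b' ∧ S = {b, b'} := by
  rw [Multiset.insert_eq_cons, Multiset.rel_cons_left]
  constructor
  · rintro ⟨b, s, h, hs, rfl⟩
    obtain ⟨b', h', rfl⟩ := rel_singleton_left.1 hs
    exact ⟨b, b', h, h', rfl⟩
  · rintro ⟨b, b', h, h', rfl⟩
    exact ⟨b, {b'}, h, rel_singleton_left.2 ⟨b', h', rfl⟩, rfl⟩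

/-- Passage from the residuals of 𝕊, known up to isomorphism, to the strict `D.next b k` of 𝕄: the
state `k` is transported along the isomorphism. -/
theorem exists_next {p n : ℕ} {b : Basic p n} {B : IndBeh n} {D : DefBeh n}
    (i : Nonempty (B ≅ D.1)) {B' : IndBeh p} (h : B.Next b.view B') :
    ∃ k : D.after b, Nonempty (B' ≅ (D.next b k).1) :=
  h.congr i.some (Iso.refl _)

/-! ### Items along an action -/

section

variable {σ : Seed} {Y X : Diagram} {u : Cospan Y X} (d : ActionData σ u)

theorem ActionData.values_x {β : Type*} (f : Ag X → β) :
    values f = values (f ∘ Ag.map d.zx) + values (f ∘ Ag.map d.x) := by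
  rw [add_comm]
  have := σ.isPosition_init.finite_ag
  have := d.isPosition.finite_ag
  exact values_sum (ag_bijective d.sqX fun _ => isEmpty_interface (ag_dim_pos _)) f

theorem ActionData.values_y {β : Type*} (f : Ag Y → β) :
    values f = values (f ∘ Ag.map d.zy) + values (f ∘ Ag.map d.y) := by
  rw [add_comm]
  have := σ.isPosition_final.finite_ag
  have := d.isPosition.finite_ag
  exact values_sum (ag_bijective d.sqY fun _ => isEmpty_interface (ag_dim_pos _)) f

end

section

variable {σ : Seed} {x y : SVertex} {M : Cospan y.pos.diagram x.pos.diagram} (d : ActionData σ M)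
  {γ γ' : Finset ℕ} {e : {c // c ∈ x.pos.chan} → {c // c ∈ γ}}
  {e' : {c // c ∈ y.pos.chan} → {c // c ∈ γ'}}

/-- The items of the passive agents do not change. -/
theorem ActionData.rel_passive (hγ : γ ⊆ γ')
    (he : ∀ (c : el y.pos.diagram .star) (c' : el x.pos.diagram .star),
      M.s.app _ c = M.t.app _ c' → (e' c).1 = (e c').1)
    (hZ : ∀ (p : ℕ) (z : el d.Z (.ag p)),
      Nonempty (y.beh.el (d.zy.app _ z) ≅ x.beh.el (d.zx.app _ z)))
    {T : Multiset (Item γ)} (hT : Multiset.Rel (ItemRel e) (values (x.item ∘ Ag.map d.zx)) T) :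
    Multiset.Rel (ItemRel e') (values (y.item ∘ Ag.map d.zy)) (T.map (Item.weaken hγ)) := by
  have := d.isPosition.finite_ag
  have := Fintype.ofFinite (Ag d.Z)
  rw [values_eq, Multiset.rel_map_left] at hT
  rw [values_eq, Multiset.rel_map]
  refine hT.mono ?_
  rintro ⟨p, z⟩ - I - ⟨D, ⟨i⟩, rfl⟩
  obtain ⟨i'⟩ := hZ p z
  exact itemRel_item ⟨i' ≪≫ i⟩ fun k => Subtype.ext (he _ _ (d.s_port_zy z k))

end

theorem itemRel_snoc {y : SVertex} {γ : Finset ℕ} {e : {c // c ∈ y.pos.chan} → {c // c ∈ γ}}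
    {n : ℕ} {f : el y.pos.diagram (.ag (n + 1))} {D : DefBeh (n + 1)}
    (i : Nonempty (y.beh.el f ≅ D.1)) {ρ : Fin n → {c // c ∈ γ}} {a : {c // c ∈ γ}}
    (h : ∀ i, e ((Edge.port (n + 1) (Fin.castSucc i)).act y.pos.diagram f) = ρ i)
    (h' : e ((Edge.port (n + 1) (Fin.last n)).act y.pos.diagram f) = a) :
    ItemRel e (y.item ⟨n + 1, f⟩) ⟨n + 1, D, Fin.snoc (α := fun _ => {c // c ∈ γ}) ρ a⟩ := by
  refine itemRel_item i fun j => ?_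
  induction j using Fin.lastCases with
  | cast j => rw [Fin.snoc_castSucc, h]
  | last => rw [Fin.snoc_last, h']

/-- Edges of `𝕊` are matched by edges of `𝕄`. -/
theorem Matches.exists_mStep {x y : SVertex} {N : Mixed} {α : Label} (hx : Matches x N)
    (h : SStep α x y) : ∃ N', MStep α N N' ∧ Matches y N' := by
  cases h with
  | refl => exact ⟨N, .refl N, hx⟩
  | @action _ _ _ σ hσ M hM h =>
    obtain ⟨d⟩ := hM.data
    rw [sResidue_iff d _ x.definite] at h
    obtain ⟨γ, S⟩ := N
    obtain ⟨e, he⟩ : ∃ e : {c // c ∈ x.pos.chan} ≃ {c // c ∈ γ},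
      Multiset.Rel (ItemRel e) (values x.item) S := hx
    -- Splits the mixed behaviour into a context `T` matching the passive agents and a part `S₀`
    -- matching the agents of the seed; the rule for `S₀` is then applied in context `T`.
    rw [d.values_x, Multiset.rel_add_left] at he
    obtain ⟨T, S₀, hT, hS₀, rfl⟩ := he
    have hZ (p : ℕ) (z : el d.Z (.ag p)) :=
      (d.agentResidue_passive x.beh z _).1 (h p (d.zy.app _ z))
    have hT' {γ' : Finset ℕ} (hγ : γ ⊆ γ') (e' : {c // c ∈ y.pos.chan} → {c // c ∈ γ'}) he' :=
      d.rel_passive (e' := e') hγ he' hZ hT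
    cases hσ with
    | tick n =>
      rw [values_ind, rel_singleton_left] at hS₀
      obtain ⟨_, ⟨D, i, rfl⟩, rfl⟩ := hS₀
      obtain ⟨k, hk⟩ := exists_next i ((agentResidue_act x.beh d _).1 (h _ _))
      obtain ⟨e', he'⟩ := d.exists_names (Seed.t_star_surjective_act _) e
      refine ⟨_, .context T subset_rfl (.tick D _ k), e', ?_⟩
      rw [d.values_y, values_ind]
      refine (hT' _ _ fun c c' hc => congrArg Subtype.val (he' c c' hc)).add
        (rel_singleton_left.2 ⟨_, itemRel_item hk fun j => he' _ _ (port_act d j), rfl⟩)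
    | tau n =>
      rw [values_ind, rel_singleton_left] at hS₀
      obtain ⟨_, ⟨D, i, rfl⟩, rfl⟩ := hS₀
      obtain ⟨k, hk⟩ := exists_next i ((agentResidue_act x.beh d _).1 (h _ _))
      obtain ⟨e', he'⟩ := d.exists_names (Seed.t_star_surjective_act _) e
      refine ⟨_, .context T subset_rfl (.tau D _ k), e', ?_⟩
      rw [d.values_y, values_ind]
      refine (hT' _ _ fun c c' hc => congrArg Subtype.val (he' c c' hc)).add
        (rel_singleton_left.2 ⟨_, itemRel_item hk fun j => he' _ _ (port_act d j), rfl⟩)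
    | nu n =>
      rw [values_ind, rel_singleton_left] at hS₀
      obtain ⟨_, ⟨D, i, rfl⟩, rfl⟩ := hS₀
      obtain ⟨k, hk⟩ := exists_next i ((agentResidue_act x.beh d _).1 (h _ _))
      -- Any fresh name will do, because `Matches` allows the channels to be renamed.
      obtain ⟨a, ha⟩ := Infinite.exists_notMem_finset γ
      obtain ⟨e', he', hnew⟩ := d.exists_names_nu e ha
      refine ⟨_, .context T (Finset.subset_insert _ _) (.nu D _ k a ha), e', ?_⟩
      rw [d.values_y, values_ind]
      refine (hT' _ _ he').add
        (rel_singleton_left.2 ⟨_, itemRel_snoc hk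
          (fun j => Subtype.ext (a2 := ⟨_, Finset.mem_insert_of_mem (e _).2⟩)
            (he' _ _ (port_act d j))) (Subtype.ext (hnew _ (port_newChan d))), rfl⟩)
    | fork n =>
      rw [values_ind, rel_singleton_left] at hS₀
      obtain ⟨_, ⟨D, i, rfl⟩, rfl⟩ := hS₀
      obtain ⟨k, hk⟩ := exists_next i ((agentResidue_forkL x.beh d _).1 (h _ _))
      obtain ⟨l, hl⟩ := exists_next i ((agentResidue_forkR x.beh d _).1 (h _ _))
      obtain ⟨e', he'⟩ := d.exists_names (Seed.t_star_surjective_fork _) e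
      refine ⟨_, .context T subset_rfl (.fork D _ k l), e', ?_⟩
      rw [d.values_y, values_pair (ag_twin n)]
      exact (hT' _ _ fun c c' hc => congrArg Subtype.val (he' c c' hc)).add
        (rel_pair_left.2 ⟨_, _, itemRel_item hk fun j => he' _ _ (port_forkL d j),
          itemRel_item hl fun j => he' _ _ (port_forkR d j), rfl⟩)
    | sync n a m c o =>
      rw [values_pair (ag_link m c n a), rel_pair_left] at hS₀
      obtain ⟨_, _, ⟨D, i, rfl⟩, ⟨D', i', rfl⟩, rfl⟩ := hS₀
      obtain ⟨k, hk⟩ := exists_next i ((agentResidue_syncL x.beh d _).1 (h _ _))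
      obtain ⟨l, hl⟩ := exists_next i' ((agentResidue_syncR x.beh d _).1 (h _ _))
      obtain ⟨e', he'⟩ := d.exists_names (Seed.t_star_surjective_sync _ _ _ _ _) e
      -- The seed lists the sender first, the rule of 𝕄 the receiver first.
      rw [Multiset.pair_comm]
      refine ⟨_, .context T subset_rfl (.sync D' _ D _ a c o l k ?_), e', ?_⟩
      -- The side condition of the rule holds because the initial position of the seed glues port
      -- `c` of the sender to port `a` of the receiver.
      · refine congrArg e ?_
        have hc := congrArg (fun z => d.x.app _ z)
          (port_condition (pushout.condition (f := (Edge.port m c).rep) (g := (Edge.port n a).rep)))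
        exact (Edge.act_app d.x _ _).symm.trans (hc.symm.trans (Edge.act_app d.x _ _))
      rw [d.values_y, values_pair (ag_link₂ _ _ _ _ _ _),
        Multiset.pair_comm (α := Item y.pos.chan)]
      exact (hT' _ _ fun c c' hc => congrArg Subtype.val (he' c c' hc)).add
        (rel_pair_left.2 ⟨_, _, itemRel_snoc hl (fun j => he' _ _ (port_syncR d j))
          (he' _ _ (port_syncR_last d)), itemRel_item hk fun j => he' _ _ (port_syncL d j), rfl⟩)

/-! ### Construction of positions and actions -/

theorem isIso_of_bijective (f : P ⟶ Q)
    (h : ∀ c : Vertex, Function.Bijective (f.app (op c.ob))) : IsIso f := by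
  have (c : Baseᵒᵖ) : IsIso (f.app c) := (isIso_iff_bijective _).2 (h c.unop.as)
  exact NatIso.isIso_of_isIso_app f

/-- The numbering of channels of a position obtained by naming the elements of a finite diagram. -/
theorem IsPosition.exists_position (hP : IsPosition P) :
    ∃ X : Position, Nonempty (X.diagram ≅ P) := by
  classical
  have hag := hP.finite_ag
  have hstar : Finite (el P .star) := by
    have := hP.finite
    exact Finite.of_injective (fun x => (⟨.star, x⟩ : Σ c : Vertex, el P c))
      fun x y h => eq_of_heq (Sigma.mk.inj_iff.1 h).2
  have := Fintype.ofFinite (Ag P)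
  have := Fintype.ofFinite (el P .star)
  -- Finiteness provides numberings of channels and agents; an agent is then named by its arity and
  -- its number.
  obtain ⟨φ, hφ⟩ := exists_injective_nat (el P .star)
  obtain ⟨ψ, hψ⟩ := exists_injective_nat (Ag P)
  let chan : Finset ℕ := Finset.univ.image φ
  let agents : Finset (ℕ × ℕ) := Finset.univ.image fun a : Ag P => (a.1, ψ a)
  have hchan (c : {c // c ∈ chan}) : ∃ x : el P .star, φ x = c.1 := by
    obtain ⟨x, -, h⟩ := Finset.mem_image.1 c.2
    exact ⟨x, h⟩
  have hagents (n k : ℕ) (h : (n, k) ∈ agents) : ∃ x : el P (.ag n), ψ ⟨n, x⟩ = k := by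
    obtain ⟨⟨m, x⟩, -, h⟩ := Finset.mem_image.1 h
    cases h
    exact ⟨x, rfl⟩
  choose xc hxc using hchan
  choose xa hxa using hagents
  let X : Position := ⟨chan, agents, fun a i => ⟨φ ((Edge.port a.1.1 i).act P (xa _ _ a.2)),
    Finset.mem_image_of_mem φ (Finset.mem_univ _)⟩⟩
  let f : ∀ c : Vertex, X.elems c → el P c
    | .star => xc
    | .ag n => fun k => xa n k.1 k.2
    | .act _ => PEmpty.elim
    | .fork _ => PEmpty.elim
    | .sync _ _ _ _ _ => PEmpty.elim
  let F : X.diagram ⟶ P := Diagram.homMk f (by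
    rintro a b (_ | _ | _ | _ | _ | _ | _) x <;> try exact x.elim
    exact hφ (hxc _))
  refine ⟨X, ⟨@asIso _ _ _ _ F (isIso_of_bijective F fun c => ?_)⟩⟩
  have hempty {c : Vertex} (hc : 1 < c.dim) (hX : IsEmpty (X.elems c)) :
      Function.Bijective (f c) :=
    ⟨fun x => hX.elim x, fun x => absurd (hP.dim_le c ⟨x⟩) hc.not_ge⟩
  change Function.Bijective (f c)
  cases c with
  | star =>
    refine ⟨fun x y h => Subtype.ext ?_, fun x => ⟨⟨φ x,
      Finset.mem_image_of_mem φ (Finset.mem_univ _)⟩, hφ (hxc _)⟩⟩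
    rw [← hxc x, ← hxc y]
    exact congrArg φ h
  | ag n =>
    refine ⟨fun x y h => Subtype.ext ?_, fun x => ⟨⟨ψ ⟨n, x⟩,
      Finset.mem_image_of_mem (fun a : Ag P => (a.1, ψ a)) (Finset.mem_univ (⟨n, x⟩ : Ag P))⟩, ?_⟩⟩
    · exact (hxa n _ x.2).symm.trans ((congrArg (fun z => ψ ⟨n, z⟩) h).trans (hxa n _ y.2))
    · exact eq_of_heq (Sigma.mk.inj_iff.1 (hψ (hxa n _ _))).2
  | act b => exact hempty (by simp [Vertex.dim]) (inferInstanceAs (IsEmpty PEmpty))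
  | fork n => exact hempty (by simp [Vertex.dim]) (inferInstanceAs (IsEmpty PEmpty))
  | sync n a m c d => exact hempty (by simp [Vertex.dim]) (inferInstanceAs (IsEmpty PEmpty))

theorem Position.isEmpty_el (X : Position) {c : Vertex} (hc : 1 < c.dim) :
    IsEmpty (el X.diagram c) := by
  cases c with
  | star => exact absurd hc (by decide)
  | ag n => exact absurd hc (lt_irrefl 1)
  | act b => exact inferInstanceAs (IsEmpty PEmpty)
  | fork n => exact inferInstanceAs (IsEmpty PEmpty)
  | sync n a m c d => exact inferInstanceAs (IsEmpty PEmpty)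

theorem Position.isPosition (X : Position) : IsPosition X.diagram := by
  refine ⟨?_, fun c ⟨x⟩ => ?_⟩
  · let φ : {c // c ∈ X.chan} ⊕ Ag X.diagram → Σ c : Vertex, el X.diagram c :=
      Sum.elim (fun c => ⟨.star, (c : X.elems .star)⟩) fun a => ⟨.ag a.1, a.2⟩
    refine Finite.of_surjective φ ?_
    rintro ⟨c, x⟩
    cases c with
    | star => exact ⟨.inl x, rfl⟩
    | ag n => exact ⟨.inr ⟨n, x⟩, rfl⟩
    | act b => exact PEmpty.elim x
    | fork n => exact PEmpty.elim x
    | sync n a m c d => exact PEmpty.elim x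
  · by_contra h
    exact (X.isEmpty_el (not_le.1 h)).elim x

/-- Checked pointwise: on channels two parallel sides are isomorphisms, and in positive dimensions
the corner `A` is empty and `D` is a disjoint union. -/
theorem isPushout_of_bijective {A B C D : Diagram} {f : A ⟶ B} {g : A ⟶ C} {h : B ⟶ D}
    {k : C ⟶ D} (w : f ≫ h = g ≫ k)
    (hf : Function.Bijective (f.app (op Vertex.star.ob)))
    (hk : Function.Bijective (k.app (op Vertex.star.ob)))
    (he : ∀ c : Vertex, 0 < c.dim → IsEmpty (el A c))
    (hb : ∀ c : Vertex, 0 < c.dim → Function.Bijective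
      (Sum.elim (fun x : el B c => h.app (op c.ob) x) fun x : el C c => k.app (op c.ob) x)) :
    IsPushout f g h k := by
  refine IsPushout.of_forall_isPushout_app fun c => ?_
  obtain ⟨c, rfl⟩ : ∃ V : Vertex, op V.ob = c := ⟨c.unop.as, rfl⟩
  have w' : f.app (op c.ob) ≫ h.app (op c.ob) = g.app (op c.ob) ≫ k.app (op c.ob) :=
    congrArg (fun p => p.app (op c.ob)) w
  by_cases hc : 0 < c.dim
  · have hb := hb c hc
    have he := he c hc
    have hm : Mono (h.app (op c.ob)) := (mono_iff_injective _).2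
      fun x y e => Sum.inl_injective (hb.1 (a₁ := .inl x) (a₂ := .inl y) e)
    have hki : Function.Injective (k.app (op c.ob)) :=
      fun x y e => Sum.inr_injective (hb.1 (a₁ := .inr x) (a₂ := .inr y) e)
    refine Types.isPushout_of_isPullback_of_mono' ((Types.isPullback_iff _ _ _ _).2
      ⟨w', fun x => he.elim x, fun x y e => ?_⟩) ?_ fun x y _ _ e => hki e
    · exact nomatch hb.1 (a₁ := .inl x) (a₂ := .inr y) e
    · refine Set.eq_univ_of_forall fun x => ?_
      obtain ⟨y | y, rfl⟩ := hb.2 x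
      · exact .inl ⟨y, rfl⟩
      · exact .inr ⟨y, rfl⟩
  · have hc : c = .star := by
      cases c with
      | star => rfl
      | _ => exact absurd (by simp [Vertex.dim]) hc
    subst hc
    have : IsIso (f.app (op Vertex.star.ob)) := (isIso_iff_bijective _).2 hf
    have : IsIso (k.app (op Vertex.star.ob)) := (isIso_iff_bijective _).2 hk
    exact IsPushout.of_horiz_isIso ⟨w'⟩

open Classical in
/-- The position obtained by removing some agents. -/
def Position.filter (X : Position) (p : X.Agent → Prop) : Position where
  chan := X.chan
  agents := {a ∈ X.agents | ∃ h : a ∈ X.agents, p ⟨a, h⟩}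
  port a := X.port ⟨a.1, (Finset.mem_filter.1 a.2).1⟩

theorem Position.mem_filter {X : Position} {p : X.Agent → Prop} {a : ℕ × ℕ} :
    a ∈ (X.filter p).agents ↔ ∃ h : a ∈ X.agents, p ⟨a, h⟩ := by
  classical exact Finset.mem_filter.trans ⟨fun h => h.2, fun h => ⟨h.1, h⟩⟩

/-- The inclusion of some agents of a position. -/
def Position.filterMap (X : Position) (p : X.Agent → Prop) :
    (X.filter p).diagram ⟶ X.diagram :=
  Diagram.homMk (P := (X.filter p).diagram) (Q := X.diagram)
    (fun c => match c with
      | .star => fun k => k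
      | .ag _ => fun k => ⟨k.1, (Position.mem_filter.1 k.2).1⟩
      | .act _ => PEmpty.elim
      | .fork _ => PEmpty.elim
      | .sync _ _ _ _ _ => PEmpty.elim)
    (by
      rintro a b (_ | _ | _ | _ | _ | _ | _) x <;> first | exact x.elim | rfl)

/-- Every diagram that is injective on agents and is the initial position of a seed is
the initial part of an action. -/
theorem exists_actionData {σ : Seed} {X : Position} (x : σ.init ⟶ X.diagram)
    (hx : ∀ n, Function.Injective (x.app (op (Vertex.ag n).ob))) :
    ∃ (Y : Position) (M : Cospan Y.diagram X.diagram) (d : ActionData σ M), d.x = x := by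
  -- The context keeps all channels of `X` and drops the agents in the image of `x`; injectivity on
  -- agents then makes `X` a pushout over the interface.
  let Z := X.filter fun a => ¬ ∃ i : el σ.init (.ag a.arity), X.agent (x.app _ i) = a
  let zx : Z.diagram ⟶ X.diagram := X.filterMap _
  let h : interface σ.init ⟶ Z.diagram := Sigma.desc fun c : el σ.init .star =>
    nameOf (P := Z.diagram) (c := .star) (x.app _ c : X.elems .star)
  have hzx : Function.Bijective (zx.app (op Vertex.star.ob)) := Function.bijective_id
  have sqX : IsPushout (interfaceMap σ.init) h x zx := by
    refine isPushout_of_bijective ?_ (interfaceMap_bijective _) hzx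
      (fun c hc => isEmpty_interface hc) fun c hc => ?_
    · refine hom_ext_interface fun c => ?_
      rw [NatTrans.comp_app_apply, NatTrans.comp_app_apply, interfaceMap_el]
      exact (congrArg (fun z => zx.app _ z) (desc_interfaceEl (Q := Z.diagram)
        (fun c => (x.app _ c : X.elems .star)) c)).symm
    · by_cases hc' : 1 < c.dim
      · have := X.isEmpty_el hc'
        have := Z.isEmpty_el hc'
        have : IsEmpty (el σ.init c) :=
          ⟨fun i => (X.isEmpty_el hc').elim (x.app (op c.ob) i)⟩
        exact ⟨Function.injective_of_subsingleton _, fun z => (X.isEmpty_el hc').elim z⟩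
      · obtain ⟨n, rfl⟩ : ∃ n, c = .ag n := by
          cases c with
          | star => exact absurd hc (lt_irrefl 0)
          | ag n => exact ⟨n, rfl⟩
          | _ => exact absurd (by simp [Vertex.dim]) hc'
        have hz (i : el σ.init (.ag n)) (z : el Z.diagram (.ag n)) :
            x.app _ i ≠ zx.app _ z := by
          intro e
          obtain ⟨z, hz⟩ := z
          refine (Position.mem_filter.1 hz).2 ⟨i, ?_⟩
          rw [e]
          rfl
        constructor
        · rintro (i | z) (i' | z') e
          · exact congrArg _ (hx n e)
          · exact (hz _ _ e).elim
          · exact (hz _ _ e.symm).elim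
          · have e := congrArg Subtype.val e
            exact congrArg _ (Subtype.ext e)
        · rintro ⟨k, hk⟩
          by_cases hi : ∃ i : el σ.init (.ag n), X.agent (x.app _ i) = ⟨(n, k), hk⟩
          · obtain ⟨i, hi⟩ := hi
            refine ⟨.inl i, Subtype.ext ?_⟩
            exact congrArg (fun a : X.Agent => a.1.2) hi
          · exact ⟨.inr ⟨k, Position.mem_filter.2 ⟨hk, hi⟩⟩, rfl⟩
  -- The interface maps to the final position since that position contains every channel of the
  -- seed.
  have hj (c : el σ.init .star) : ∃ f : el σ.final .star,
      σ.cospan.s.app _ f = σ.cospan.t.app _ c := σ.s_star_surjective _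
  choose j₀ hj₀ using hj
  let j : interface σ.init ⟶ σ.final := Sigma.desc fun c : el σ.init .star =>
    nameOf (P := σ.final) (j₀ c)
  have hj : j ≫ σ.cospan.s = interfaceMap σ.init ≫ σ.cospan.t := by
    refine hom_ext_interface fun c => ?_
    rw [NatTrans.comp_app_apply, NatTrans.comp_app_apply, interfaceMap_el, ← hj₀]
    exact congrArg (fun z => σ.cospan.s.app _ z) (desc_interfaceEl j₀ c)
  have hY : IsPosition (pushout j h) :=
    .of_isPushout (.of_hasPushout _ _) σ.isPosition_final Z.isPosition
  -- The final position is a pushout of diagrams; its elements are renumbered to obtain a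
  -- `Position`.
  obtain ⟨Y, ⟨φ⟩⟩ := hY.exists_position
  let U := pushout (interfaceMap σ.init ≫ σ.cospan.t) h
  let μ : σ.cospan.mid ⟶ U := pushout.inl _ _
  let zu : Z.diagram ⟶ U := pushout.inr _ _
  have sqU : IsPushout (interfaceMap σ.init ≫ σ.cospan.t) h μ zu := .of_hasPushout _ _
  let M : Cospan Y.diagram X.diagram :=
    ⟨U, φ.hom ≫ pushout.desc (σ.cospan.s ≫ μ) zu (by rw [reassoc_of% hj, ← sqU.w, Category.assoc]),
      sqX.desc (σ.cospan.t ≫ μ) zu (by rw [← sqU.w, Category.assoc])⟩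
  refine ⟨Y, M, ⟨Z.diagram, Z.isPosition, h, j, x, zx, μ, zu, pushout.inl _ _ ≫ φ.inv,
    pushout.inr _ _ ≫ φ.inv, hj, sqX, sqU, ?_, sqX.inl_desc _ _ _, sqX.inr_desc _ _ _, ?_, ?_⟩, rfl⟩
  · exact (IsPushout.of_hasPushout j h).of_iso (Iso.refl _) (Iso.refl _) (Iso.refl _) φ.symm
      (by simp) (by simp) (by simp) (by simp)
  · exact (Category.assoc _ _ _).trans
      ((congrArg (_ ≫ ·) (φ.inv_hom_id_assoc _)).trans (pushout.inl_desc _ _ _))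
  · exact (Category.assoc _ _ _).trans
      ((congrArg (_ ≫ ·) (φ.inv_hom_id_assoc _)).trans (pushout.inr_desc _ _ _))

/-! ### Edges of `𝕄` are matched by edges of `𝕊` -/

theorem exists_beh {Y : Position} (F : ∀ a : Ag Y.diagram, DefBeh a.1) :
    ∃ B : Beh Y, B.IsDefinite ∧ ∀ (n : ℕ) (a : el Y.diagram (.ag n)), B.el a = (F ⟨n, a⟩).1 :=
  ⟨.ofFamily fun a => (F (Y.agEquiv a)).1, fun a => (F (Y.agEquiv a)).2, fun _ _ => rfl⟩

/-- The target of an edge of `𝕊` over a given action, with given components on active agents. -/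
theorem ActionData.exists_vertex {σ : Seed} {x : SVertex} {Y : Position}
    {M : Cospan Y.diagram x.pos.diagram} (d : ActionData σ M)
    (F : ∀ a : Ag σ.final, DefBeh a.1) :
    ∃ B : Beh Y, B.IsDefinite ∧
      (∀ (n : ℕ) (f : el σ.final (.ag n)), B.el (d.y.app _ f) = (F ⟨n, f⟩).1) ∧
      ∀ (n : ℕ) (z : el d.Z (.ag n)), B.el (d.zy.app _ z) = x.beh.el (d.zx.app _ z) := by
  obtain ⟨H, hF, hG⟩ := exists_glue (β := fun a => DefBeh a.1)
    (ag_bijective d.sqY fun _ => isEmpty_interface (ag_dim_pos _)) F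
    fun a => ⟨x.beh.el (d.zx.app _ a.2), x.definite _⟩
  obtain ⟨B, hB, hB'⟩ := exists_beh H
  exact ⟨B, hB, fun n f => (hB' _ _).trans (congrArg Subtype.val (hF ⟨n, f⟩)),
    fun n z => (hB' _ _).trans (congrArg Subtype.val (hG ⟨n, z⟩))⟩

theorem mem_values {A β : Type*} [Finite A] {f : A → β} {b : β} :
    b ∈ values f ↔ ∃ a, f a = b := by
  have := Fintype.ofFinite A
  rw [values_eq]
  simp

/-- Even if the two values coincide, multiplicities provide two different agents, as a
synchronisation requires: the second is found after erasing the first. -/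
theorem exists_pair_of_values {A β : Type*} [Finite A] {f : A → β} {b b' : β} {S : Multiset β}
    (h : values f = S + {b, b'}) : ∃ a a', a ≠ a' ∧ f a = b ∧ f a' = b' := by
  classical
  have := Fintype.ofFinite A
  rw [values_eq, Multiset.insert_eq_cons, Multiset.add_cons, ← Multiset.map_eq_cons] at h
  obtain ⟨a, -, rfl, h⟩ := h
  have hb : b' ∈ ((Finset.univ : Finset A).val.erase a).map f := by
    rw [h]
    simp
  obtain ⟨a', ha', rfl⟩ := Multiset.mem_map.1 hb
  refine ⟨a, a', ?_, rfl, rfl⟩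
  rintro rfl
  exact (Multiset.Nodup.notMem_erase Finset.univ.nodup) ha'

theorem rel_singleton_right {α β : Type*} {r : α → β → Prop} {b : β} {S : Multiset α} :
    Multiset.Rel r S {b} ↔ ∃ a, r a b ∧ S = {a} := by
  rw [← Multiset.rel_flip]
  exact rel_singleton_left

theorem rel_pair_right {α β : Type*} {r : α → β → Prop} {b b' : β} {S : Multiset α} :
    Multiset.Rel r S {b, b'} ↔ ∃ a a', r a b ∧ r a' b' ∧ S = {a, a'} := by
  rw [← Multiset.rel_flip]
  exact rel_pair_left

theorem ItemRel.exists_agent {x : SVertex} {γ : Finset ℕ}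
    {e : {c // c ∈ x.pos.chan} → {c // c ∈ γ}} {a : Ag x.pos.diagram} {n : ℕ} {D : DefBeh n}
    {ρ : Fin n → {c // c ∈ γ}} (h : ItemRel e (x.item a) ⟨n, D, ρ⟩) :
    ∃ a' : el x.pos.diagram (.ag n), a = ⟨n, a'⟩ ∧ Nonempty (x.beh.el a' ≅ D.1) ∧
      ∀ i, e ((Edge.port n i).act x.pos.diagram a') = ρ i := by
  obtain ⟨m, a⟩ := a
  obtain ⟨D', i, h⟩ := h
  cases h
  exact ⟨a, rfl, i, fun _ => rfl⟩

section

variable {x : SVertex} {γ : Finset ℕ} {e : {c // c ∈ x.pos.chan} ≃ {c // c ∈ γ}}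
  {T : Multiset (Item γ)}

/-- Realises a one-item rule: the item is matched by some agent, on which the seed is grafted. The
final agent receives the prescribed residual and the passive agents keep their behaviours. -/
theorem exists_basic_action {p n : ℕ} {b : Basic p n} {D : DefBeh n} {ρ : Fin n → {c // c ∈ γ}}
    (hx : Multiset.Rel (ItemRel e) (values x.item) (T + {⟨n, D, ρ⟩})) (k : D.after b) :
    ∃ (y : SVertex) (M : Cospan y.pos.diagram x.pos.diagram) (d : ActionData (.act b) M),
      SResidue x.beh y.beh M ∧
      Multiset.Rel (ItemRel e) (values (x.item ∘ Ag.map d.zx)) T ∧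
      (∀ (p : ℕ) (z : el d.Z (.ag p)),
        Nonempty (y.beh.el (d.zy.app _ z) ≅ x.beh.el (d.zx.app _ z))) ∧
      y.beh.el (d.y.app _ (gen (.ag p))) = (D.next b k).1 ∧
      ∀ i, e ((Edge.port n i).act x.pos.diagram (d.x.app _ (gen (.ag n)))) = ρ i := by
  obtain ⟨A, B, hA, hB, hAB⟩ := Multiset.rel_add_right.1 hx
  obtain ⟨J, hJ, rfl⟩ := rel_singleton_right.1 hB
  obtain ⟨a, rfl⟩ : ∃ a, x.item a = J := mem_values.1 (by rw [hAB]; simp)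
  obtain ⟨a, rfl, ⟨i⟩, hρ⟩ := hJ.exists_agent
  obtain ⟨Y, M, d, hd⟩ := exists_actionData (σ := .act b) (nameOf (P := x.pos.diagram) a)
    fun n => Function.injective_of_subsingleton (α := el (ind _) (.ag n)) _
  have ha : d.x.app _ (gen (.ag n)) = a := by
    rw [hd]
    exact nameOf_gen a
  rw [d.values_x, values_ind] at hAB
  replace hAB : values (x.item ∘ Ag.map d.zx) + {x.item ⟨n, d.x.app _ (gen (.ag n))⟩} =
    A + {x.item ⟨n, a⟩} := hAB
  rw [ha] at hAB
  -- Cancelling the item of the active agent shows that the remaining items, matched with `T`, are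
  -- those of the passive agents.
  obtain rfl := add_right_cancel hAB
  obtain ⟨F, hF⟩ := exists_glue_ind (β := fun a => DefBeh a.1) (D.next b k)
  obtain ⟨B, hB, hBy, hBz⟩ := d.exists_vertex F
  have hgen : B.el (d.y.app _ (gen (.ag p))) = (D.next b k).1 :=
    (hBy _ _).trans (congrArg Subtype.val hF)
  refine ⟨⟨Y, B, hB⟩, M, d, ?_, hA, fun p z => ⟨eqToIso (hBz p z)⟩, hgen, ha.symm ▸ hρ⟩
  refine (sResidue_iff d _ x.definite _).2 fun q y => ?_
  rcases d.agents_Y y with ⟨f, rfl⟩ | ⟨z, rfl⟩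
  · obtain ⟨rfl, rfl⟩ := el_ind f
    refine (agentResidue_act x.beh d _).2 ?_
    rw [ha]
    refine IndBeh.Next.congr (B := D.1) ⟨k, ⟨Iso.refl _⟩⟩ i.symm (eqToIso hgen.symm)
  · exact (d.agentResidue_passive _ _ _).2 ⟨eqToIso (hBz q z)⟩

theorem exists_fork {n : ℕ} {D : DefBeh n} {ρ : Fin n → {c // c ∈ γ}}
    (hx : Multiset.Rel (ItemRel e) (values x.item) (T + {⟨n, D, ρ⟩})) (k : D.after (.forkL n))
    (l : D.after (.forkR n)) :
    ∃ (y : SVertex) (M : Cospan y.pos.diagram x.pos.diagram) (d : ActionData (.fork n) M),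
      SResidue x.beh y.beh M ∧
      Multiset.Rel (ItemRel e) (values (x.item ∘ Ag.map d.zx)) T ∧
      (∀ (p : ℕ) (z : el d.Z (.ag p)),
        Nonempty (y.beh.el (d.zy.app _ z) ≅ x.beh.el (d.zx.app _ z))) ∧
      y.beh.el (d.y.app _ ((twinL n).app _ (gen (.ag n)))) = (D.next _ k).1 ∧
      y.beh.el (d.y.app _ ((twinR n).app _ (gen (.ag n)))) = (D.next _ l).1 ∧
      ∀ i, e ((Edge.port n i).act x.pos.diagram (d.x.app _ (gen (.ag n)))) = ρ i := by
  obtain ⟨A, B, hA, hB, hAB⟩ := Multiset.rel_add_right.1 hx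
  obtain ⟨J, hJ, rfl⟩ := rel_singleton_right.1 hB
  obtain ⟨a, rfl⟩ : ∃ a, x.item a = J := mem_values.1 (by rw [hAB]; simp)
  obtain ⟨a, rfl, ⟨i⟩, hρ⟩ := hJ.exists_agent
  obtain ⟨Y, M, d, hd⟩ := exists_actionData (σ := .fork n) (nameOf (P := x.pos.diagram) a)
    fun n => Function.injective_of_subsingleton (α := el (ind _) (.ag n)) _
  have ha : d.x.app _ (gen (.ag n)) = a := by
    rw [hd]
    exact nameOf_gen a
  rw [d.values_x, values_ind] at hAB
  replace hAB : values (x.item ∘ Ag.map d.zx) + {x.item ⟨n, d.x.app _ (gen (.ag n))⟩} =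
    A + {x.item ⟨n, a⟩} := hAB
  rw [ha] at hAB
  obtain rfl := add_right_cancel hAB
  obtain ⟨F, hF⟩ := exists_glue_ind (β := fun a => DefBeh a.1) (D.next _ k)
  obtain ⟨G, hG⟩ := exists_glue_ind (β := fun a => DefBeh a.1) (D.next _ l)
  -- The two final agents are distinct, so their residuals can be prescribed independently.
  obtain ⟨H, hHF, hHG⟩ := exists_glue (β := fun a => DefBeh a.1) (ag_twin n) F G
  obtain ⟨B, hB, hBy, hBz⟩ := d.exists_vertex H
  have hL : B.el (d.y.app _ ((twinL n).app _ (gen (.ag n)))) = (D.next _ k).1 :=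
    (hBy _ _).trans (congrArg Subtype.val ((hHF _).trans hF))
  have hR : B.el (d.y.app _ ((twinR n).app _ (gen (.ag n)))) = (D.next _ l).1 :=
    (hBy _ _).trans (congrArg Subtype.val ((hHG _).trans hG))
  refine ⟨⟨Y, B, hB⟩, M, d, ?_, hA, fun p z => ⟨eqToIso (hBz p z)⟩, hL, hR, ha.symm ▸ hρ⟩
  refine (sResidue_iff d _ x.definite _).2 fun q y => ?_
  rcases d.agents_Y y with ⟨f, rfl⟩ | ⟨z, rfl⟩
  · obtain ⟨h, rfl | rfl⟩ := el_twin f <;> cases h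
    · refine (agentResidue_forkL x.beh d _).2 ?_
      rw [ha]
      exact IndBeh.Next.congr (B := D.1) ⟨k, ⟨Iso.refl _⟩⟩ i.symm (eqToIso hL.symm)
    · refine (agentResidue_forkR x.beh d _).2 ?_
      rw [ha]
      exact IndBeh.Next.congr (B := D.1) ⟨l, ⟨Iso.refl _⟩⟩ i.symm (eqToIso hR.symm)
  · exact (d.agentResidue_passive _ _ _).2 ⟨eqToIso (hBz q z)⟩

/-- The map from `[m] c|a [n]` to a position that picks two agents. -/
theorem exists_link {X : Position} {m n : ℕ} {c : Fin m} {a : Fin n} (f : el X.diagram (.ag m))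
    (g : el X.diagram (.ag n))
    (h : (Edge.port m c).act X.diagram f = (Edge.port n a).act X.diagram g)
    (hne : (⟨m, f⟩ : Ag X.diagram) ≠ ⟨n, g⟩) :
    ∃ x : link m c n a ⟶ X.diagram, (∀ k, Function.Injective (x.app (op (Vertex.ag k).ob))) ∧
      x.app _ ((linkL m c n a).app _ (gen (.ag m))) = f ∧
      x.app _ ((linkR m c n a).app _ (gen (.ag n))) = g := by
  let x : link m c n a ⟶ X.diagram :=
    pushout.desc (nameOf (P := X.diagram) f) (nameOf (P := X.diagram) g) (by
      rw [Edge.rep_nameOf, Edge.rep_nameOf, h])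
  have hL : x.app _ ((linkL m c n a).app _ (gen (.ag m))) = f := by
    rw [← NatTrans.comp_app_apply]
    exact (app_gen_congr (pushout.inl_desc _ _ _)).trans (nameOf_gen f)
  have hR : x.app _ ((linkR m c n a).app _ (gen (.ag n))) = g := by
    rw [← NatTrans.comp_app_apply]
    exact (app_gen_congr (pushout.inr_desc _ _ _)).trans (nameOf_gen g)
  refine ⟨x, fun k u v huv => ?_, hL, hR⟩
  obtain ⟨h₁, rfl⟩ | ⟨h₁, rfl⟩ := el_link u <;> obtain ⟨h₂, rfl⟩ | ⟨h₂, rfl⟩ := el_link v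
  · rfl
  · cases h₁
    cases h₂
    exact (hne (by rw [← hL, ← hR]; exact congrArg _ huv)).elim
  · cases h₁
    cases h₂
    exact (hne (by rw [← hL, ← hR]; exact congrArg _ huv.symm)).elim
  · rfl

theorem exists_sync {n m : ℕ} {D : DefBeh n} {ρ : Fin n → {c // c ∈ γ}} {D' : DefBeh m}
    {ρ' : Fin m → {c // c ∈ γ}} {a : Fin n} {c o : Fin m}
    (hx : Multiset.Rel (ItemRel e) (values x.item) (T + {⟨n, D, ρ⟩, ⟨m, D', ρ'⟩}))
    (k : D.after (.inp n a)) (l : D'.after (.out m c o)) (h : ρ a = ρ' c) :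
    ∃ (y : SVertex) (M : Cospan y.pos.diagram x.pos.diagram) (d : ActionData (.sync n a m c o) M),
      SResidue x.beh y.beh M ∧
      Multiset.Rel (ItemRel e) (values (x.item ∘ Ag.map d.zx)) T ∧
      (∀ (p : ℕ) (z : el d.Z (.ag p)),
        Nonempty (y.beh.el (d.zy.app _ z) ≅ x.beh.el (d.zx.app _ z))) ∧
      y.beh.el (d.y.app _ ((link₂R m c o (n + 1) (Fin.castSucc a) (Fin.last n)).app _
        (gen (.ag (n + 1))))) = (D.next _ k).1 ∧
      y.beh.el (d.y.app _ ((link₂L m c o (n + 1) (Fin.castSucc a) (Fin.last n)).app _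
        (gen (.ag m)))) = (D'.next _ l).1 ∧
      (∀ i, e ((Edge.port n i).act x.pos.diagram
        (d.x.app _ ((linkR m c n a).app _ (gen (.ag n))))) = ρ i) ∧
      ∀ i, e ((Edge.port m i).act x.pos.diagram
        (d.x.app _ ((linkL m c n a).app _ (gen (.ag m))))) = ρ' i := by
  obtain ⟨A, B, hA, hB, hAB⟩ := Multiset.rel_add_right.1 hx
  obtain ⟨I, J, hI, hJ, rfl⟩ := rel_pair_right.1 hB
  obtain ⟨f, g, hne, rfl, rfl⟩ := exists_pair_of_values hAB
  obtain ⟨f, rfl, ⟨i⟩, hρ⟩ := hI.exists_agent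
  obtain ⟨g, rfl, ⟨i'⟩, hρ'⟩ := hJ.exists_agent
  -- The subjects have the same name by `h`, so they are the same channel of the position since the
  -- naming `e` is injective. Distinctness of the agents makes the map injective on agents.
  obtain ⟨u, hu, hL, hR⟩ := exists_link (c := c) (a := a) g f
    (e.injective ((hρ' c).trans (h.symm.trans (hρ a).symm))) hne.symm
  obtain ⟨Y, M, d, hd⟩ := exists_actionData (σ := .sync n a m c o) u hu
  rw [← hd] at hL hR
  rw [d.values_x, values_pair (ag_link m c n a)] at hAB
  replace hAB : values (x.item ∘ Ag.map d.zx) +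
    {x.item ⟨m, d.x.app _ ((linkL m c n a).app _ (gen (.ag m)))⟩,
      x.item ⟨n, d.x.app _ ((linkR m c n a).app _ (gen (.ag n)))⟩} =
    A + {x.item ⟨n, f⟩, x.item ⟨m, g⟩} := hAB
  rw [hL, hR, Multiset.pair_comm] at hAB
  obtain rfl := add_right_cancel hAB
  obtain ⟨F, hF⟩ := exists_glue_ind (β := fun a => DefBeh a.1) (D'.next _ l)
  obtain ⟨G, hG⟩ := exists_glue_ind (β := fun a => DefBeh a.1) (D.next _ k)
  obtain ⟨H, hHF, hHG⟩ := exists_glue (β := fun a => DefBeh a.1)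
    (ag_link₂ m c o (n + 1) (Fin.castSucc a) (Fin.last n)) F G
  obtain ⟨B, hB, hBy, hBz⟩ := d.exists_vertex H
  have hFL : B.el (d.y.app _ ((link₂L m c o (n + 1) (Fin.castSucc a) (Fin.last n)).app _
      (gen (.ag m)))) = (D'.next _ l).1 :=
    (hBy _ _).trans (congrArg Subtype.val ((hHF _).trans hF))
  have hGR : B.el (d.y.app _ ((link₂R m c o (n + 1) (Fin.castSucc a) (Fin.last n)).app _
      (gen (.ag (n + 1))))) = (D.next _ k).1 :=
    (hBy _ _).trans (congrArg Subtype.val ((hHG _).trans hG))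
  refine ⟨⟨Y, B, hB⟩, M, d, ?_, hA, fun p z => ⟨eqToIso (hBz p z)⟩, hGR, hFL, hR.symm ▸ hρ,
    hL.symm ▸ hρ'⟩
  refine (sResidue_iff d _ x.definite _).2 fun q y => ?_
  rcases d.agents_Y y with ⟨v, rfl⟩ | ⟨z, rfl⟩
  · obtain ⟨h, rfl⟩ | ⟨h, rfl⟩ := el_link₂ v <;> cases h
    · refine (agentResidue_syncL x.beh d _).2 ?_
      rw [hL]
      exact IndBeh.Next.congr (B := D'.1) ⟨l, ⟨Iso.refl _⟩⟩ i'.symm (eqToIso hFL.symm)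
    · refine (agentResidue_syncR x.beh d _).2 ?_
      rw [hR]
      exact IndBeh.Next.congr (B := D.1) ⟨k, ⟨Iso.refl _⟩⟩ i.symm (eqToIso hGR.symm)
  · exact (d.agentResidue_passive _ _ _).2 ⟨eqToIso (hBz q z)⟩

end

theorem Item.weaken_self {γ : Finset ℕ} (h : γ ⊆ γ) (S : Multiset (Item γ)) :
    S.map (Item.weaken h) = S := Multiset.map_id _

/-- Edges of `𝕄` in context are matched by edges of `𝕊`. -/
theorem Matches.exists_sStep_context {N N' : Mixed} {α : Label} (h : MStep α N N') :
    ∃ hγ : N.chan ⊆ N'.chan, ∀ (x : SVertex) (T : Multiset (Item N.chan)),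
      Matches x ⟨N.chan, T + N.items⟩ →
        ∃ y, SStep α x y ∧ Matches y ⟨N'.chan, T.map (Item.weaken hγ) + N'.items⟩ := by
  -- Carrying an arbitrary context `T` makes the induction go through: the context rule merely moves
  -- its multiset `S` into `T`.
  induction h with
  | fork D ρ i j =>
    refine ⟨subset_rfl, fun x T ⟨e, hx⟩ => ?_⟩
    obtain ⟨y, M, d, hM, hT, hZ, hL, hR, hρ⟩ := exists_fork hx i j
    obtain ⟨e', he'⟩ := d.exists_names (Seed.t_star_surjective_fork _) e
    refine ⟨y, .action (.fork _) M d.isActionOf hM, e', ?_⟩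
    rw [d.values_y, values_pair (ag_twin _)]
    exact (d.rel_passive _ (fun c c' hc => congrArg Subtype.val (he' c c' hc)) hZ hT).add
      (rel_pair_left.2 ⟨_, _,
        itemRel_item ⟨eqToIso hL⟩ fun j => (he' _ _ (port_forkL d j)).trans (hρ j),
        itemRel_item ⟨eqToIso hR⟩ fun j => (he' _ _ (port_forkR d j)).trans (hρ j), rfl⟩)
  | tau D ρ i =>
    refine ⟨subset_rfl, fun x T ⟨e, hx⟩ => ?_⟩
    obtain ⟨y, M, d, hM, hT, hZ, hB, hρ⟩ := exists_basic_action hx i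
    obtain ⟨e', he'⟩ := d.exists_names (Seed.t_star_surjective_act _) e
    refine ⟨y, .action (.tau _) M d.isActionOf hM, e', ?_⟩
    rw [d.values_y, values_ind]
    exact (d.rel_passive _ (fun c c' hc => congrArg Subtype.val (he' c c' hc)) hZ hT).add
      (rel_singleton_left.2 ⟨_,
        itemRel_item ⟨eqToIso hB⟩ fun j => (he' _ _ (port_act d j)).trans (hρ j), rfl⟩)
  | tick D ρ i =>
    refine ⟨subset_rfl, fun x T ⟨e, hx⟩ => ?_⟩
    obtain ⟨y, M, d, hM, hT, hZ, hB, hρ⟩ := exists_basic_action hx i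
    obtain ⟨e', he'⟩ := d.exists_names (Seed.t_star_surjective_act _) e
    refine ⟨y, .action (.tick _) M d.isActionOf hM, e', ?_⟩
    rw [d.values_y, values_ind]
    exact (d.rel_passive _ (fun c c' hc => congrArg Subtype.val (he' c c' hc)) hZ hT).add
      (rel_singleton_left.2 ⟨_,
        itemRel_item ⟨eqToIso hB⟩ fun j => (he' _ _ (port_act d j)).trans (hρ j), rfl⟩)
  | nu D ρ i a ha =>
    refine ⟨Finset.subset_insert _ _, fun x T ⟨e, hx⟩ => ?_⟩
    obtain ⟨y, M, d, hM, hT, hZ, hB, hρ⟩ := exists_basic_action hx i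
    obtain ⟨e', he', hnew⟩ := d.exists_names_nu e ha
    refine ⟨y, .action (.nu _) M d.isActionOf hM, e', ?_⟩
    rw [d.values_y, values_ind]
    exact (d.rel_passive _ he' hZ hT).add
      (rel_singleton_left.2 ⟨_, itemRel_snoc ⟨eqToIso hB⟩
        (fun j => Subtype.ext (a2 := ⟨_, Finset.mem_insert_of_mem (ρ j).2⟩)
          ((he' _ _ (port_act d j)).trans (congrArg Subtype.val (hρ j))))
        (Subtype.ext (hnew _ (port_newChan d))), rfl⟩)
  | sync D₁ ρ₁ D₂ ρ₂ a₁ a₂ b₂ i j h =>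
    refine ⟨subset_rfl, fun x T ⟨e, hx⟩ => ?_⟩
    obtain ⟨y, M, d, hM, hT, hZ, hR, hL, hρ, hρ'⟩ := exists_sync hx i j h
    obtain ⟨e', he'⟩ := d.exists_names (Seed.t_star_surjective_sync _ _ _ _ _) e
    refine ⟨y, .action (.sync _ _ _ _ _) M d.isActionOf hM, e', ?_⟩
    rw [d.values_y, values_pair (ag_link₂ _ _ _ _ _ _), Multiset.pair_comm (α := Item y.pos.chan)]
    exact (d.rel_passive _ (fun c c' hc => congrArg Subtype.val (he' c c' hc)) hZ hT).add
      (rel_pair_left.2 ⟨_, _,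
        itemRel_snoc ⟨eqToIso hR⟩ (fun j => (he' _ _ (port_syncR d j)).trans (hρ j))
          ((he' _ _ (port_syncR_last d)).trans (hρ' _)),
        itemRel_item ⟨eqToIso hL⟩ fun j => (he' _ _ (port_syncL d j)).trans (hρ' j), rfl⟩)
  | @context α γ₁ γ₂ S₁ S₂ S hγ h ih =>
    obtain ⟨_, ih⟩ := ih
    refine ⟨hγ, fun x T hx => ?_⟩
    obtain ⟨y, hy, h'⟩ := ih x (T + S) (by simpa only [add_assoc] using hx)
    refine ⟨y, hy, ?_⟩
    simpa only [add_assoc, Multiset.map_add] using h'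
  | refl N =>
    refine ⟨subset_rfl, fun x T hx => ⟨x, .refl x, ?_⟩⟩
    rwa [Item.weaken_self]

theorem Matches.exists_sStep {x : SVertex} {N N' : Mixed} {α : Label} (hx : Matches x N)
    (h : MStep α N N') : ∃ y, SStep α x y ∧ Matches y N' := by
  obtain ⟨hγ, h⟩ := Matches.exists_sStep_context h
  simpa only [Multiset.map_zero, zero_add] using
    h x 0 (by simpa only [zero_add] using hx)

/-! ### Testing -/

theorem interfaceTo_el (X Y : Position) (e : X.chan = Y.chan) (c : X.elems .star) :
    (X.interfaceTo Y e).app _ (interfaceEl (P := X.diagram) c) =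
      (⟨c.1, e ▸ c.2⟩ : Y.elems .star) :=
  desc_interfaceEl (P := X.diagram) (Q := Y.diagram)
    (fun c : X.elems .star => (⟨c.1, e ▸ c.2⟩ : Y.elems .star)) c

theorem interface_square {X Z : Position} {U : Diagram} {e : X.chan = Z.chan}
    {l : X.diagram ⟶ U} {r : Z.diagram ⟶ U}
    (w : interfaceMap X.diagram ≫ l = X.interfaceTo Z e ≫ r) (c : X.elems .star) :
    l.app (op Vertex.star.ob) c =
      r.app (op Vertex.star.ob) (⟨c.1, e ▸ c.2⟩ : Z.elems .star) := by
  have h := congrArg (fun f => f.app (op Vertex.star.ob) (interfaceEl (P := X.diagram) c)) w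
  simp only [NatTrans.comp_app_apply] at h
  exact (congrArg (fun z => l.app _ z) (interfaceMap_el (P := X.diagram) c)).symm.trans
    (h.trans (congrArg (fun z => r.app (op Vertex.star.ob) z) (interfaceTo_el X Z e c)))

theorem rel_values {A β δ : Type*} [Finite A] {r : β → δ → Prop} {f : A → β} {g : A → δ}
    (h : ∀ a, r (f a) (g a)) : Multiset.Rel r (values f) (values g) := by
  have := Fintype.ofFinite A
  rw [values_eq, values_eq, Multiset.rel_map]
  exact Multiset.rel_refl_of_refl_on fun a _ => h a

/-- The agents of a pushout over the interface are the sum of those of the two sides, with the same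
behaviours up to isomorphism; its channels are the common channels, with names recovered by
inverting the right inclusion. -/
theorem STest.exists_mTest {x z u : SVertex} (h : STest x z u) :
    ∃ N, MTest (mixed x) (mixed z) N ∧ Matches u N := by
  obtain ⟨⟨γ, agents, port⟩, B, hB⟩ := x
  obtain ⟨⟨γ', agents', port'⟩, B', hB'⟩ := z
  obtain ⟨e, l, r, sq, ⟨i⟩, ⟨i'⟩⟩ := h
  change γ = γ' at e
  subst e
  refine ⟨_, .mk γ _ _, ?_⟩
  have hr := pushout_inr_bijective sq (interfaceMap_bijective _)
  have hlr (c : {c // c ∈ γ}) : l.app (op Vertex.star.ob) c = r.app (op Vertex.star.ob) c :=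
    interface_square sq.w c
  let e : {c // c ∈ u.pos.chan} ≃ {c // c ∈ γ} := (Equiv.ofBijective _ hr).symm
  have he (c : {c // c ∈ γ}) : e (r.app (op Vertex.star.ob) c) = c :=
    (Equiv.ofBijective _ hr).symm_apply_apply c
  refine ⟨e, ?_⟩
  rw [values_sum (ag_bijective sq fun _ => isEmpty_interface (ag_dim_pos _))]
  refine Multiset.Rel.add ?_ ?_
  · change Multiset.Rel _ _ (mixed ⟨⟨γ, agents, port⟩, B, hB⟩).items
    rw [mixed_items]
    refine rel_values fun a => ?_
    refine itemRel_item ⟨(Beh.atIso i (Position.agent _ a.2)).symm⟩ fun k => ?_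
    rw [← Edge.act_app]
    exact (congrArg e (hlr _)).trans (he _)
  · change Multiset.Rel _ _ (mixed ⟨⟨γ, agents', port'⟩, B', hB'⟩).items
    rw [mixed_items]
    refine rel_values fun a => ?_
    refine itemRel_item ⟨(Beh.atIso i' (Position.agent _ a.2)).symm⟩ fun k => ?_
    rw [← Edge.act_app]
    exact he _

/-- The pushout of the two positions is renumbered as a position and the two families of behaviours
are glued over its agents. -/
theorem exists_sTest {x z : SVertex} (e : x.pos.chan = z.pos.chan) : ∃ u, STest x z u := by
  have sq := IsPushout.of_hasPushout (interfaceMap x.pos.diagram) (x.pos.interfaceTo z.pos e)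
  obtain ⟨U, ⟨φ⟩⟩ := (IsPosition.of_isPushout sq x.pos.isPosition z.pos.isPosition).exists_position
  replace sq : IsPushout (interfaceMap x.pos.diagram) (x.pos.interfaceTo z.pos e)
      (pushout.inl _ _ ≫ φ.inv) (pushout.inr _ _ ≫ φ.inv) :=
    sq.of_iso (Iso.refl _) (Iso.refl _) (Iso.refl _) φ.symm (by simp) (by simp) (by simp) (by simp)
  obtain ⟨H, hF, hG⟩ := exists_glue (β := fun a => DefBeh a.1)
    (ag_bijective sq fun _ => isEmpty_interface (ag_dim_pos _))
    (fun a : Ag x.pos.diagram => (x.item a).beh) fun a : Ag z.pos.diagram => (z.item a).beh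
  obtain ⟨B, hB, hB'⟩ := exists_beh H
  refine ⟨⟨U, B, hB⟩, e, _, _, sq, ⟨Beh.isoOfAt fun a => ?_⟩, ⟨Beh.isoOfAt fun a => ?_⟩⟩
  · exact eqToIso ((hB' _ _).trans (congrArg Subtype.val (hF (x.pos.agEquiv a)))).symm
  · exact eqToIso ((hB' _ _).trans (congrArg Subtype.val (hG (z.pos.agEquiv a)))).symm

theorem MTest.chan_eq {N N' K : Mixed} (h : MTest N N' K) : N.chan = N'.chan := by
  cases h
  rfl

theorem MTest.unique {N N' K K' : Mixed} (h : MTest N N' K) (h' : MTest N N' K') : K = K' := by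
  cases h
  cases h'
  rfl

theorem coh_iff {x z : SVertex} : Coh STest x z ↔ Coh MTest (mixed x) (mixed z) := by
  constructor
  · rintro ⟨u, h⟩
    obtain ⟨N, hN, -⟩ := h.exists_mTest
    exact ⟨N, hN⟩
  · rintro ⟨N, h⟩
    exact exists_sTest (x := x) (z := z) h.chan_eq

/-! ### Surjectivity -/

theorem values_comp {A C β : Type*} [Finite A] {u : A → C} (h : Function.Bijective u)
    (f : C → β) : values f = values (f ∘ u) := by
  have := Fintype.ofFinite A
  have := Fintype.ofBijective _ h
  rw [values_eq, values_eq, ← Finset.map_univ_equiv (Equiv.ofBijective _ h), Finset.map_val,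
    Multiset.map_map]
  rfl

theorem values_get {β : Type*} (L : List β) : values L.get = L := by
  rw [values_eq, Fin.univ_val_map, List.ofFn_get]

/-- The multiset is listed and agents are numbered by their index in the list, so that repeated
items become different agents. -/
theorem mixed_surjective : Function.Surjective mixed := by
  classical
  rintro ⟨γ, S⟩
  obtain ⟨L, rfl⟩ := Quot.exists_rep S
  let agents : Finset (ℕ × ℕ) := Finset.univ.image fun i : Fin L.length => ((L.get i).arity, i.1)
  have h (a : {a // a ∈ agents}) : ∃ (D : DefBeh a.1.1) (ρ : Fin a.1.1 → {c // c ∈ γ})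
      (i : Fin L.length), i.1 = a.1.2 ∧ L.get i = ⟨a.1.1, D, ρ⟩ := by
    obtain ⟨⟨n, k⟩, h⟩ := a
    obtain ⟨i, -, hi⟩ := Finset.mem_image.1 h
    cases hi
    exact ⟨_, _, i, rfl, rfl⟩
  choose D ρ i hi hD using h
  let x : SVertex := ⟨⟨γ, agents, ρ⟩, .ofFamily fun a => (D a).1, fun a => (D a).2⟩
  refine ⟨x, ?_⟩
  have hmem (j : Fin L.length) : ((L.get j).arity, j.1) ∈ agents :=
    Finset.mem_image_of_mem (fun i : Fin L.length => ((L.get i).arity, i.1)) (Finset.mem_univ j)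
  let u : Fin L.length → Ag x.pos.diagram := fun j => x.pos.agEquiv ⟨_, hmem j⟩
  have hu : Function.Bijective u := by
    refine x.pos.agEquiv.bijective.comp ⟨fun j j' h => ?_, fun a => ?_⟩
    · exact Fin.ext (congrArg (fun a : {a // a ∈ agents} => a.1.2) h)
    · obtain ⟨⟨n, k⟩, h⟩ := a
      obtain ⟨j, -, hj⟩ := Finset.mem_image.1 h
      exact ⟨j, Subtype.ext hj⟩
  have hitem : x.item ∘ u = L.get := by
    funext j
    have h₁ : i ⟨_, hmem j⟩ = j := Fin.ext (hi _)
    exact (hD ⟨_, hmem j⟩).symm.trans (congrArg L.get h₁)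
  have h : (mixed x).items = (L : Multiset (Item γ)) := by
    rw [mixed_items, values_comp hu, hitem]
    exact values_get L
  exact congrArg (Mixed.mk γ) h

/-! ### Bisimulation and fair testing -/

section

variable {V W : Type*} {step : Label → V → V → Prop} {step' : Label → W → W → Prop}
  {R : V → W → Prop}

theorem IsBisimulation.flip (hR : IsBisimulation step step' R) :
    IsBisimulation step' step fun y x => R x y := fun y x h => ⟨(hR x y h).2, (hR x y h).1⟩

theorem IsBisimulation.freeStep (hR : IsBisimulation step step' R) {k : ℕ} {x x' : V} {y : W}
    (hxy : R x y) (h : FreeStep step k x x') : ∃ y', FreeStep step' k y y' ∧ R x' y' := by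
  induction h with
  | nil x => exact ⟨y, .nil y, hxy⟩
  | silent _ e ih =>
    obtain ⟨y₁, h₁, hR₁⟩ := ih hxy
    obtain ⟨y₂, h₂, hR₂⟩ := (hR _ _ hR₁).1 _ _ e
    exact ⟨y₂, .silent h₁ h₂, hR₂⟩
  | heart _ e ih =>
    obtain ⟨y₁, h₁, hR₁⟩ := ih hxy
    obtain ⟨y₂, h₂, hR₂⟩ := (hR _ _ hR₁).1 _ _ e
    exact ⟨y₂, .heart h₁ h₂, hR₂⟩

/-- A silent path from `y` is matched by one from `x`; the tick available there is carried back
across the bisimulation. -/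
theorem IsBisimulation.pole (hR : IsBisimulation step step' R) {x : V} {y : W} (hxy : R x y)
    (h : Pole step x) : Pole step' y := by
  intro y' hy'
  obtain ⟨x', hx', hxy'⟩ := hR.flip.freeStep hxy hy'
  obtain ⟨z, hz⟩ := h x' hx'
  obtain ⟨z', hz', -⟩ := hR.freeStep hxy' hz
  exact ⟨z', hz'⟩

end

theorem isBisimulation_matches : IsBisimulation SStep MStep Matches := fun _ _ hx =>
  ⟨fun _ _ h => hx.exists_mStep h, fun _ _ h => hx.exists_sStep h⟩

/-- In the backward direction any vertex of `STest x z` serves: it matches a result of the test in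
𝕄, and that result is unique. -/
theorem passes_iff {x z : SVertex} :
    Passes SStep STest x z ↔ Passes MStep MTest (mixed x) (mixed z) := by
  constructor
  · rintro ⟨u, h, hu⟩
    obtain ⟨N, hN, hm⟩ := h.exists_mTest
    exact ⟨N, hN, isBisimulation_matches.pole hm hu⟩
  · rintro ⟨N, h, hN⟩
    obtain ⟨u, hu⟩ := exists_sTest (x := x) (z := z) h.chan_eq
    obtain ⟨N', hN', hm⟩ := hu.exists_mTest
    obtain rfl := h.unique hN'
    exact ⟨u, hu, isBisimulation_matches.flip.pole hm hN⟩

theorem fairEq_iff {x y : SVertex} :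
    FairEq SStep STest x y ↔ FairEq MStep MTest (mixed x) (mixed y) := by
  -- By surjectivity the tests in 𝕄 may be taken of the form `mixed z`, so both sides quantify over
  -- the same tests.
  rw [FairEq, FairEq, coh_iff, mixed_surjective.forall]
  simp only [coh_iff, passes_iff]

theorem MTest.fairEq_refl (N : Mixed) : FairEq MStep MTest N N :=
  ⟨⟨_, .mk N.chan N.items N.items⟩, fun _ _ => Iff.rfl⟩

end PiTraces

end

theorem mainTheorem7 :
    (∀ x y : PiTraces.SVertex,
      PiTraces.FairEq PiTraces.SStep PiTraces.STest x y ↔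
        PiTraces.FairEq PiTraces.MStep PiTraces.MTest (PiTraces.mixed x) (PiTraces.mixed y)) ∧
    (∀ y : PiTraces.Mixed, ∃ x : PiTraces.SVertex,
      PiTraces.FairEq PiTraces.MStep PiTraces.MTest (PiTraces.mixed x) y) ∧
    Function.Surjective PiTraces.mixed ∧
    (∀ x : PiTraces.SVertex,
      PiTraces.Bisimilar PiTraces.SStep PiTraces.MStep x (PiTraces.mixed x)) := by
  refine ⟨fun x y => PiTraces.fairEq_iff, fun y => ?_, PiTraces.mixed_surjective,
    fun x => ⟨_, PiTraces.isBisimulation_matches, PiTraces.matches_mixed x⟩⟩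
  obtain ⟨x, rfl⟩ := PiTraces.mixed_surjective y
  exact ⟨x, PiTraces.MTest.fairEq_refl _⟩
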